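/- \textbf{Setting.} Let $M$ be a smooth real manifold or a complex manifold (finite-dimensional). Let $\mathcal O_M$ be the sheaf of smooth complex-valued (resp. holomorphic) functions and $TM$ the complexified (resp. holomorphic) tangent bundle; all bundles, sections and forms are smooth complex (resp. holomorphic). A \emph{Lie algebroid} $A$ on $M$ is a vector bundle with a Lie bracket on its sheaf of sections and a bracket-preserving anchor $a:A\to TM$ satisfying the Leibniz rule; $d_A$ is the differential of its de Rham complex $\Omega_A^\bullet=\Gamma(\wedge^\bullet A^*)$. An $A$-connection on a line bundle $L$ is an additive operator $\partial:\mathcal O(L)\to\mathcal O(A^*\otimes L)$ with $\partial(fs)=(d_Af)\otimes s+f\,\partial s$; its curvature is denoted $F_\partial\in\Omega^2_A$. A $\mathbb C^*$-\emph{gerbe} $G$, locally trivialized over an open cover $\{U_i\}$, is given by line bundles $L_{ij}$ on $U_{ij}=U_i\cap U_j$, with $L_{ji}$ dual to $L_{ij}$, and isomorphisms $\theta_{ijk}:L_{ij}\otimes L_{jk}\to L_{ik}$ on $U_{ijk}$ with $\theta_{ikl}(\theta_{ijk}\otimes 1)=\theta_{ijl}(1\otimes\theta_{jkl})$. A \emph{$0$-connection}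 over $A$ on $G$ is a family of $A$-connections $\partial_{ij}$ on $L_{ij}$ with $\partial_{ji}=\partial_{ij}^*$ for which the $\theta_{ijk}$ are flat. An \emph{$A$-connection} $(\partial,B)$ on $G$ is a $0$-connection $\partial$ over $A$ together with $B_i\in\Omega^2_A(U_i)$ such that $B_j-B_i=F_{\partial_{ij}}$ on $U_{ij}$; it is \emph{flat} if $d_AB_i=0$ for all $i$. A change of local trivialization, by line bundles with $A$-connection $(L_i,\nabla_i)$ on $U_i$, replaces $(L_{ij},\theta_{ijk},\partial_{ij},B_i)$ by $$(L_{ij}\otimes L_i\otimes L_j^*,\ \theta_{ijk}\otimes\mathrm{id}_{L_i\otimes L_k^*},\ \partial_{ij}+\nabla_i+\nabla_j^*,\ B_i-F_{\nabla_i}).\qquad(*)$$ Let $\partial$ be a $0$-connection over $TM$ on $G$. The \emph{Courant algebroid} $E_\partial$, with projection $\pi:E_\partial\to TM$, is obtained by gluing $\mathbb TU_i=TU_i\oplus T^*U_i$ to $\mathbb TU_j$ by $e^{F_{\partial_{ij}}}$, where $e^F(X+\xi)=X+\xi+i_XF$. It carries the pairing $\langle X+\xi,Y+\eta\rangle=\tfrac12(\xi(Y)+\eta(X))$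 and the Courant bracket $[X+\xi,Y+\eta]=[X,Y]+L_X\eta-i_Yd\xi$. A change of local trivialization $(L_i,\nabla_i)$ (with $A=TM$), taking $(G,\partial)$ to $(G',\partial')$, induces the map $\psi:E_\partial\to E_{\partial'}$ given by $e^{-F_{\nabla_i}}$ on $\mathbb TU_i$. \textbf{Theorem.} Let $(G,\partial)$ be a gerbe with $0$-connection over $TM$, and let $D\subset E_\partial$ be an involutive isotropic subbundle. Then: \begin{enumerate} \item The restrictions to $D$ of $\pi$ and of the Courant bracket make $D$ a Lie algebroid. \item $G$ has a flat $D$-connection $(\partial^D,B)$, where $\partial^D_{ij}=(\pi|_D)^*\circ\partial_{ij}$, and where $B_i\in\Omega^2_D(U_i)$ is the restriction to $D|_{U_i}\subset\mathbb TU_i$ of the antisymmetric pairing $\langle X+\xi,Y+\eta\rangle_-=\tfrac12(\xi(Y)-\eta(X))$. \item This connection is canonical, i.e. independent of the local trivialization of $(G,\partial)$: if $(G',\partial')$ is obtained from $(G,\partial)$ by a change of local trivialization $(L_i,\nabla_i)$ over the same cover, then $D'=\psi(D)\subset E_{\partial'}$ is again an involutive isotropic subbundle, $\psi:D\to D'$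 is an isomorphism of Lie algebroids, and under this isomorphism the $D'$-connection on $G'$ defined as in (2) is the one obtained from $(\partial^D,B)$ by the change of local trivialization $(*)$ given by the line bundles with $D$-connection $(L_i,(\pi|_D)^*\circ\nabla_i)$. \end{enumerate} -/

import Mathlib

open scoped Manifold ContDiff Topology TensorProduct
open TopologicalSpace

noncomputable section

namespace Gerbes

universe uk uE uM uι v v' w w'

/-! ### Complex functions, the complexified tangent bundle and its sections

`M` is a manifold over `𝕜`, where `𝕜 = ℝ` (the smooth category) or `𝕜 = ℂ` (the holomorphic
category).  In both cases `𝒪_M` is the sheaf of complex functions which are `C^∞` over `𝕜`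
(smooth, respectively holomorphic), and the relevant tangent bundle is `ℂ ⊗[𝕜] TM`
(`TM ⊗ ℂ`, respectively the holomorphic tangent bundle).

A section over an open set `V` is written as a function on all of `M`, whose values outside
`V` are irrelevant. -/

section Tangent

variable (𝕜 : Type uk) [RCLike 𝕜] [NormedAlgebra 𝕜 ℂ]
  (E : Type uE) [NormedAddCommGroup E] [NormedSpace 𝕜 E]
  {M : Type uM} [TopologicalSpace M] [ChartedSpace E M]

/-- The complex function `f` is smooth (holomorphic if `𝕜 = ℂ`) at `x`. -/
def SmoothFunAt (f : M → ℂ) (x : M) : Prop :=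
  ContMDiffAt 𝓘(𝕜, E) 𝓘(𝕜, ℂ) ∞ f x

/-- The complexified tangent space. -/
abbrev CTangent (x : M) : Type uE := ℂ ⊗[𝕜] TangentSpace 𝓘(𝕜, E) x

/-- The complexified cotangent space. -/
abbrev CCotangent (x : M) : Type uE := Module.Dual ℂ (CTangent 𝕜 E x)

/-- The differential `df` at `x`, as a complex covector. -/
def dfun (f : M → ℂ) (x : M) : CCotangent 𝕜 E x :=
  let φ : TangentSpace 𝓘(𝕜, E) x →L[𝕜] ℂ := mfderiv 𝓘(𝕜, E) 𝓘(𝕜, ℂ) f x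
  LinearMap.liftBaseChange ℂ φ.toLinearMap

/-- A complex vector field is smooth at `x` if it differentiates smooth functions to functions
which are smooth at `x`. -/
def VectorSmoothAt (X : ∀ y : M, CTangent 𝕜 E y) (x : M) : Prop :=
  ∀ f : M → ℂ, (∀ᶠ y in 𝓝 x, SmoothFunAt 𝕜 E f y) →
    SmoothFunAt 𝕜 E (fun y => dfun 𝕜 E f y (X y)) x

/-- A complex 1-form is smooth at `x` if its contraction with smooth vector fields is. -/
def CovectorSmoothAt (ξ : ∀ y : M, CCotangent 𝕜 E y) (x : M) : Prop :=
  ∀ X : (∀ y : M, CTangent 𝕜 E y), (∀ᶠ y in 𝓝 x, VectorSmoothAt 𝕜 E X y) →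
    SmoothFunAt 𝕜 E (fun y => ξ y (X y)) x

/-- The Lie bracket of complex vector fields: the tangent vector `Z` at `x` with
`Z f = X (Y f) - Y (X f)` for all `f` smooth near `x`. -/
def vbracket (X Y : ∀ y : M, CTangent 𝕜 E y) (x : M) : CTangent 𝕜 E x :=
  Classical.epsilon fun Z : CTangent 𝕜 E x =>
    ∀ f : M → ℂ, (∀ᶠ y in 𝓝 x, SmoothFunAt 𝕜 E f y) →
      dfun 𝕜 E f x Z
        = dfun 𝕜 E (fun y => dfun 𝕜 E f y (Y y)) x (X x)
          - dfun 𝕜 E (fun y => dfun 𝕜 E f y (X y)) x (Y x)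

end Tangent

/-! ### Vector bundles -/

/-- The data of a complex vector bundle: its fibres, and which of its sections are smooth at
which points. -/
structure BundleData (M : Type uM) where
  fiber : M → Type v
  [acg : ∀ x, AddCommGroup (fiber x)]
  [mod : ∀ x, Module ℂ (fiber x)]
  SmoothAt : (∀ x, fiber x) → M → Prop

attribute [instance] BundleData.acg BundleData.mod

/-- Sections (over a subset of `M`, extended arbitrarily). -/
abbrev BundleData.Sec {M : Type uM} (L : BundleData.{uM, v} M) : Type (max uM v) :=
  ∀ x, L.fiber x

/-- `s` is a smooth section over the open set `V`. -/
def BundleData.SmoothOn {M : Type uM} [TopologicalSpace M] (L : BundleData.{uM, v} M)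
    (V : Opens M) (s : L.Sec) : Prop :=
  ∀ x ∈ V, L.SmoothAt s x

/-- The product of a function and a section. -/
def BundleData.fmul {M : Type uM} (L : BundleData.{uM, v} M) (f : M → ℂ) (s : L.Sec) : L.Sec :=
  fun x => f x • s x

section Bundles

variable (𝕜 : Type uk) [RCLike 𝕜] [NormedAlgebra 𝕜 ℂ]
  (E : Type uE) [NormedAddCommGroup E] [NormedSpace 𝕜 E]
  {M : Type uM} [TopologicalSpace M] [ChartedSpace E M]

/-- The function `f` is smooth on the open set `V`. -/
def SmoothFunOn (V : Opens M) (f : M → ℂ) : Prop := ∀ x ∈ V, SmoothFunAt 𝕜 E f x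

/-- `L` is a (smooth or holomorphic) complex vector bundle of finite rank over the open set
`U`: near each point there is a frame, and a section is smooth at a point if and only if its
coefficients in the frame are. -/
def IsVectorBundleOn (U : Opens M) (L : BundleData.{uM, v} M) : Prop :=
  ∀ x ∈ U, ∃ (V : Opens M) (n : ℕ) (e : Fin n → L.Sec), x ∈ V ∧
    (∀ y ∈ V, LinearIndependent ℂ (fun k => e k y) ∧
      Submodule.span ℂ (Set.range fun k => e k y) = ⊤) ∧
    ∀ (s : L.Sec), ∀ y ∈ V, L.SmoothAt s y ↔
      ∃ c : Fin n → M → ℂ, (∀ k, SmoothFunAt 𝕜 E (c k) y) ∧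
        ∀ᶠ z in 𝓝 y, s z = ∑ k, c k z • e k z

/-- `L` is a complex line bundle over the open set `U`. -/
def IsLineBundleOn (U : Opens M) (L : BundleData.{uM, v} M) : Prop :=
  IsVectorBundleOn 𝕜 E U L ∧ ∀ x ∈ U, Module.finrank ℂ (L.fiber x) = 1

/-- The pairing `p` identifies the line bundles `L` and `L'` over `U` as duals of each other. -/
structure IsDualPairing (U : Opens M) (L : BundleData.{uM, v} M) (L' : BundleData.{uM, v'} M)
    (p : ∀ x, L.fiber x →ₗ[ℂ] L'.fiber x →ₗ[ℂ] ℂ) : Prop where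
  perfect : ∀ x ∈ U, (p x).IsPerfPair
  smooth : ∀ V ≤ U, ∀ s t, L.SmoothOn V s → L'.SmoothOn V t →
    SmoothFunOn 𝕜 E V (fun x => p x (s x) (t x))

end Bundles

/-! ### Lie algebroids -/

/-- The data of a complex Lie algebroid: a bundle, an anchor, and a bracket of sections. -/
structure LieAlgebroidData (𝕜 : Type uk) [RCLike 𝕜] [NormedAlgebra 𝕜 ℂ]
    (E : Type uE) [NormedAddCommGroup E] [NormedSpace 𝕜 E]
    (M : Type uM) [TopologicalSpace M] [ChartedSpace E M] extends BundleData.{uM, w} M where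
  anchor : ∀ x, fiber x →ₗ[ℂ] CTangent 𝕜 E x
  bracket : (∀ x, fiber x) → (∀ x, fiber x) → (∀ x, fiber x)

section Algebroids

variable {𝕜 : Type uk} [RCLike 𝕜] [NormedAlgebra 𝕜 ℂ]
  {E : Type uE} [NormedAddCommGroup E] [NormedSpace 𝕜 E]
  {M : Type uM} [TopologicalSpace M] [ChartedSpace E M]

/-- The derivative `ρ(v) f` of a function along a vector of the algebroid. -/
def LieAlgebroidData.deriv (A : LieAlgebroidData.{uk, uE, uM, w} 𝕜 E M) (f : M → ℂ) (x : M)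
    (v : A.fiber x) : ℂ :=
  dfun 𝕜 E f x (A.anchor x v)

/-- `A` is a complex Lie algebroid on `M`: a vector bundle, with a Lie bracket on its sheaf of
sections and a bracket-preserving bundle map to the tangent bundle satisfying the Leibniz
rule. -/
structure IsLieAlgebroid (A : LieAlgebroidData.{uk, uE, uM, w} 𝕜 E M) : Prop where
  bundle : IsVectorBundleOn 𝕜 E ⊤ A.toBundleData
  anchor_smooth : ∀ (V : Opens M) (a : A.Sec), A.SmoothOn V a →
    ∀ x ∈ V, VectorSmoothAt 𝕜 E (fun y => A.anchor y (a y)) x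
  bracket_smooth : ∀ (V : Opens M) (a b : A.Sec), A.SmoothOn V a → A.SmoothOn V b →
    A.SmoothOn V (A.bracket a b)
  bracket_local : ∀ (V : Opens M) (a b a' b' : A.Sec), A.SmoothOn V a → A.SmoothOn V b →
    (∀ x ∈ V, a x = a' x) → (∀ x ∈ V, b x = b' x) →
    ∀ x ∈ V, A.bracket a b x = A.bracket a' b' x
  bracket_add : ∀ (V : Opens M) (a b c : A.Sec), A.SmoothOn V a → A.SmoothOn V b →
    A.SmoothOn V c → ∀ x ∈ V, A.bracket a (b + c) x = A.bracket a b x + A.bracket a c x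
  bracket_skew : ∀ (V : Opens M) (a b : A.Sec), A.SmoothOn V a → A.SmoothOn V b →
    ∀ x ∈ V, A.bracket a b x = - A.bracket b a x
  jacobi : ∀ (V : Opens M) (a b c : A.Sec), A.SmoothOn V a → A.SmoothOn V b →
    A.SmoothOn V c → ∀ x ∈ V, A.bracket a (A.bracket b c) x
      = A.bracket (A.bracket a b) c x + A.bracket b (A.bracket a c) x
  leibniz : ∀ (V : Opens M) (f : M → ℂ) (a b : A.Sec), SmoothFunOn 𝕜 E V f →
    A.SmoothOn V a → A.SmoothOn V b → ∀ x ∈ V, A.bracket a (A.fmul f b) x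
      = f x • A.bracket a b x + A.deriv f x (a x) • b x
  anchor_bracket : ∀ (V : Opens M) (a b : A.Sec), A.SmoothOn V a → A.SmoothOn V b →
    ∀ x ∈ V, A.anchor x (A.bracket a b x)
      = vbracket 𝕜 E (fun y => A.anchor y (a y)) (fun y => A.anchor y (b y)) x

/-- The fibrewise linear isomorphisms `φ` are an isomorphism of Lie algebroids. -/
structure IsLieAlgebroidIso (A : LieAlgebroidData.{uk, uE, uM, w} 𝕜 E M)
    (A' : LieAlgebroidData.{uk, uE, uM, w'} 𝕜 E M)
    (φ : ∀ x, A.fiber x ≃ₗ[ℂ] A'.fiber x) : Prop where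
  smooth_iff : ∀ (V : Opens M) (a : A.Sec),
    A'.SmoothOn V (fun x => φ x (a x)) ↔ A.SmoothOn V a
  anchor : ∀ x v, A'.anchor x (φ x v) = A.anchor x v
  bracket : ∀ (V : Opens M) (a b : A.Sec), A.SmoothOn V a → A.SmoothOn V b →
    ∀ x ∈ V, φ x (A.bracket a b x)
      = A'.bracket (fun y => φ y (a y)) (fun y => φ y (b y)) x

/-- The 2-form `B` on `A` (alternating, smooth) over the open set `U`. -/
structure IsTwoFormOn (A : LieAlgebroidData.{uk, uE, uM, w} 𝕜 E M) (U : Opens M)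
    (B : ∀ x, A.fiber x →ₗ[ℂ] A.fiber x →ₗ[ℂ] ℂ) : Prop where
  alt : ∀ x ∈ U, ∀ v, B x v v = 0
  smooth : ∀ V ≤ U, ∀ a b, A.SmoothOn V a → A.SmoothOn V b →
    SmoothFunOn 𝕜 E V (fun x => B x (a x) (b x))

/-- The de Rham differential of a 1-form on `A`, evaluated on sections. -/
def LieAlgebroidData.d₁ (A : LieAlgebroidData.{uk, uE, uM, w} 𝕜 E M)
    (ξ : ∀ x, Module.Dual ℂ (A.fiber x)) (a b : A.Sec) (x : M) : ℂ :=
  A.deriv (fun y => ξ y (b y)) x (a x) - A.deriv (fun y => ξ y (a y)) x (b x)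
    - ξ x (A.bracket a b x)

/-- The de Rham differential of a 2-form on `A`, evaluated on sections. -/
def LieAlgebroidData.d₂ (A : LieAlgebroidData.{uk, uE, uM, w} 𝕜 E M)
    (B : ∀ x, A.fiber x →ₗ[ℂ] A.fiber x →ₗ[ℂ] ℂ) (a b c : A.Sec) (x : M) : ℂ :=
  A.deriv (fun y => B y (b y) (c y)) x (a x)
    - A.deriv (fun y => B y (a y) (c y)) x (b x)
    + A.deriv (fun y => B y (a y) (b y)) x (c x)
    - B x (A.bracket a b x) (c x) + B x (A.bracket a c x) (b x)
    - B x (A.bracket b c x) (a x)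

variable (𝕜 E M) in
/-- The complexified (respectively holomorphic) tangent bundle as a Lie algebroid. -/
def tangentAlgebroid : LieAlgebroidData.{uk, uE, uM, uE} 𝕜 E M where
  fiber x := CTangent 𝕜 E x
  SmoothAt := VectorSmoothAt 𝕜 E
  anchor _ := LinearMap.id
  bracket := vbracket 𝕜 E

/-! ### Connections on line bundles over a Lie algebroid -/

/-- Operators from sections of `L` to sections of `A^* ⊗ L = Hom(A, L)`. -/
abbrev ConnOp (A : LieAlgebroidData.{uk, uE, uM, w} 𝕜 E M) (L : BundleData.{uM, v} M) :
    Type (max uM v w) :=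
  L.Sec → ∀ x, A.fiber x →ₗ[ℂ] L.fiber x

/-- `D` is an `A`-connection on the bundle `L` over the open set `U`. -/
structure IsConnectionOn (A : LieAlgebroidData.{uk, uE, uM, w} 𝕜 E M) (U : Opens M)
    (L : BundleData.{uM, v} M) (D : ConnOp A L) : Prop where
  smooth : ∀ V ≤ U, ∀ s a, L.SmoothOn V s → A.SmoothOn V a →
    L.SmoothOn V (fun x => D s x (a x))
  congr : ∀ V ≤ U, ∀ s s', L.SmoothOn V s → (∀ x ∈ V, s x = s' x) →
    ∀ x ∈ V, D s x = D s' x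
  add : ∀ V ≤ U, ∀ s t, L.SmoothOn V s → L.SmoothOn V t →
    ∀ x ∈ V, D (s + t) x = D s x + D t x
  leibniz : ∀ V ≤ U, ∀ f s, SmoothFunOn 𝕜 E V f → L.SmoothOn V s →
    ∀ x ∈ V, ∀ v, D (L.fmul f s) x v = A.deriv f x v • s x + f x • D s x v

/-- The curvature 2-form `F` of an `A`-connection `D` on a line bundle, characterized by
`F(a,b) s = D_a D_b s - D_b D_a s - D_{[a,b]} s`. -/
def curvature {A : LieAlgebroidData.{uk, uE, uM, w} 𝕜 E M} {L : BundleData.{uM, v} M}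
    (D : ConnOp A L) (x : M) : A.fiber x →ₗ[ℂ] A.fiber x →ₗ[ℂ] ℂ :=
  Classical.epsilon fun F : A.fiber x →ₗ[ℂ] A.fiber x →ₗ[ℂ] ℂ =>
    ∀ (a b : A.Sec) (s : L.Sec), (∀ᶠ y in 𝓝 x, A.SmoothAt a y) →
      (∀ᶠ y in 𝓝 x, A.SmoothAt b y) → (∀ᶠ y in 𝓝 x, L.SmoothAt s y) →
      F (a x) (b x) • s x
        = D (fun y => D s y (b y)) x (a x) - D (fun y => D s y (a y)) x (b x)
          - D s x (A.bracket a b x)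

/-- Composition of a connection operator with (the dual of) a bundle map `A → A'`. -/
def ConnOp.pullback {A : LieAlgebroidData.{uk, uE, uM, w} 𝕜 E M}
    {A' : LieAlgebroidData.{uk, uE, uM, w'} 𝕜 E M} {L : BundleData.{uM, v} M}
    (D : ConnOp A' L) (φ : ∀ x, A.fiber x →ₗ[ℂ] A'.fiber x) : ConnOp A L :=
  fun s x => (D s x).comp (φ x)

/-- The connections `D`, `D'` on `L`, `L'` are dual with respect to the pairing `p`. -/
def AreDualConnections (A : LieAlgebroidData.{uk, uE, uM, w} 𝕜 E M) (U : Opens M)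
    {L : BundleData.{uM, v} M} {L' : BundleData.{uM, v'} M}
    (p : ∀ x, L.fiber x →ₗ[ℂ] L'.fiber x →ₗ[ℂ] ℂ) (D : ConnOp A L) (D' : ConnOp A L') : Prop :=
  ∀ V ≤ U, ∀ s t, L.SmoothOn V s → L'.SmoothOn V t → ∀ x ∈ V, ∀ v,
    A.deriv (fun y => p y (s y) (t y)) x v = p x (D s x v) (t x) + p x (s x) (D' t x v)

end Algebroids

/-! ### Gerbes and connections on gerbes -/

section GerbeSection

variable (𝕜 : Type uk) [RCLike 𝕜] [NormedAlgebra 𝕜 ℂ]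
  (E : Type uE) [NormedAddCommGroup E] [NormedSpace 𝕜 E]
  {M : Type uM} [TopologicalSpace M] [ChartedSpace E M] {ι : Type uι}

/-- A `ℂ^*`-gerbe, locally trivialized over the open cover `U`: line bundles `L i j` over
`U i ∩ U j`, with `L i j` dual to `L j i`, and coherent isomorphisms
`θ i j k : L i j ⊗ L j k → L i k` over triple overlaps. -/
structure Gerbe (U : ι → Opens M) where
  cover : ∀ x, ∃ i, x ∈ U i
  L : ι → ι → BundleData.{uM, v} M
  line : ∀ i j, IsLineBundleOn 𝕜 E (U i ⊓ U j) (L i j)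
  ev : ∀ i j x, (L i j).fiber x →ₗ[ℂ] (L j i).fiber x →ₗ[ℂ] ℂ
  ev_dual : ∀ i j, IsDualPairing 𝕜 E (U i ⊓ U j) (L i j) (L j i) (ev i j)
  ev_symm : ∀ i j, ∀ x ∈ U i ⊓ U j, ∀ s t, ev i j x s t = ev j i x t s
  θ : ∀ i j k x, (L i j).fiber x →ₗ[ℂ] (L j k).fiber x →ₗ[ℂ] (L i k).fiber x
  θ_iso : ∀ i j k, ∀ x ∈ U i ⊓ U j ⊓ U k,
    Function.Bijective (TensorProduct.lift (θ i j k x))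
  θ_smooth : ∀ i j k, ∀ V ≤ U i ⊓ U j ⊓ U k, ∀ s t, (L i j).SmoothOn V s →
    (L j k).SmoothOn V t → (L i k).SmoothOn V (fun x => θ i j k x (s x) (t x))
  coherence : ∀ i j k l, ∀ x ∈ U i ⊓ U j ⊓ U k ⊓ U l, ∀ r s t,
    θ i k l x (θ i j k x r s) t = θ i j l x r (θ j k l x s t)

variable {𝕜 E} {U : ι → Opens M}

/-- `del` is a 0-connection over `A` on the gerbe `G`: a family of `A`-connections on the
`L i j`, with `del j i` dual to `del i j`, such that the `θ i j k` are flat. -/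
structure IsZeroConnection (A : LieAlgebroidData.{uk, uE, uM, w} 𝕜 E M)
    (G : Gerbe.{uk, uE, uM, uι, v} 𝕜 E U) (del : ∀ i j, ConnOp A (G.L i j)) : Prop where
  conn : ∀ i j, IsConnectionOn A (U i ⊓ U j) (G.L i j) (del i j)
  dual : ∀ i j, AreDualConnections A (U i ⊓ U j) (G.ev i j) (del i j) (del j i)
  flat : ∀ i j k, ∀ V ≤ U i ⊓ U j ⊓ U k, ∀ s t, (G.L i j).SmoothOn V s →
    (G.L j k).SmoothOn V t → ∀ x ∈ V, ∀ v,
      del i k (fun y => G.θ i j k y (s y) (t y)) x v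
        = G.θ i j k x (del i j s x v) (t x) + G.θ i j k x (s x) (del j k t x v)

/-- The data of an `A`-connection on a gerbe: the 0-connection `{∂_ij}` and the
1-connection `{B_i}`. -/
structure GerbeConn (A : LieAlgebroidData.{uk, uE, uM, w} 𝕜 E M)
    (G : Gerbe.{uk, uE, uM, uι, v} 𝕜 E U) where
  zero : ∀ i j, ConnOp A (G.L i j)
  one : ι → ∀ x, A.fiber x →ₗ[ℂ] A.fiber x →ₗ[ℂ] ℂ

/-- `C = (∂, B)` is an `A`-connection on `G`. -/
structure IsGerbeConnection (A : LieAlgebroidData.{uk, uE, uM, w} 𝕜 E M)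
    (G : Gerbe.{uk, uE, uM, uι, v} 𝕜 E U) (C : GerbeConn A G) : Prop where
  zero : IsZeroConnection A G C.zero
  form : ∀ i, IsTwoFormOn A (U i) (C.one i)
  glue : ∀ i j, ∀ x ∈ U i ⊓ U j, C.one j x - C.one i x = curvature (C.zero i j) x

/-- The connection is flat: its curving, the 3-form on `A` which is `d_A B_i` on `U i`,
vanishes. -/
def GerbeConn.IsFlat {A : LieAlgebroidData.{uk, uE, uM, w} 𝕜 E M}
    {G : Gerbe.{uk, uE, uM, uι, v} 𝕜 E U} (C : GerbeConn A G) : Prop :=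
  ∀ i, ∀ V ≤ U i, ∀ a b c, A.SmoothOn V a → A.SmoothOn V b → A.SmoothOn V c →
    ∀ x ∈ V, A.d₂ (C.one i) a b c x = 0

/-- Pullback of the data of a connection along a bundle map `A → A'`. -/
def GerbeConn.pullback {A : LieAlgebroidData.{uk, uE, uM, w} 𝕜 E M}
    {A' : LieAlgebroidData.{uk, uE, uM, w'} 𝕜 E M}
    {G : Gerbe.{uk, uE, uM, uι, v} 𝕜 E U} (C : GerbeConn A' G)
    (φ : ∀ x, A.fiber x →ₗ[ℂ] A'.fiber x) : GerbeConn A G where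
  zero i j := (C.zero i j).pullback φ
  one i x := (C.one i x).compl₁₂ (φ x) (φ x)

end GerbeSection

/-! ### Courant algebroids -/

section Courant

variable (𝕜 : Type uk) [RCLike 𝕜] [NormedAlgebra 𝕜 ℂ]
  (E : Type uE) [NormedAddCommGroup E] [NormedSpace 𝕜 E]
  {M : Type uM} [TopologicalSpace M] [ChartedSpace E M] {ι : Type uι}

/-- The fibre of `𝕋M = TM ⊕ T^*M` (complexified, respectively holomorphic). -/
abbrev GTangent (x : M) : Type uE := CTangent 𝕜 E x × CCotangent 𝕜 E x

variable {𝕜 E}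

/-- The symmetric pairing `⟨X + ξ, Y + η⟩ = (ξ(Y) + η(X)) / 2`. -/
def symPair {x : M} (e e' : GTangent 𝕜 E x) : ℂ := (1 / 2) * (e.2 e'.1 + e'.2 e.1)

/-- The antisymmetric pairing `⟨X + ξ, Y + η⟩₋ = (ξ(Y) - η(X)) / 2`, as a bilinear form. -/
def antiPair (x : M) : GTangent 𝕜 E x →ₗ[ℂ] GTangent 𝕜 E x →ₗ[ℂ] ℂ :=
  LinearMap.mk₂ ℂ (fun e e' => (1 / 2) * (e.2 e'.1 - e'.2 e.1))
    (by intros; simp; ring) (by intros; simp; ring)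
    (by intros; simp; ring) (by intros; simp; ring)

/-- The transformation `e^B : X + ξ ↦ X + ξ + i_X B`. -/
def expB {x : M} (B : CTangent 𝕜 E x →ₗ[ℂ] CTangent 𝕜 E x →ₗ[ℂ] ℂ) :
    GTangent 𝕜 E x →ₗ[ℂ] GTangent 𝕜 E x :=
  LinearMap.prod (LinearMap.fst ℂ _ _)
    (LinearMap.snd ℂ _ _ + B ∘ₗ LinearMap.fst ℂ _ _)

/-- The covector `β` at `x` with `β(Z) = Φ(Z)` for all vector fields `Z` smooth near `x`, for
an expression `Φ` which only depends on the value of `Z` at `x`. -/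
def covectorOf (x : M) (Φ : (∀ y : M, CTangent 𝕜 E y) → ℂ) : CCotangent 𝕜 E x :=
  Classical.epsilon fun β : CCotangent 𝕜 E x =>
    ∀ Z : (∀ y : M, CTangent 𝕜 E y), (∀ᶠ y in 𝓝 x, VectorSmoothAt 𝕜 E Z y) → β (Z x) = Φ Z

/-- The Lie derivative `L_X η`, where `(L_X η)(Z) = X(η(Z)) - η([X, Z])`. -/
def lieDer (X : ∀ y : M, CTangent 𝕜 E y) (η : ∀ y : M, CCotangent 𝕜 E y) (x : M) :
    CCotangent 𝕜 E x :=
  covectorOf x fun Z => dfun 𝕜 E (fun y => η y (Z y)) x (X x) - η x (vbracket 𝕜 E X Z x)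

/-- The contraction `i_Y dξ`. -/
def contrD (Y : ∀ y : M, CTangent 𝕜 E y) (ξ : ∀ y : M, CCotangent 𝕜 E y) (x : M) :
    CCotangent 𝕜 E x :=
  covectorOf x fun Z => (tangentAlgebroid 𝕜 E M).d₁ ξ Y Z x

/-- The Courant bracket `[X + ξ, Y + η] = [X, Y] + L_X η - i_Y dξ` on sections of `𝕋M`. -/
def courantBracket (a b : ∀ y : M, GTangent 𝕜 E y) (x : M) : GTangent 𝕜 E x :=
  (vbracket 𝕜 E (fun y => (a y).1) (fun y => (b y).1) x,
    lieDer (fun y => (a y).1) (fun y => (b y).2) x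
      - contrD (fun y => (b y).1) (fun y => (a y).2) x)

/-- Smoothness of sections of `𝕋M`. -/
def GSmoothAt (a : ∀ y : M, GTangent 𝕜 E y) (x : M) : Prop :=
  VectorSmoothAt 𝕜 E (fun y => (a y).1) x ∧ CovectorSmoothAt 𝕜 E (fun y => (a y).2) x

variable (𝕜 E M) in
/-- The data of a Courant algebroid. -/
structure CourantData extends BundleData.{uM, w} M where
  anchor : ∀ x, fiber x →ₗ[ℂ] CTangent 𝕜 E x
  pair : ∀ x, fiber x → fiber x → ℂ
  bracket : (∀ x, fiber x) → (∀ x, fiber x) → (∀ x, fiber x)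

/-- `D` is a (smooth or holomorphic) subbundle of `C`: locally spanned by linearly independent
smooth sections of `C`. -/
def CourantData.IsSubbundle (C : CourantData.{uk, uE, uM, w} 𝕜 E M)
    (D : ∀ x, Submodule ℂ (C.fiber x)) : Prop :=
  ∀ x, ∃ (V : Opens M) (n : ℕ) (e : Fin n → C.Sec), x ∈ V ∧
    (∀ k, C.SmoothOn V (e k)) ∧
    ∀ y ∈ V, LinearIndependent ℂ (fun k => e k y) ∧
      Submodule.span ℂ (Set.range fun k => e k y) = D y

/-- `D` is isotropic. -/
def CourantData.IsIsotropic (C : CourantData.{uk, uE, uM, w} 𝕜 E M)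
    (D : ∀ x, Submodule ℂ (C.fiber x)) : Prop :=
  ∀ x, ∀ a ∈ D x, ∀ b ∈ D x, C.pair x a b = 0

/-- `D` is involutive: local sections of `D` are closed under the bracket. -/
def CourantData.IsInvolutive (C : CourantData.{uk, uE, uM, w} 𝕜 E M)
    (D : ∀ x, Submodule ℂ (C.fiber x)) : Prop :=
  ∀ (V : Opens M) (a b : C.Sec), C.SmoothOn V a → C.SmoothOn V b →
    (∀ x ∈ V, a x ∈ D x) → (∀ x ∈ V, b x ∈ D x) → ∀ x ∈ V, C.bracket a b x ∈ D x

open Classical in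
/-- The restriction of the anchor and the bracket of `C` to `D`.  (If `D` is involutive, the
bracket of smooth sections of `D` lies in `D`, so that the value `0` does not occur.) -/
def CourantData.restrict (C : CourantData.{uk, uE, uM, w} 𝕜 E M)
    (D : ∀ x, Submodule ℂ (C.fiber x)) : LieAlgebroidData.{uk, uE, uM, w} 𝕜 E M where
  fiber x := D x
  SmoothAt a x := C.SmoothAt (fun y => (a y : C.fiber y)) x
  anchor x := (C.anchor x).comp (D x).subtype
  bracket a b x :=
    if h : C.bracket (fun y => (a y : C.fiber y)) (fun y => (b y : C.fiber y)) x ∈ D x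
    then ⟨_, h⟩ else 0

variable {U : ι → Opens M}

/-- The fibre at `x` of the bundle `E_∂` obtained by gluing `𝕋U_i` to `𝕋U_j` by
`e^{F_ij}`, where `F_ij` is the curvature of `∂_ij`: families `(e_i)` of elements of the fibre
of `𝕋M`, indexed by the `i` with `x ∈ U_i`, with `e_j = e^{F_ij} e_i`. -/
def courantFiber (G : Gerbe.{uk, uE, uM, uι, v} 𝕜 E U)
    (del : ∀ i j, ConnOp (tangentAlgebroid 𝕜 E M) (G.L i j)) (x : M) :
    Submodule ℂ ({i : ι // x ∈ U i} → GTangent 𝕜 E x) where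
  carrier := {e | ∀ i j, e j = expB (curvature (del i.1 j.1) x) (e i)}
  zero_mem' := by intro i j; simp
  add_mem' := by
    intro a b ha hb i j
    rw [Pi.add_apply, Pi.add_apply, ha i j, hb i j, map_add]
  smul_mem' := by
    intro c a ha i j
    rw [Pi.smul_apply, Pi.smul_apply, ha i j, map_smul]

open Classical in
/-- The component `a_i`, a section of `𝕋U_i`, of a section `a` of `E_∂`. -/
def courantComp (G : Gerbe.{uk, uE, uM, uι, v} 𝕜 E U)
    (del : ∀ i j, ConnOp (tangentAlgebroid 𝕜 E M) (G.L i j)) (i : ι)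
    (a : ∀ x, courantFiber G del x) (x : M) : GTangent 𝕜 E x :=
  if h : x ∈ U i then (a x).1 ⟨i, h⟩ else 0

/-- Some index `i` with `x ∈ U_i`. -/
def Gerbe.index (G : Gerbe.{uk, uE, uM, uι, v} 𝕜 E U) (x : M) : {i : ι // x ∈ U i} :=
  ⟨(G.cover x).choose, (G.cover x).choose_spec⟩

open Classical in
/-- The Courant algebroid `E_∂` of a gerbe with 0-connection.  All structure is that of `𝕋U_i`
in each component: the anchor and the pairing are invariant under the gluing maps, so that they
can be computed in any component, and the bracket is taken componentwise.  (The brackets of the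
components of smooth sections are again related by the gluing maps, so that the value `0` of the
bracket does not occur for them.) -/
def courantAlgebroid (G : Gerbe.{uk, uE, uM, uι, v} 𝕜 E U)
    (del : ∀ i j, ConnOp (tangentAlgebroid 𝕜 E M) (G.L i j)) :
    CourantData.{uk, uE, uM, max uE uι} 𝕜 E M where
  fiber x := courantFiber G del x
  SmoothAt a x := ∀ i, x ∈ U i → GSmoothAt (courantComp G del i a) x
  anchor x := LinearMap.fst ℂ _ _ ∘ₗ LinearMap.proj (G.index x) ∘ₗ
    (courantFiber G del x).subtype
  pair x e e' := symPair (e.1 (G.index x)) (e'.1 (G.index x))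
  bracket a b x :=
    if h : (fun i : {i : ι // x ∈ U i} =>
        courantBracket (courantComp G del i.1 a) (courantComp G del i.1 b) x)
          ∈ courantFiber G del x
    then ⟨_, h⟩ else 0

/-! ### The connection over an isotropic involutive subbundle -/

/-- The Lie algebroid `D ⊂ E_∂`. -/
abbrev diracAlgebroid (G : Gerbe.{uk, uE, uM, uι, v} 𝕜 E U)
    (del : ∀ i j, ConnOp (tangentAlgebroid 𝕜 E M) (G.L i j))
    (D : ∀ x, Submodule ℂ ((courantAlgebroid G del).fiber x)) :
    LieAlgebroidData.{uk, uE, uM, max uE uι} 𝕜 E M :=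
  (courantAlgebroid G del).restrict D

/-- The inclusion, at `x ∈ U_i`, of `D` into `𝕋U_i`; its image is denoted `D_i`. -/
def diracComp (G : Gerbe.{uk, uE, uM, uι, v} 𝕜 E U)
    (del : ∀ i j, ConnOp (tangentAlgebroid 𝕜 E M) (G.L i j))
    (D : ∀ x, Submodule ℂ ((courantAlgebroid G del).fiber x)) (x : M) (i : {i : ι // x ∈ U i}) :
    (diracAlgebroid G del D).fiber x →ₗ[ℂ] GTangent 𝕜 E x :=
  LinearMap.proj i ∘ₗ (courantFiber G del x).subtype ∘ₗ (D x).subtype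

open Classical in
/-- The canonical `D`-connection: the 0-connection is `∂_ij` composed with the dual of the
anchor of `D`, and `B_i` is the restriction of the antisymmetric pairing on `𝕋U_i` to the image
`D_i` of `D`. -/
def diracConnection (G : Gerbe.{uk, uE, uM, uι, v} 𝕜 E U)
    (del : ∀ i j, ConnOp (tangentAlgebroid 𝕜 E M) (G.L i j))
    (D : ∀ x, Submodule ℂ ((courantAlgebroid G del).fiber x)) :
    GerbeConn (diracAlgebroid G del D) G where
  zero i j := (del i j).pullback (diracAlgebroid G del D).anchor
  one i x :=
    if h : x ∈ U i then
      (antiPair x).compl₁₂ (diracComp G del D x ⟨i, h⟩) (diracComp G del D x ⟨i, h⟩)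
    else 0

/-! ### Changes of local trivialization -/

/-- The gerbe data `G'` arise from `G` by a change of local trivialization, by line bundles
`N i` over `U i` (with dual bundles `N' i`): isomorphisms
`κ i j : L i j ⊗ N i ⊗ N' j → L' i j` under which `θ' i j k` corresponds to
`θ i j k ⊗ id`, the factor `N' j ⊗ N j` being contracted by the duality pairing. -/
structure Retrivialization (G : Gerbe.{uk, uE, uM, uι, v} 𝕜 E U)
    (G' : Gerbe.{uk, uE, uM, uι, v'} 𝕜 E U) where
  N : ι → BundleData.{uM, w} M
  N' : ι → BundleData.{uM, w} M
  line : ∀ i, IsLineBundleOn 𝕜 E (U i) (N i)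
  line' : ∀ i, IsLineBundleOn 𝕜 E (U i) (N' i)
  ev : ∀ i x, (N i).fiber x →ₗ[ℂ] (N' i).fiber x →ₗ[ℂ] ℂ
  ev_dual : ∀ i, IsDualPairing 𝕜 E (U i) (N i) (N' i) (ev i)
  κ : ∀ i j x, (G.L i j).fiber x →ₗ[ℂ] (N i).fiber x →ₗ[ℂ] (N' j).fiber x →ₗ[ℂ]
    (G'.L i j).fiber x
  κ_iso : ∀ i j, ∀ x ∈ U i ⊓ U j,
    Function.Bijective (TensorProduct.lift (TensorProduct.lift (κ i j x)))
  κ_smooth : ∀ i j, ∀ V ≤ U i ⊓ U j, ∀ s n t, (G.L i j).SmoothOn V s →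
    (N i).SmoothOn V n → (N' j).SmoothOn V t →
    (G'.L i j).SmoothOn V (fun x => κ i j x (s x) (n x) (t x))
  κ_θ : ∀ i j k, ∀ x ∈ U i ⊓ U j ⊓ U k, ∀ r n t s m u,
    G'.θ i j k x (κ i j x r n t) (κ j k x s m u)
      = ev j x m t • κ i k x (G.θ i j k x r s) n u

/-- `nab` and `nab'` are dual `A`-connections on the line bundles `N i` and `N' i`. -/
structure Retrivialization.IsConn {G : Gerbe.{uk, uE, uM, uι, v} 𝕜 E U}
    {G' : Gerbe.{uk, uE, uM, uι, v'} 𝕜 E U}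
    (R : Retrivialization.{uk, uE, uM, uι, v, v', w} G G')
    {A : LieAlgebroidData 𝕜 E M}
    (nab : ∀ i, ConnOp A (R.N i)) (nab' : ∀ i, ConnOp A (R.N' i)) : Prop where
  conn : ∀ i, IsConnectionOn A (U i) (R.N i) (nab i)
  conn' : ∀ i, IsConnectionOn A (U i) (R.N' i) (nab' i)
  dual : ∀ i, AreDualConnections A (U i) (R.ev i) (nab i) (nab' i)

/-- Under `κ`, the connection `del' i j` is the tensor product connection
`del i j + nab i + nab' j`. -/
def Retrivialization.TransformsZero {G : Gerbe.{uk, uE, uM, uι, v} 𝕜 E U}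
    {G' : Gerbe.{uk, uE, uM, uι, v'} 𝕜 E U}
    (R : Retrivialization.{uk, uE, uM, uι, v, v', w} G G')
    {A : LieAlgebroidData 𝕜 E M}
    (nab : ∀ i, ConnOp A (R.N i)) (nab' : ∀ i, ConnOp A (R.N' i))
    (del : ∀ i j, ConnOp A (G.L i j)) (del' : ∀ i j, ConnOp A (G'.L i j)) : Prop :=
  ∀ i j, ∀ V ≤ U i ⊓ U j, ∀ s n t, (G.L i j).SmoothOn V s → (R.N i).SmoothOn V n →
    (R.N' j).SmoothOn V t → ∀ x ∈ V, ∀ v,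
    del' i j (fun y => R.κ i j y (s y) (n y) (t y)) x v
      = R.κ i j x (del i j s x v) (n x) (t x) + R.κ i j x (s x) (nab i n x v) (t x)
        + R.κ i j x (s x) (n x) (nab' j t x v)

/-- The effect of the change of local trivialization on `A`-connections `(∂, B)`:
`∂_ij ↦ ∂_ij + nab_i + nab_j^*` and `B_i ↦ B_i - F_{nab_i}`. -/
structure Retrivialization.Transforms {G : Gerbe.{uk, uE, uM, uι, v} 𝕜 E U}
    {G' : Gerbe.{uk, uE, uM, uι, v'} 𝕜 E U}
    (R : Retrivialization.{uk, uE, uM, uι, v, v', w} G G')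
    {A : LieAlgebroidData 𝕜 E M}
    (nab : ∀ i, ConnOp A (R.N i)) (nab' : ∀ i, ConnOp A (R.N' i))
    (C : GerbeConn A G) (C' : GerbeConn A G') : Prop where
  zero : R.TransformsZero nab nab' C.zero C'.zero
  one : ∀ i, ∀ x ∈ U i, C'.one i x = C.one i x - curvature (nab i) x

/-- The image of `D ⊂ E_∂` under the map `E_∂ → E_∂'` induced by a change of local
trivialization by line bundles with connection `nab`, which is `e^{-F_{nab_i}}` on `𝕋U_i`. -/
def Retrivialization.image {G : Gerbe.{uk, uE, uM, uι, v} 𝕜 E U}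
    {G' : Gerbe.{uk, uE, uM, uι, v'} 𝕜 E U}
    (R : Retrivialization.{uk, uE, uM, uι, v, v', w} G G')
    (nab : ∀ i, ConnOp (tangentAlgebroid 𝕜 E M) (R.N i))
    (del : ∀ i j, ConnOp (tangentAlgebroid 𝕜 E M) (G.L i j))
    (del' : ∀ i j, ConnOp (tangentAlgebroid 𝕜 E M) (G'.L i j))
    (D : ∀ x, Submodule ℂ ((courantAlgebroid G del).fiber x)) (x : M) :
    Submodule ℂ ((courantAlgebroid G' del').fiber x) :=
  (((D x).map (courantFiber G del x).subtype).map
    (LinearMap.pi fun i : {i : ι // x ∈ U i} =>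
      expB (-curvature (nab i.1) x) ∘ₗ LinearMap.proj i)).comap
        (courantFiber G' del' x).subtype

end Courant

end Gerbes

end

open scoped Manifold ContDiff Topology TensorProduct
open TopologicalSpace

noncomputable section

namespace Gerbes

universe uk uE uM uι v v' w w'

/-! ### Smooth complex functions and their complex differential. -/

section FunctionCalculus

variable {𝕜 : Type uk} [RCLike 𝕜] [NormedAlgebra 𝕜 ℂ]
  {E : Type uE} [NormedAddCommGroup E] [NormedSpace 𝕜 E]
  {M : Type uM} [TopologicalSpace M] [ChartedSpace E M] {f g : M → ℂ} {x : M}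

/-! Everything is checked in one component `𝕋U_i`, and rests on three facts about the map e^F for a
closed 2-form F. It commutes with the Courant bracket, since the defect evaluated on a field W is
dF(X, Y, W) (`courantBracket_expB`). It preserves the symmetric pairing, because F(X, Y) and F(Y, X)
cancel (`symPair_expB`). It changes the antisymmetric pairing by exactly F(X, Y), because there they
add up (`antiPair_expB`). The forms that occur are curvatures of connections on line bundles; in a
frame such a curvature is d of the connection form, hence closed
(`IsConnectionOn.isClosedFormNear`). So the bracket and the pairing of E_∂ can be computed in any
component, and an element of E_∂ is determined by one component.

The Courant bracket used here satisfies the Jacobi identity in derivation form and the Leibniz rule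
in its second argument. Its only defect is [a, b] + [b, a] = 2 d⟨a, b⟩, which vanishes for sections
of an isotropic D; with involutivity this makes D a Lie algebroid (`dirac_isLieAlgebroid`). That D
is a vector bundle in the required sense needs smooth coefficients of smooth sections, which is
Cramer's rule (`smoothFunAt_coeff`).

Curvature commutes with pullback along the anchor because the anchor preserves brackets
(`IsConnectionOn.curvature_pullback`), so the gluing law for the B_i is the third fact with F =
F_ij. For flatness, isotropy turns B_i(a, b) into ξ(Y), and then d_D B_i(a, b, c) is precisely 2⟨[a,
b], c⟩, which is zero (`dirac_isFlat`).

Under a change of trivialization, comparing curvatures through κ gives F'_ij = F_ij + F_i - F_j,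
where F_i is the curvature of `nab i` (`curvature_trilinear`, `curvature_dual`). Hence the maps
e^{-F_i} are compatible with the gluing, and the three facts for -F_i yield the claims about D' and
its connection.

Lie brackets, L_X η, i_Y dξ and curvatures are defined by `Classical.epsilon`, so each needs a proof
that an object with the defining property exists. For the Lie bracket this comes from coordinates
with commuting coordinate fields; for the others from tensoriality
(`exists_linearMap_of_tensorial`). Sections are total functions with meaningless values off their
domain, so the calculus is stated for germs. -/

lemma SmoothFunAt.congr (hf : SmoothFunAt 𝕜 E f x) (h : g =ᶠ[𝓝 x] f) : SmoothFunAt 𝕜 E g x :=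
  ContMDiffAt.congr_of_eventuallyEq hf h

lemma SmoothFunAt.comp₁ {φ : ℂ → ℂ} (hφ : ContDiffAt 𝕜 ∞ φ (f x)) (hf : SmoothFunAt 𝕜 E f x) :
    SmoothFunAt 𝕜 E (fun y => φ (f y)) x :=
  ContMDiffAt.comp x hφ.contMDiffAt hf

lemma SmoothFunAt.comp₂ {φ : ℂ × ℂ → ℂ} (hφ : ContDiff 𝕜 ∞ φ) (hf : SmoothFunAt 𝕜 E f x)
    (hg : SmoothFunAt 𝕜 E g x) : SmoothFunAt 𝕜 E (fun y => φ (f y, g y)) x :=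
  ContMDiffAt.comp x hφ.contMDiff.contMDiffAt (ContMDiffAt.prodMk_space hf hg)

lemma smoothFunAt_const (c : ℂ) : SmoothFunAt 𝕜 E (fun _ : M => c) x := contMDiffAt_const

lemma SmoothFunAt.add (hf : SmoothFunAt 𝕜 E f x) (hg : SmoothFunAt 𝕜 E g x) :
    SmoothFunAt 𝕜 E (fun y => f y + g y) x :=
  SmoothFunAt.comp₂ (φ := fun p => p.1 + p.2) (contDiff_fst.add contDiff_snd) hf hg

lemma SmoothFunAt.mul (hf : SmoothFunAt 𝕜 E f x) (hg : SmoothFunAt 𝕜 E g x) :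
    SmoothFunAt 𝕜 E (fun y => f y * g y) x :=
  SmoothFunAt.comp₂ (φ := fun p => p.1 * p.2) (contDiff_fst.mul contDiff_snd) hf hg

lemma SmoothFunAt.neg (hf : SmoothFunAt 𝕜 E f x) : SmoothFunAt 𝕜 E (fun y => - f y) x :=
  hf.comp₁ (φ := fun z => -z) contDiff_id.neg.contDiffAt

lemma SmoothFunAt.sub (hf : SmoothFunAt 𝕜 E f x) (hg : SmoothFunAt 𝕜 E g x) :
    SmoothFunAt 𝕜 E (fun y => f y - g y) x :=
  SmoothFunAt.comp₂ (φ := fun p => p.1 - p.2) (contDiff_fst.sub contDiff_snd) hf hg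

lemma SmoothFunAt.inv (hf : SmoothFunAt 𝕜 E f x) (h : f x ≠ 0) :
    SmoothFunAt 𝕜 E (fun y => (f y)⁻¹) x :=
  hf.comp₁ (φ := fun z => z⁻¹) (contDiffAt_inv 𝕜 h)

lemma SmoothFunAt.div (hf : SmoothFunAt 𝕜 E f x) (hg : SmoothFunAt 𝕜 E g x) (h : g x ≠ 0) :
    SmoothFunAt 𝕜 E (fun y => f y / g y) x := by
  simpa only [div_eq_mul_inv] using hf.mul (hg.inv h)

lemma SmoothFunAt.sum {α : Type*} (s : Finset α) {F : α → M → ℂ}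
    (h : ∀ k ∈ s, SmoothFunAt 𝕜 E (F k) x) : SmoothFunAt 𝕜 E (fun y => ∑ k ∈ s, F k y) x := by
  classical
  induction s using Finset.induction_on with
  | empty => simpa using smoothFunAt_const (𝕜 := 𝕜) (E := E) (x := x) 0
  | insert a s ha ih =>
    simp only [Finset.sum_insert ha]
    exact (h a (by simp)).add (ih fun k hk => h k (by simp [hk]))

lemma SmoothFunAt.prod {α : Type*} (s : Finset α) {F : α → M → ℂ}
    (h : ∀ k ∈ s, SmoothFunAt 𝕜 E (F k) x) : SmoothFunAt 𝕜 E (fun y => ∏ k ∈ s, F k y) x := by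
  classical
  induction s using Finset.induction_on with
  | empty => simpa using smoothFunAt_const (𝕜 := 𝕜) (E := E) (x := x) 1
  | insert a s ha ih =>
    simp only [Finset.prod_insert ha]
    exact (h a (by simp)).mul (ih fun k hk => h k (by simp [hk]))

lemma SmoothFunAt.mdifferentiableAt (hf : SmoothFunAt 𝕜 E f x) :
    MDifferentiableAt 𝓘(𝕜, E) 𝓘(𝕜, ℂ) f x :=
  ContMDiffAt.mdifferentiableAt hf (by simp)

lemma SmoothFunAt.continuousAt (hf : SmoothFunAt 𝕜 E f x) : ContinuousAt f x :=
  ContMDiffAt.continuousAt hf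

variable (𝕜 E) in
/-- The differential of `f` at `x`, as a `𝕜`-linear map. -/
def realDeriv (f : M → ℂ) (x : M) : TangentSpace 𝓘(𝕜, E) x →L[𝕜] ℂ :=
  mfderiv 𝓘(𝕜, E) 𝓘(𝕜, ℂ) f x

lemma dfun_tmul (f : M → ℂ) (x : M) (z : ℂ) (v : TangentSpace 𝓘(𝕜, E) x) :
    dfun 𝕜 E f x (z ⊗ₜ[𝕜] v) = z * realDeriv 𝕜 E f x v :=
  LinearMap.liftBaseChange_tmul ℂ _ z v

lemma dfun_congr (h : f =ᶠ[𝓝 x] g) : dfun 𝕜 E f x = dfun 𝕜 E g x := by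
  have h' : realDeriv 𝕜 E f x = realDeriv 𝕜 E g x := h.mfderiv_eq
  change LinearMap.liftBaseChange ℂ (realDeriv 𝕜 E f x).toLinearMap = _
  rw [h']
  rfl

/-- The vectors `1 ⊗ₜ v` generate the complexified tangent space over `ℂ`, so rules for `dfun`
reduce to those for the `𝕜`-linear `mfderiv`. -/
lemma cdual_ext {φ ψ : CCotangent 𝕜 E x}
    (h : ∀ v : TangentSpace 𝓘(𝕜, E) x, φ (1 ⊗ₜ v) = ψ (1 ⊗ₜ v)) : φ = ψ := by
  ext v
  exact h v

lemma dfun_const (c : ℂ) : dfun 𝕜 E (fun _ : M => c) x = 0 := by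
  refine cdual_ext fun v => ?_
  have h : realDeriv 𝕜 E (fun _ : M => c) x = 0 := mfderiv_const
  rw [dfun_tmul, h]
  simp

lemma dfun_add (hf : SmoothFunAt 𝕜 E f x) (hg : SmoothFunAt 𝕜 E g x) :
    dfun 𝕜 E (fun y => f y + g y) x = dfun 𝕜 E f x + dfun 𝕜 E g x := by
  refine cdual_ext fun v => ?_
  rw [LinearMap.add_apply, dfun_tmul, dfun_tmul, dfun_tmul]
  have h : realDeriv 𝕜 E (fun y => f y + g y) x = realDeriv 𝕜 E f x + realDeriv 𝕜 E g x :=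
    (hf.mdifferentiableAt.hasMFDerivAt.add hg.mdifferentiableAt.hasMFDerivAt).mfderiv
  rw [h]
  exact mul_add _ _ _

lemma dfun_mul (hf : SmoothFunAt 𝕜 E f x) (hg : SmoothFunAt 𝕜 E g x) :
    dfun 𝕜 E (fun y => f y * g y) x = f x • dfun 𝕜 E g x + g x • dfun 𝕜 E f x := by
  refine cdual_ext fun v => ?_
  rw [LinearMap.add_apply, LinearMap.smul_apply, LinearMap.smul_apply, dfun_tmul, dfun_tmul,
    dfun_tmul]
  have h : realDeriv 𝕜 E (fun y => f y * g y) x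
      = f x • realDeriv 𝕜 E g x + g x • realDeriv 𝕜 E f x :=
    (hf.mdifferentiableAt.hasMFDerivAt.mul hg.mdifferentiableAt.hasMFDerivAt).mfderiv
  rw [h, one_mul, one_mul, one_mul]
  rfl

lemma dfun_const_mul (c : ℂ) (hf : SmoothFunAt 𝕜 E f x) :
    dfun 𝕜 E (fun y => c * f y) x = c • dfun 𝕜 E f x := by
  rw [dfun_mul (smoothFunAt_const c) hf, dfun_const, smul_zero, add_zero]

lemma dfun_neg (hf : SmoothFunAt 𝕜 E f x) :
    dfun 𝕜 E (fun y => - f y) x = - dfun 𝕜 E f x := by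
  simpa using dfun_const_mul (-1) hf

lemma dfun_sub (hf : SmoothFunAt 𝕜 E f x) (hg : SmoothFunAt 𝕜 E g x) :
    dfun 𝕜 E (fun y => f y - g y) x = dfun 𝕜 E f x - dfun 𝕜 E g x := by
  simp only [sub_eq_add_neg]
  rw [dfun_add hf hg.neg, dfun_neg hg]

end FunctionCalculus

/-! ### Charts as frames of commuting coordinate vector fields. -/

section CoordinateFrame

variable {𝕜 : Type uk} [RCLike 𝕜] [NormedAlgebra 𝕜 ℂ]
  {E : Type uE} [NormedAddCommGroup E] [NormedSpace 𝕜 E]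
  {M : Type uM} [TopologicalSpace M] [ChartedSpace E M]

variable (𝕜 E) in
/-- Coordinate functions `u k` on the open set `V`, with their coordinate vector fields. -/
structure CoordinateFrame (V : Opens M) (n : ℕ) where
  u : Fin n → M → ℂ
  del : Fin n → ∀ y : M, CTangent 𝕜 E y
  smooth : ∀ k, ∀ y ∈ V, SmoothFunAt 𝕜 E (u k) y
  expand : ∀ y ∈ V, ∀ v : CTangent 𝕜 E y, v = ∑ k, dfun 𝕜 E (u k) y v • del k y
  deriv_smooth : ∀ k, ∀ y ∈ V, ∀ f : M → ℂ, SmoothFunAt 𝕜 E f y →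
    SmoothFunAt 𝕜 E (fun z => dfun 𝕜 E f z (del k z)) y
  deriv_comm : ∀ k l, ∀ y ∈ V, ∀ f : M → ℂ, SmoothFunAt 𝕜 E f y →
    dfun 𝕜 E (fun z => dfun 𝕜 E f z (del k z)) y (del l y)
      = dfun 𝕜 E (fun z => dfun 𝕜 E f z (del l z)) y (del k y)

/-- Order `∞` at one point need not persist nearby, but order 1 does. This is enough to rewrite
derivatives of `f` in a chart on a whole neighbourhood. -/
lemma SmoothFunAt.eventually_mdifferentiableAt [IsManifold 𝓘(𝕜, E) ∞ M] {f : M → ℂ} {x : M}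
    (hf : SmoothFunAt 𝕜 E f x) : ∀ᶠ y in 𝓝 x, MDifferentiableAt 𝓘(𝕜, E) 𝓘(𝕜, ℂ) f y := by
  have : IsManifold 𝓘(𝕜, E) 1 M := IsManifold.of_le (n := ∞) (by exact_mod_cast le_top)
  have h1 : ContMDiffAt 𝓘(𝕜, E) 𝓘(𝕜, ℂ) 1 f x := ContMDiffAt.of_le hf (by exact_mod_cast le_top)
  obtain ⟨s, hs, h⟩ := (contMDiffAt_iff_contMDiffOn_nhds (by simp)).1 h1
  filter_upwards [eventually_mem_nhds_iff.2 hs] with y hy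
  exact (h.contMDiffAt hy).mdifferentiableAt (by simp)

variable (𝕜) in
/-- The derivative of the inverse of a chart, at the point corresponding to `y`. -/
def chartSymmDeriv (x₀ y : M) : E →L[𝕜] TangentSpace 𝓘(𝕜, E) y :=
  mfderiv 𝓘(𝕜, E) 𝓘(𝕜, E) (chartAt E x₀).symm (chartAt E x₀ y)

/-- The derivative of `f` in the direction of the `v`-coordinate vector field of a chart. -/
lemma realDeriv_chart_symm [IsManifold 𝓘(𝕜, E) ∞ M] (x₀ : M) (v : E) {f : M → ℂ} {y : M}
    (hy : y ∈ (chartAt E x₀).source) (hf : MDifferentiableAt 𝓘(𝕜, E) 𝓘(𝕜, ℂ) f y) :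
    realDeriv 𝕜 E f y (chartSymmDeriv 𝕜 x₀ y v)
      = fderiv 𝕜 (f ∘ (chartAt E x₀).symm) (chartAt E x₀ y) v := by
  have : IsManifold 𝓘(𝕜, E) 1 M := IsManifold.of_le (n := ∞) (by exact_mod_cast le_top)
  have hc := mdifferentiable_chart (I := 𝓘(𝕜, E)) x₀
  have hy' : chartAt E x₀ y ∈ (chartAt E x₀).target := (chartAt E x₀).map_source hy
  have h1 : MDifferentiableAt 𝓘(𝕜, E) 𝓘(𝕜, E) (chartAt E x₀).symm (chartAt E x₀ y) :=
    hc.mdifferentiableAt_symm hy'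
  have h3 := (chartAt E x₀).left_inv hy
  have hf' : MDifferentiableAt 𝓘(𝕜, E) 𝓘(𝕜, ℂ) f ((chartAt E x₀).symm (chartAt E x₀ y)) := by
    rwa [h3]
  have h2 := mfderiv_comp (chartAt E x₀ y) hf' h1
  rw [mfderiv_eq_fderiv] at h2
  rw [h2]
  -- The point obtained by going to the chart and back equals `y` only propositionally, so the base
  -- point is generalized; both tangent spaces are `E`.
  have h4 : ∀ z, z = y → ∀ w : E, (mfderiv 𝓘(𝕜, E) 𝓘(𝕜, ℂ) f z : E →L[𝕜] ℂ) w
      = (mfderiv 𝓘(𝕜, E) 𝓘(𝕜, ℂ) f y : E →L[𝕜] ℂ) w := by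
    rintro _ rfl w
    rfl
  exact (h4 _ h3 _).symm

variable (𝕜) in
/-- The coordinate vector field of a chart in the direction `v`. -/
def chartField (x₀ : M) (v : E) (y : M) : CTangent 𝕜 E y :=
  1 ⊗ₜ chartSymmDeriv 𝕜 x₀ y v

lemma dfun_chartField [IsManifold 𝓘(𝕜, E) ∞ M] (x₀ : M) (v : E) {f : M → ℂ} {y : M}
    (hy : y ∈ (chartAt E x₀).source) (hf : MDifferentiableAt 𝓘(𝕜, E) 𝓘(𝕜, ℂ) f y) :
    dfun 𝕜 E f y (chartField 𝕜 x₀ v y)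
      = fderiv 𝕜 (f ∘ (chartAt E x₀).symm) (chartAt E x₀ y) v := by
  rw [chartField, dfun_tmul, one_mul]
  exact realDeriv_chart_symm x₀ v hy hf

lemma SmoothFunAt.contDiffAt_chart [IsManifold 𝓘(𝕜, E) ∞ M] (x₀ : M) {f : M → ℂ} {y : M}
    (hy : y ∈ (chartAt E x₀).source) (hf : SmoothFunAt 𝕜 E f y) :
    ContDiffAt 𝕜 ∞ (f ∘ (chartAt E x₀).symm) (chartAt E x₀ y) := by
  have h1 : ContMDiffAt 𝓘(𝕜, E) 𝓘(𝕜, E) ∞ (chartAt E x₀).symm (chartAt E x₀ y) :=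
    contMDiffOn_chart_symm.contMDiffAt
      ((chartAt E x₀).open_target.mem_nhds ((chartAt E x₀).map_source hy))
  refine ContMDiffAt.contDiffAt (ContMDiffAt.comp _ ?_ h1)
  rw [(chartAt E x₀).left_inv hy]
  exact hf

lemma smoothFunAt_comp_chart [IsManifold 𝓘(𝕜, E) ∞ M] (x₀ : M) {F : E → ℂ} {y : M}
    (hy : y ∈ (chartAt E x₀).source) (hF : ContDiffAt 𝕜 ∞ F (chartAt E x₀ y)) :
    SmoothFunAt 𝕜 E (fun z => F (chartAt E x₀ z)) y :=
  ContMDiffAt.comp y hF.contMDiffAt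
    (contMDiffOn_chart.contMDiffAt ((chartAt E x₀).open_source.mem_nhds hy))

lemma dfun_chartField_eventuallyEq [IsManifold 𝓘(𝕜, E) ∞ M] (x₀ : M) (v : E) {f : M → ℂ} {y : M}
    (hy : y ∈ (chartAt E x₀).source) (hf : SmoothFunAt 𝕜 E f y) :
    (fun z => dfun 𝕜 E f z (chartField 𝕜 x₀ v z)) =ᶠ[𝓝 y]
      fun z => fderiv 𝕜 (f ∘ (chartAt E x₀).symm) (chartAt E x₀ z) v := by
  filter_upwards [hf.eventually_mdifferentiableAt, (chartAt E x₀).open_source.mem_nhds hy]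
    with z hz hz' using dfun_chartField x₀ v hz' hz

lemma smoothFunAt_dfun_chartField [IsManifold 𝓘(𝕜, E) ∞ M] (x₀ : M) (v : E) {f : M → ℂ} {y : M}
    (hy : y ∈ (chartAt E x₀).source) (hf : SmoothFunAt 𝕜 E f y) :
    SmoothFunAt 𝕜 E (fun z => dfun 𝕜 E f z (chartField 𝕜 x₀ v z)) y := by
  refine SmoothFunAt.congr ?_ (dfun_chartField_eventuallyEq x₀ v hy hf)
  refine smoothFunAt_comp_chart (F := fun e => fderiv 𝕜 (f ∘ (chartAt E x₀).symm) e v) x₀ hy ?_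
  exact ((hf.contDiffAt_chart x₀ hy).fderiv_right (m := ∞) (by simp)).clm_apply contDiffAt_const

/-- With iterated coordinate derivatives read as a second derivative in the chart, commutation of
coordinate fields becomes symmetry of that second derivative. -/
lemma dfun_chartField_chartField [IsManifold 𝓘(𝕜, E) ∞ M] (x₀ : M) (v w : E) {f : M → ℂ} {y : M}
    (hy : y ∈ (chartAt E x₀).source) (hf : SmoothFunAt 𝕜 E f y) :
    dfun 𝕜 E (fun z => dfun 𝕜 E f z (chartField 𝕜 x₀ v z)) y (chartField 𝕜 x₀ w y)
      = fderiv 𝕜 (fderiv 𝕜 (f ∘ (chartAt E x₀).symm)) (chartAt E x₀ y) w v := by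
  have hF := (hf.contDiffAt_chart x₀ hy).fderiv_right (m := ∞) (by simp)
  rw [dfun_chartField x₀ w hy (smoothFunAt_dfun_chartField x₀ v hy hf).mdifferentiableAt]
  have h : ((fun z => dfun 𝕜 E f z (chartField 𝕜 x₀ v z)) ∘ (chartAt E x₀).symm)
      =ᶠ[𝓝 (chartAt E x₀ y)] fun e => fderiv 𝕜 (f ∘ (chartAt E x₀).symm) e v := by
    have h1 : Filter.Tendsto (chartAt E x₀).symm (𝓝 (chartAt E x₀ y)) (𝓝 y) := by
      have := (chartAt E x₀).continuousAt_symm ((chartAt E x₀).map_source hy)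
      rwa [ContinuousAt, (chartAt E x₀).left_inv hy] at this
    filter_upwards [h1.eventually (dfun_chartField_eventuallyEq x₀ v hy hf),
      (chartAt E x₀).open_target.mem_nhds ((chartAt E x₀).map_source hy)] with e he he'
    rw [Function.comp_apply, he, (chartAt E x₀).right_inv he']
  rw [h.fderiv_eq, fderiv_clm_apply (hF.differentiableAt (by simp))
    (differentiableAt_const _)]
  simp

/-- Every point has a coordinate neighbourhood. -/
lemma exists_coordinateFrame [FiniteDimensional 𝕜 E] [IsManifold 𝓘(𝕜, E) ∞ M] (x₀ : M) :
    ∃ (V : Opens M) (n : ℕ) (_ : CoordinateFrame 𝕜 E V n), x₀ ∈ V := by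
  have : IsManifold 𝓘(𝕜, E) 1 M := IsManifold.of_le (n := ∞) (by exact_mod_cast le_top)
  have hc := mdifferentiable_chart (I := 𝓘(𝕜, E)) x₀
  let b := Module.finBasis 𝕜 E
  let coord : Fin (Module.finrank 𝕜 E) → E →L[𝕜] ℂ := fun k =>
    (Algebra.linearMap 𝕜 ℂ ∘ₗ b.coord k).toContinuousLinearMap
  have hcoord : ∀ k v, coord k v = algebraMap 𝕜 ℂ (b.repr v k) := fun k v => rfl
  have hsm : ∀ k, ∀ y ∈ (chartAt E x₀).source,
      SmoothFunAt 𝕜 E (fun z => coord k (chartAt E x₀ z)) y := fun k y hy =>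
    smoothFunAt_comp_chart x₀ hy (coord k).contDiff.contDiffAt
  have hder : ∀ k, ∀ y ∈ (chartAt E x₀).source, ∀ v,
      dfun 𝕜 E (fun z => coord k (chartAt E x₀ z)) y (chartField 𝕜 x₀ v y) = coord k v := by
    intro k y hy v
    rw [dfun_chartField x₀ v hy (hsm k y hy).mdifferentiableAt]
    have h : ((fun z => coord k (chartAt E x₀ z)) ∘ (chartAt E x₀).symm)
        =ᶠ[𝓝 (chartAt E x₀ y)] coord k := by
      filter_upwards [(chartAt E x₀).open_target.mem_nhds ((chartAt E x₀).map_source hy)]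
        with e he
      simp [(chartAt E x₀).right_inv he]
    rw [h.fderiv_eq, ContinuousLinearMap.fderiv]
  have hexp : ∀ y ∈ (chartAt E x₀).source, ∀ v : TangentSpace 𝓘(𝕜, E) y,
      (1 ⊗ₜ v : CTangent 𝕜 E y) = ∑ k, dfun 𝕜 E (fun z => coord k (chartAt E x₀ z)) y (1 ⊗ₜ v)
        • chartField 𝕜 x₀ (b k) y := by
    intro y hy v
    -- The derivative of the chart is inverse to `chartSymmDeriv`, so every tangent vector is a
    -- value of a coordinate field.
    obtain ⟨w, hw⟩ : ∃ w : E, chartSymmDeriv 𝕜 x₀ y w = v :=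
      ⟨mfderiv 𝓘(𝕜, E) 𝓘(𝕜, E) (chartAt E x₀) y v,
        DFunLike.congr_fun (hc.symm_comp_deriv hy) v⟩
    have hv : (1 ⊗ₜ v : CTangent 𝕜 E y) = chartField 𝕜 x₀ w y := by rw [chartField, hw]
    rw [hv]
    simp only [hder _ y hy]
    simp only [hcoord, algebraMap_smul]
    let φ : E →ₗ[𝕜] CTangent 𝕜 E y :=
      (TensorProduct.mk 𝕜 ℂ (TangentSpace 𝓘(𝕜, E) y) 1).comp
        (chartSymmDeriv 𝕜 x₀ y).toLinearMap
    have hφ : ∀ u, chartField 𝕜 x₀ u y = φ u := fun u => rfl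
    simp only [hφ]
    conv_lhs => rw [← b.sum_repr w]
    rw [map_sum]
    exact Finset.sum_congr rfl fun k _ => φ.map_smul _ _
  refine ⟨⟨(chartAt E x₀).source, (chartAt E x₀).open_source⟩, Module.finrank 𝕜 E,
    { u := fun k z => coord k (chartAt E x₀ z)
      del := fun k => chartField 𝕜 x₀ (b k)
      smooth := hsm
      expand := ?_
      deriv_smooth := fun k y hy f hf => smoothFunAt_dfun_chartField x₀ (b k) hy hf
      deriv_comm := ?_ }, mem_chart_source E x₀⟩
  · intro y hy v
    induction v using TensorProduct.induction_on with
    | zero => simp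
    | add a c ha hc =>
      simp only [map_add, add_smul, Finset.sum_add_distrib]
      rw [← ha, ← hc]
    | tmul z v =>
      have : (z ⊗ₜ v : CTangent 𝕜 E y) = z • (1 ⊗ₜ v) := by
        rw [TensorProduct.smul_tmul', smul_eq_mul, mul_one]
      rw [this]
      conv_lhs => rw [hexp y hy v]
      simp only [map_smul, smul_eq_mul, Finset.smul_sum, mul_smul]
  · intro k l y hy f hf
    rw [dfun_chartField_chartField x₀ _ _ hy hf, dfun_chartField_chartField x₀ _ _ hy hf]
    exact (hf.contDiffAt_chart x₀ hy).isSymmSndFDerivAt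
      (by
        rw [minSmoothness_of_isRCLikeNormedField]
        exact WithTop.coe_le_coe.2 (le_top : (2 : ℕ∞) ≤ ⊤)) _ _

end CoordinateFrame
-- Complex vector fields as derivations, and their Lie bracket.
section VectorFields

variable {𝕜 : Type uk} [RCLike 𝕜] [NormedAlgebra 𝕜 ℂ]
  {E : Type uE} [NormedAddCommGroup E] [NormedSpace 𝕜 E]
  {M : Type uM} [TopologicalSpace M] [ChartedSpace E M]
  {X Y Z : ∀ y : M, CTangent 𝕜 E y} {f g : M → ℂ} {x : M}

variable (𝕜 E) in
/-- `f` is smooth near `x`. -/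
abbrev SmoothFunNear (f : M → ℂ) (x : M) : Prop := ∀ᶠ y in 𝓝 x, SmoothFunAt 𝕜 E f y

variable (𝕜 E) in
/-- The vector field `X` is smooth near `x`. -/
abbrev VectorSmoothNear (X : ∀ y : M, CTangent 𝕜 E y) (x : M) : Prop :=
  ∀ᶠ y in 𝓝 x, VectorSmoothAt 𝕜 E X y

lemma VectorSmoothAt.congr (hX : VectorSmoothAt 𝕜 E X x) (h : ∀ᶠ y in 𝓝 x, Y y = X y) :
    VectorSmoothAt 𝕜 E Y x := fun f hf =>
  (hX f hf).congr (by filter_upwards [h] with y hy; rw [hy])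

lemma VectorSmoothAt.add (hX : VectorSmoothAt 𝕜 E X x) (hY : VectorSmoothAt 𝕜 E Y x) :
    VectorSmoothAt 𝕜 E (fun y => X y + Y y) x := fun f hf => by
  simpa only [map_add] using (hX f hf).add (hY f hf)

lemma VectorSmoothAt.smul (hg : SmoothFunAt 𝕜 E g x) (hX : VectorSmoothAt 𝕜 E X x) :
    VectorSmoothAt 𝕜 E (fun y => g y • X y) x := fun f hf => by
  simpa only [map_smul, smul_eq_mul] using hg.mul (hX f hf)

lemma vectorSmoothAt_zero : VectorSmoothAt 𝕜 E (fun _ : M => 0) x := fun f _ => by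
  simpa only [map_zero] using smoothFunAt_const 0

lemma VectorSmoothAt.sum {α : Type*} (s : Finset α) {F : α → ∀ y : M, CTangent 𝕜 E y}
    (h : ∀ k ∈ s, VectorSmoothAt 𝕜 E (F k) x) :
    VectorSmoothAt 𝕜 E (fun y => ∑ k ∈ s, F k y) x := fun f hf => by
  simpa only [map_sum] using SmoothFunAt.sum s fun k hk => h k hk f hf

lemma SmoothFunNear.deriv (hf : SmoothFunNear 𝕜 E f x) (hX : VectorSmoothNear 𝕜 E X x) :
    SmoothFunNear 𝕜 E (fun y => dfun 𝕜 E f y (X y)) x := by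
  filter_upwards [hf.eventually_nhds, hX] with y h1 h2 using h2 f h1

namespace CoordinateFrame

variable {V : Opens M} {n : ℕ} (C : CoordinateFrame 𝕜 E V n)
include C

lemma del_smoothAt (k : Fin n) (hx : x ∈ V) : VectorSmoothAt 𝕜 E (C.del k) x := fun f hf =>
  C.deriv_smooth k x hx f hf.self_of_nhds

lemma smoothNear_of_mem (k : Fin n) (hx : x ∈ V) : SmoothFunNear 𝕜 E (C.u k) x := by
  filter_upwards [V.isOpen.mem_nhds hx] with y hy using C.smooth k y hy

lemma coeff_smoothAt (k : Fin n) (hx : x ∈ V) (hX : VectorSmoothAt 𝕜 E X x) :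
    SmoothFunAt 𝕜 E (fun y => dfun 𝕜 E (C.u k) y (X y)) x :=
  hX _ (C.smoothNear_of_mem k hx)

lemma dfun_expand (hx : x ∈ V) (f : M → ℂ) (v : CTangent 𝕜 E x) :
    dfun 𝕜 E f x v = ∑ k, dfun 𝕜 E (C.u k) x v * dfun 𝕜 E f x (C.del k x) := by
  conv_lhs => rw [C.expand x hx v]
  simp only [map_sum, map_smul, smul_eq_mul]

lemma eventually_dfun_expand (hx : x ∈ V) (f : M → ℂ) (X : ∀ y : M, CTangent 𝕜 E y) :
    (fun y => dfun 𝕜 E f y (X y)) =ᶠ[𝓝 x] fun y =>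
      ∑ k, dfun 𝕜 E (C.u k) y (X y) * dfun 𝕜 E f y (C.del k y) := by
  filter_upwards [V.isOpen.mem_nhds hx] with y hy using C.dfun_expand hy f (X y)

end CoordinateFrame

lemma dfun_sum {α : Type*} (s : Finset α) {F : α → M → ℂ}
    (h : ∀ k ∈ s, SmoothFunAt 𝕜 E (F k) x) :
    dfun 𝕜 E (fun y => ∑ k ∈ s, F k y) x = ∑ k ∈ s, dfun 𝕜 E (F k) x := by
  classical
  induction s using Finset.induction_on with
  | empty => simpa using dfun_const (𝕜 := 𝕜) (E := E) (x := x) 0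
  | insert a s ha ih =>
    simp only [Finset.sum_insert ha]
    rw [dfun_add (h a (by simp)) (SmoothFunAt.sum s fun k hk => h k (by simp [hk])),
      ih fun k hk => h k (by simp [hk])]

variable [FiniteDimensional 𝕜 E] [IsManifold 𝓘(𝕜, E) ∞ M]

/-- Vectors are determined by their action on functions. -/
lemma ctangent_ext {v w : CTangent 𝕜 E x}
    (h : ∀ f : M → ℂ, SmoothFunNear 𝕜 E f x → dfun 𝕜 E f x v = dfun 𝕜 E f x w) : v = w := by
  obtain ⟨V, n, C, hx⟩ := exists_coordinateFrame (𝕜 := 𝕜) (E := E) x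
  rw [C.expand x hx v, C.expand x hx w]
  simp only [h _ (C.smoothNear_of_mem _ hx)]

/-- Constant coefficients in a coordinate frame give the extension. Pointwise identities between
forms can therefore be tested on smooth fields. -/
lemma exists_vectorField (v : CTangent 𝕜 E x) :
    ∃ X : ∀ y : M, CTangent 𝕜 E y, VectorSmoothNear 𝕜 E X x ∧ X x = v := by
  obtain ⟨V, n, C, hx⟩ := exists_coordinateFrame (𝕜 := 𝕜) (E := E) x
  refine ⟨fun y => ∑ k, dfun 𝕜 E (C.u k) x v • C.del k y, ?_, (C.expand x hx v).symm⟩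
  filter_upwards [V.isOpen.mem_nhds hx] with y hy
  exact VectorSmoothAt.sum _ fun k _ =>
    VectorSmoothAt.smul (g := fun _ => dfun 𝕜 E (C.u k) x v) (smoothFunAt_const _)
      (C.del_smoothAt k hy)

lemma ccotangent_ext {α β : CCotangent 𝕜 E x}
    (h : ∀ Z : (∀ y : M, CTangent 𝕜 E y), VectorSmoothNear 𝕜 E Z x → α (Z x) = β (Z x)) :
    α = β := by
  refine LinearMap.ext fun v => ?_
  obtain ⟨Z, hZ, rfl⟩ := exists_vectorField v
  exact h Z hZ

/-- The definition by choice is useful only once some vector has the required property. In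
coordinates the second-order parts of `X (Y f)` and `Y (X f)` agree by `deriv_comm` and cancel, so
the difference is the derivative along the vector with coefficients `X (Y u_k) - Y (X u_k)`. -/
lemma vbracket_spec (hX : VectorSmoothAt 𝕜 E X x) (hY : VectorSmoothAt 𝕜 E Y x)
    (hf : SmoothFunNear 𝕜 E f x) :
    dfun 𝕜 E f x (vbracket 𝕜 E X Y x)
      = dfun 𝕜 E (fun y => dfun 𝕜 E f y (Y y)) x (X x)
        - dfun 𝕜 E (fun y => dfun 𝕜 E f y (X y)) x (Y x) := by
  obtain ⟨V, n, C, hx⟩ := exists_coordinateFrame (𝕜 := 𝕜) (E := E) x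
  have key : ∀ (X Y : ∀ y : M, CTangent 𝕜 E y), VectorSmoothAt 𝕜 E X x →
      VectorSmoothAt 𝕜 E Y x → ∀ f, SmoothFunNear 𝕜 E f x →
      dfun 𝕜 E (fun y => dfun 𝕜 E f y (Y y)) x (X x)
        = ∑ k, (dfun 𝕜 E (fun y => dfun 𝕜 E (C.u k) y (Y y)) x (X x) * dfun 𝕜 E f x (C.del k x)
          + dfun 𝕜 E (C.u k) x (Y x) * ∑ l, dfun 𝕜 E (C.u l) x (X x)
            * dfun 𝕜 E (fun z => dfun 𝕜 E f z (C.del k z)) x (C.del l x)) := by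
    intro X Y hX hY f hf
    have h1 : ∀ k, SmoothFunAt 𝕜 E (fun y => dfun 𝕜 E (C.u k) y (Y y)) x := fun k =>
      C.coeff_smoothAt k hx hY
    have h2 : ∀ k, SmoothFunAt 𝕜 E (fun y => dfun 𝕜 E f y (C.del k y)) x := fun k =>
      C.deriv_smooth k x hx f hf.self_of_nhds
    rw [dfun_congr (C.eventually_dfun_expand hx f Y),
      dfun_sum _ fun k _ => (h1 k).mul (h2 k), LinearMap.sum_apply]
    refine Finset.sum_congr rfl fun k _ => ?_
    rw [dfun_mul (h1 k) (h2 k), ← C.dfun_expand hx]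
    simp only [LinearMap.add_apply, LinearMap.smul_apply, smul_eq_mul]
    ring
  refine Classical.epsilon_spec (p := fun Z : CTangent 𝕜 E x =>
    ∀ f : M → ℂ, (∀ᶠ y in 𝓝 x, SmoothFunAt 𝕜 E f y) →
      dfun 𝕜 E f x Z
        = dfun 𝕜 E (fun y => dfun 𝕜 E f y (Y y)) x (X x)
          - dfun 𝕜 E (fun y => dfun 𝕜 E f y (X y)) x (Y x))
    ⟨∑ k, (dfun 𝕜 E (fun y => dfun 𝕜 E (C.u k) y (Y y)) x (X x)
      - dfun 𝕜 E (fun y => dfun 𝕜 E (C.u k) y (X y)) x (Y x)) • C.del k x, ?_⟩ f hf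
  intro f hf
  rw [key X Y hX hY f hf, key Y X hY hX f hf, Finset.sum_add_distrib, Finset.sum_add_distrib]
  have hs : ∑ k, dfun 𝕜 E (C.u k) x (Y x) * ∑ l, dfun 𝕜 E (C.u l) x (X x)
        * dfun 𝕜 E (fun z => dfun 𝕜 E f z (C.del k z)) x (C.del l x)
      = ∑ k, dfun 𝕜 E (C.u k) x (X x) * ∑ l, dfun 𝕜 E (C.u l) x (Y x)
        * dfun 𝕜 E (fun z => dfun 𝕜 E f z (C.del k z)) x (C.del l x) := by
    simp only [Finset.mul_sum]
    rw [Finset.sum_comm]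
    refine Finset.sum_congr rfl fun k _ => Finset.sum_congr rfl fun l _ => ?_
    rw [C.deriv_comm l k x hx f hf.self_of_nhds]
    ring
  rw [hs, add_sub_add_right_eq_sub, ← Finset.sum_sub_distrib]
  simp only [map_sum, map_smul, smul_eq_mul, sub_mul]

lemma VectorSmoothNear.vbracket_at (hX : VectorSmoothNear 𝕜 E X x)
    (hY : VectorSmoothNear 𝕜 E Y x) : VectorSmoothAt 𝕜 E (vbracket 𝕜 E X Y) x := by
  intro f hf
  have h : (fun y => dfun 𝕜 E f y (vbracket 𝕜 E X Y y)) =ᶠ[𝓝 x] fun y =>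
      dfun 𝕜 E (fun y => dfun 𝕜 E f y (Y y)) y (X y)
        - dfun 𝕜 E (fun y => dfun 𝕜 E f y (X y)) y (Y y) := by
    filter_upwards [hX, hY, hf.eventually_nhds] with y h1 h2 h3 using vbracket_spec h1 h2 h3
  exact SmoothFunAt.congr ((((SmoothFunNear.deriv hf hY).deriv hX).self_of_nhds).sub
    (((SmoothFunNear.deriv hf hX).deriv hY).self_of_nhds)) h

lemma VectorSmoothNear.vbracket (hX : VectorSmoothNear 𝕜 E X x)
    (hY : VectorSmoothNear 𝕜 E Y x) : VectorSmoothNear 𝕜 E (vbracket 𝕜 E X Y) x := by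
  filter_upwards [hX.eventually_nhds, hY.eventually_nhds] with y h1 h2 using
    VectorSmoothNear.vbracket_at h1 h2

-- No smoothness is needed: the property handed to `epsilon` is the same for both pairs of fields.
omit [FiniteDimensional 𝕜 E] [IsManifold 𝓘(𝕜, E) ∞ M] in
lemma vbracket_congr {X' Y' : ∀ y : M, CTangent 𝕜 E y} (hX : ∀ᶠ y in 𝓝 x, X y = X' y)
    (hY : ∀ᶠ y in 𝓝 x, Y y = Y' y) : vbracket 𝕜 E X Y x = vbracket 𝕜 E X' Y' x := by
  unfold Gerbes.vbracket
  congr 1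
  funext Z
  refine propext (forall_congr' fun f => imp_congr_right fun _ => ?_)
  have h1 : (fun y => dfun 𝕜 E f y (Y y)) =ᶠ[𝓝 x] fun y => dfun 𝕜 E f y (Y' y) := by
    filter_upwards [hY] with y hy; rw [hy]
  have h2 : (fun y => dfun 𝕜 E f y (X y)) =ᶠ[𝓝 x] fun y => dfun 𝕜 E f y (X' y) := by
    filter_upwards [hX] with y hy; rw [hy]
  rw [dfun_congr h1, dfun_congr h2, hX.self_of_nhds, hY.self_of_nhds]

lemma vbracket_skew (hX : VectorSmoothNear 𝕜 E X x) (hY : VectorSmoothNear 𝕜 E Y x) :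
    vbracket 𝕜 E X Y x = - vbracket 𝕜 E Y X x := by
  refine ctangent_ext fun f hf => ?_
  rw [map_neg, vbracket_spec hX.self_of_nhds hY.self_of_nhds hf,
    vbracket_spec hY.self_of_nhds hX.self_of_nhds hf, neg_sub]

lemma vbracket_self (hX : VectorSmoothNear 𝕜 E X x) : vbracket 𝕜 E X X x = 0 := by
  refine ctangent_ext fun f hf => ?_
  rw [map_zero, vbracket_spec hX.self_of_nhds hX.self_of_nhds hf, sub_self]

lemma vbracket_add (hX : VectorSmoothNear 𝕜 E X x) (hY : VectorSmoothNear 𝕜 E Y x)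
    (hZ : VectorSmoothNear 𝕜 E Z x) :
    vbracket 𝕜 E X (fun y => Y y + Z y) x = vbracket 𝕜 E X Y x + vbracket 𝕜 E X Z x := by
  have hYZ := hY.self_of_nhds.add hZ.self_of_nhds
  refine ctangent_ext fun f hf => ?_
  rw [map_add, vbracket_spec hX.self_of_nhds hYZ hf,
    vbracket_spec hX.self_of_nhds hY.self_of_nhds hf,
    vbracket_spec hX.self_of_nhds hZ.self_of_nhds hf]
  simp only [map_add]
  rw [dfun_add (hY.self_of_nhds f hf) (hZ.self_of_nhds f hf), LinearMap.add_apply]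
  ring

lemma vbracket_smul (hg : SmoothFunNear 𝕜 E g x) (hX : VectorSmoothNear 𝕜 E X x)
    (hY : VectorSmoothNear 𝕜 E Y x) :
    vbracket 𝕜 E X (fun y => g y • Y y) x
      = g x • vbracket 𝕜 E X Y x + dfun 𝕜 E g x (X x) • Y x := by
  refine ctangent_ext fun f hf => ?_
  rw [vbracket_spec hX.self_of_nhds (VectorSmoothAt.smul hg.self_of_nhds hY.self_of_nhds) hf]
  simp only [map_add, map_smul, smul_eq_mul]
  rw [vbracket_spec hX.self_of_nhds hY.self_of_nhds hf,
    dfun_mul hg.self_of_nhds (hY.self_of_nhds f hf)]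
  simp only [LinearMap.add_apply, LinearMap.smul_apply, smul_eq_mul]
  ring

/-- The defining formula of the bracket holds near `x`, hence may be differentiated once more; this
is what nested brackets require. -/
lemma dfun_dfun_vbracket (hY : VectorSmoothNear 𝕜 E Y x) (hZ : VectorSmoothNear 𝕜 E Z x)
    (hf : SmoothFunNear 𝕜 E f x) :
    dfun 𝕜 E (fun y => dfun 𝕜 E f y (vbracket 𝕜 E Y Z y)) x
      = dfun 𝕜 E (fun y => dfun 𝕜 E (fun y => dfun 𝕜 E f y (Z y)) y (Y y)) x
        - dfun 𝕜 E (fun y => dfun 𝕜 E (fun y => dfun 𝕜 E f y (Y y)) y (Z y)) x := by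
  have h : (fun y => dfun 𝕜 E f y (Gerbes.vbracket 𝕜 E Y Z y)) =ᶠ[𝓝 x] fun y =>
      dfun 𝕜 E (fun y => dfun 𝕜 E f y (Z y)) y (Y y)
        - dfun 𝕜 E (fun y => dfun 𝕜 E f y (Y y)) y (Z y) := by
    filter_upwards [hY, hZ, hf.eventually_nhds] with y h1 h2 h3 using vbracket_spec h1 h2 h3
  rw [dfun_congr h, dfun_sub ((SmoothFunNear.deriv hf hZ).deriv hY).self_of_nhds
    ((SmoothFunNear.deriv hf hY).deriv hZ).self_of_nhds]

/-- On functions this is the identity for commutators of operators: all triple derivatives cancel in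
pairs. -/
lemma vbracket_jacobi (hX : VectorSmoothNear 𝕜 E X x) (hY : VectorSmoothNear 𝕜 E Y x)
    (hZ : VectorSmoothNear 𝕜 E Z x) :
    vbracket 𝕜 E X (vbracket 𝕜 E Y Z) x
      = vbracket 𝕜 E (vbracket 𝕜 E X Y) Z x + vbracket 𝕜 E Y (vbracket 𝕜 E X Z) x := by
  refine ctangent_ext fun f hf => ?_
  rw [map_add, vbracket_spec hX.self_of_nhds (hY.vbracket hZ).self_of_nhds hf,
    vbracket_spec (hX.vbracket hY).self_of_nhds hZ.self_of_nhds hf,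
    vbracket_spec hY.self_of_nhds (hX.vbracket hZ).self_of_nhds hf,
    dfun_dfun_vbracket hY hZ hf, dfun_dfun_vbracket hX hY hf, dfun_dfun_vbracket hX hZ hf,
    vbracket_spec hX.self_of_nhds hY.self_of_nhds (SmoothFunNear.deriv hf hZ),
    vbracket_spec hY.self_of_nhds hZ.self_of_nhds (SmoothFunNear.deriv hf hX),
    vbracket_spec hX.self_of_nhds hZ.self_of_nhds (SmoothFunNear.deriv hf hY)]
  simp only [LinearMap.sub_apply]
  ring

/-- An expression in a vector field near `x` which is linear over functions only depends on the
value of the vector field at `x`. -/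
lemma exists_linearMap_of_tensorial {W : Type*} [AddCommGroup W] [Module ℂ W]
    (Φ : (∀ y : M, CTangent 𝕜 E y) → W)
    (hcongr : ∀ X Y : (∀ y : M, CTangent 𝕜 E y), (∀ᶠ y in 𝓝 x, X y = Y y) → Φ X = Φ Y)
    (hadd : ∀ X Y : (∀ y : M, CTangent 𝕜 E y), VectorSmoothNear 𝕜 E X x →
      VectorSmoothNear 𝕜 E Y x → Φ (fun y => X y + Y y) = Φ X + Φ Y)
    (hsmul : ∀ (g : M → ℂ) (X : ∀ y : M, CTangent 𝕜 E y), SmoothFunNear 𝕜 E g x →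
      VectorSmoothNear 𝕜 E X x → Φ (fun y => g y • X y) = g x • Φ X) :
    ∃ β : CTangent 𝕜 E x →ₗ[ℂ] W, ∀ Z : (∀ y : M, CTangent 𝕜 E y),
      VectorSmoothNear 𝕜 E Z x → β (Z x) = Φ Z := by
  obtain ⟨V, n, C, hx⟩ := exists_coordinateFrame (𝕜 := 𝕜) (E := E) x
  have hV := V.isOpen.mem_nhds hx
  have hdel : ∀ k, VectorSmoothNear 𝕜 E (C.del k) x := fun k => by
    filter_upwards [hV] with y hy using C.del_smoothAt k hy
  -- Linearity over functions leaves only one candidate: `v ↦ ∑ du_k(v) Φ(∂_k)`.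
  refine ⟨∑ k, (dfun 𝕜 E (C.u k) x).smulRight (Φ (C.del k)), fun Z hZ => ?_⟩
  have hc : ∀ k, SmoothFunNear 𝕜 E (fun y => dfun 𝕜 E (C.u k) y (Z y)) x := fun k =>
    SmoothFunNear.deriv (C.smoothNear_of_mem k hx) hZ
  have hterm : ∀ k, VectorSmoothNear 𝕜 E (fun y => dfun 𝕜 E (C.u k) y (Z y) • C.del k y) x :=
    fun k => by
      filter_upwards [hc k, hdel k] with y h1 h2 using VectorSmoothAt.smul h1 h2
  have hsum : ∀ s : Finset (Fin n),
      Φ (fun y => ∑ k ∈ s, dfun 𝕜 E (C.u k) y (Z y) • C.del k y)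
        = ∑ k ∈ s, dfun 𝕜 E (C.u k) x (Z x) • Φ (C.del k) := by
    intro s
    induction s using Finset.induction_on with
    | empty =>
      -- The empty sum is the zero field, on which `Φ` vanishes by linearity over the zero function.
      have := hsmul (fun _ => 0) (fun _ => 0) (.of_forall fun y => smoothFunAt_const 0)
        (.of_forall fun y => vectorSmoothAt_zero)
      simpa using this
    | insert a s ha ih =>
      simp only [Finset.sum_insert ha]
      rw [hadd _ _ (hterm a), ih, hsmul _ _ (hc a) (hdel a)]
      filter_upwards [Filter.eventually_all.2 hterm] with y hy using
        VectorSmoothAt.sum _ fun k _ => hy k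
  rw [hcongr Z (fun y => ∑ k, dfun 𝕜 E (C.u k) y (Z y) • C.del k y), hsum]
  · simp
  · filter_upwards [hV] with y hy using C.expand y hy (Z y)

end VectorFields
-- One-forms and the covector part of the Courant bracket.
section Covectors

variable {𝕜 : Type uk} [RCLike 𝕜] [NormedAlgebra 𝕜 ℂ]
  {E : Type uE} [NormedAddCommGroup E] [NormedSpace 𝕜 E]
  {M : Type uM} [TopologicalSpace M] [ChartedSpace E M]
  {X Y Z W : ∀ y : M, CTangent 𝕜 E y} {ξ η ζ : ∀ y : M, CCotangent 𝕜 E y}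
  {f g : M → ℂ} {x : M}

variable (𝕜 E) in
/-- The 1-form `ξ` is smooth near `x`. -/
abbrev CovectorSmoothNear (ξ : ∀ y : M, CCotangent 𝕜 E y) (x : M) : Prop :=
  ∀ᶠ y in 𝓝 x, CovectorSmoothAt 𝕜 E ξ y

lemma CovectorSmoothAt.congr (hξ : CovectorSmoothAt 𝕜 E ξ x) (h : ∀ᶠ y in 𝓝 x, η y = ξ y) :
    CovectorSmoothAt 𝕜 E η x := fun X hX =>
  (hξ X hX).congr (by filter_upwards [h] with y hy; rw [hy])

lemma CovectorSmoothAt.add (hξ : CovectorSmoothAt 𝕜 E ξ x) (hη : CovectorSmoothAt 𝕜 E η x) :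
    CovectorSmoothAt 𝕜 E (fun y => ξ y + η y) x := fun X hX => (hξ X hX).add (hη X hX)

lemma CovectorSmoothAt.smul (hg : SmoothFunAt 𝕜 E g x) (hξ : CovectorSmoothAt 𝕜 E ξ x) :
    CovectorSmoothAt 𝕜 E (fun y => g y • ξ y) x := fun X hX => hg.mul (hξ X hX)

lemma covectorSmoothAt_zero : CovectorSmoothAt 𝕜 E (fun _ : M => 0) x := fun _ _ =>
  smoothFunAt_const 0

lemma CovectorSmoothNear.apply (hξ : CovectorSmoothNear 𝕜 E ξ x)
    (hX : VectorSmoothNear 𝕜 E X x) : SmoothFunNear 𝕜 E (fun y => ξ y (X y)) x := by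
  filter_upwards [hξ, hX.eventually_nhds] with y h1 h2 using h1 X h2

/-- The de Rham differential of a 1-form on the tangent bundle. -/
lemma tangent_d₁ (ξ : ∀ y : M, CCotangent 𝕜 E y) (X Y : ∀ y : M, CTangent 𝕜 E y) (x : M) :
    (tangentAlgebroid 𝕜 E M).d₁ ξ X Y x
      = dfun 𝕜 E (fun y => ξ y (Y y)) x (X x) - dfun 𝕜 E (fun y => ξ y (X y)) x (Y x)
        - ξ x (vbracket 𝕜 E X Y x) := rfl

/-- The covector part `L_X η - i_Y dξ` of the Courant bracket. -/
def courantCovector (X : ∀ y : M, CTangent 𝕜 E y) (ξ : ∀ y : M, CCotangent 𝕜 E y)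
    (Y : ∀ y : M, CTangent 𝕜 E y) (η : ∀ y : M, CCotangent 𝕜 E y) (x : M) : CCotangent 𝕜 E x :=
  lieDer X η x - contrD Y ξ x

lemma covectorOf_congr {Φ Ψ : (∀ y : M, CTangent 𝕜 E y) → ℂ} (h : Φ = Ψ) :
    covectorOf x Φ = covectorOf x Ψ := by rw [h]

lemma lieDer_congr {X' : ∀ y : M, CTangent 𝕜 E y} {η' : ∀ y : M, CCotangent 𝕜 E y}
    (hX : ∀ᶠ y in 𝓝 x, X y = X' y) (hη : ∀ᶠ y in 𝓝 x, η y = η' y) :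
    lieDer X η x = lieDer X' η' x := by
  refine covectorOf_congr (funext fun Z => ?_)
  have h : (fun y => η y (Z y)) =ᶠ[𝓝 x] fun y => η' y (Z y) := by
    filter_upwards [hη] with y hy; rw [hy]
  rw [dfun_congr h, vbracket_congr hX (.of_forall fun y => rfl), hX.self_of_nhds,
    hη.self_of_nhds]

lemma contrD_congr {X' : ∀ y : M, CTangent 𝕜 E y} {η' : ∀ y : M, CCotangent 𝕜 E y}
    (hX : ∀ᶠ y in 𝓝 x, X y = X' y) (hη : ∀ᶠ y in 𝓝 x, η y = η' y) :
    contrD X η x = contrD X' η' x := by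
  refine covectorOf_congr (funext fun Z => ?_)
  have h : (fun y => η y (Z y)) =ᶠ[𝓝 x] fun y => η' y (Z y) := by
    filter_upwards [hη] with y hy; rw [hy]
  have h' : (fun y => η y (X y)) =ᶠ[𝓝 x] fun y => η' y (X' y) := by
    filter_upwards [hη, hX] with y hy hy'; rw [hy, hy']
  rw [tangent_d₁, tangent_d₁, dfun_congr h, dfun_congr h',
    vbracket_congr hX (.of_forall fun y => rfl), hX.self_of_nhds, hη.self_of_nhds]

variable [FiniteDimensional 𝕜 E] [IsManifold 𝓘(𝕜, E) ∞ M]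

/-- Replacing `Z` by `g Z` creates `X(g) η(Z)` in the derivative term and again, with opposite sign,
in the bracket term. The expression is thus tensorial in `Z`, which supplies a covector for
`covectorOf` to choose. -/
lemma lieDer_apply (hX : VectorSmoothNear 𝕜 E X x) (hη : CovectorSmoothNear 𝕜 E η x)
    (hZ : VectorSmoothNear 𝕜 E Z x) :
    lieDer X η x (Z x)
      = dfun 𝕜 E (fun y => η y (Z y)) x (X x) - η x (vbracket 𝕜 E X Z x) := by
  refine Classical.epsilon_spec (exists_linearMap_of_tensorial
    (fun Z => dfun 𝕜 E (fun y => η y (Z y)) x (X x) - η x (vbracket 𝕜 E X Z x)) ?_ ?_ ?_) Z hZ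
  · intro Y Z h
    have h' : (fun y => η y (Y y)) =ᶠ[𝓝 x] fun y => η y (Z y) := by
      filter_upwards [h] with y hy; rw [hy]
    simp only [dfun_congr h', vbracket_congr (.of_forall fun y => rfl) h]
  · intro Y Z hY hZ
    simp only [vbracket_add hX hY hZ, map_add]
    rw [dfun_add (hη.apply hY).self_of_nhds (hη.apply hZ).self_of_nhds, LinearMap.add_apply]
    ring
  · intro g Z hg hZ
    simp only [vbracket_smul hg hX hZ, map_add, map_smul, smul_eq_mul]
    rw [dfun_mul hg.self_of_nhds (hη.apply hZ).self_of_nhds]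
    simp only [LinearMap.add_apply, LinearMap.smul_apply, smul_eq_mul]
    ring

/-- The same cancellation, now of `Y(g) ξ(Z)`, makes `dξ(Y, Z)` tensorial in `Z`. -/
lemma contrD_apply (hY : VectorSmoothNear 𝕜 E Y x) (hξ : CovectorSmoothNear 𝕜 E ξ x)
    (hZ : VectorSmoothNear 𝕜 E Z x) :
    contrD Y ξ x (Z x)
      = dfun 𝕜 E (fun y => ξ y (Z y)) x (Y x) - dfun 𝕜 E (fun y => ξ y (Y y)) x (Z x)
        - ξ x (vbracket 𝕜 E Y Z x) := by
  refine Classical.epsilon_spec (exists_linearMap_of_tensorial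
    (fun Z => (tangentAlgebroid 𝕜 E M).d₁ ξ Y Z x) ?_ ?_ ?_) Z hZ
  · intro Z Z' h
    have h' : (fun y => ξ y (Z y)) =ᶠ[𝓝 x] fun y => ξ y (Z' y) := by
      filter_upwards [h] with y hy; rw [hy]
    simp only [tangent_d₁, dfun_congr h', vbracket_congr (.of_forall fun y => rfl) h,
      h.self_of_nhds]
  · intro Z Z' hZ hZ'
    simp only [tangent_d₁, vbracket_add hY hZ hZ', map_add]
    rw [dfun_add (hξ.apply hZ).self_of_nhds (hξ.apply hZ').self_of_nhds, LinearMap.add_apply]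
    ring
  · intro g Z hg hZ
    simp only [tangent_d₁, vbracket_smul hg hY hZ, map_add, map_smul, smul_eq_mul]
    rw [dfun_mul hg.self_of_nhds (hξ.apply hZ).self_of_nhds]
    simp only [LinearMap.add_apply, LinearMap.smul_apply, smul_eq_mul]
    ring

/-- All identities for the covector part are computed from this formula, by testing on an arbitrary
field `W`. -/
lemma courantCovector_apply (hX : VectorSmoothNear 𝕜 E X x) (hξ : CovectorSmoothNear 𝕜 E ξ x)
    (hY : VectorSmoothNear 𝕜 E Y x) (hη : CovectorSmoothNear 𝕜 E η x)
    (hW : VectorSmoothNear 𝕜 E W x) :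
    courantCovector X ξ Y η x (W x)
      = dfun 𝕜 E (fun y => η y (W y)) x (X x) - η x (vbracket 𝕜 E X W x)
        - dfun 𝕜 E (fun y => ξ y (W y)) x (Y x) + dfun 𝕜 E (fun y => ξ y (Y y)) x (W x)
        + ξ x (vbracket 𝕜 E Y W x) := by
  rw [courantCovector, LinearMap.sub_apply, lieDer_apply hX hη hW, contrD_apply hY hξ hW]
  ring

lemma eventually_courantCovector_apply (hX : VectorSmoothNear 𝕜 E X x)
    (hξ : CovectorSmoothNear 𝕜 E ξ x) (hY : VectorSmoothNear 𝕜 E Y x)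
    (hη : CovectorSmoothNear 𝕜 E η x) (hW : VectorSmoothNear 𝕜 E W x) :
    (fun x => courantCovector X ξ Y η x (W x)) =ᶠ[𝓝 x] fun x =>
      dfun 𝕜 E (fun y => η y (W y)) x (X x) - η x (vbracket 𝕜 E X W x)
        - dfun 𝕜 E (fun y => ξ y (W y)) x (Y x) + dfun 𝕜 E (fun y => ξ y (Y y)) x (W x)
        + ξ x (vbracket 𝕜 E Y W x) := by
  filter_upwards [hX.eventually_nhds, hξ.eventually_nhds, hY.eventually_nhds,
    hη.eventually_nhds, hW.eventually_nhds] with y h1 h2 h3 h4 h5 using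
    courantCovector_apply h1 h2 h3 h4 h5

lemma courantCovector_smoothNear (hX : VectorSmoothNear 𝕜 E X x)
    (hξ : CovectorSmoothNear 𝕜 E ξ x) (hY : VectorSmoothNear 𝕜 E Y x)
    (hη : CovectorSmoothNear 𝕜 E η x) :
    CovectorSmoothNear 𝕜 E (courantCovector X ξ Y η) x := by
  filter_upwards [hX.eventually_nhds, hξ.eventually_nhds, hY.eventually_nhds,
    hη.eventually_nhds] with y hX hξ hY hη W hW
  replace hξ : CovectorSmoothNear 𝕜 E ξ y := hξ
  replace hη : CovectorSmoothNear 𝕜 E η y := hη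
  replace hX : VectorSmoothNear 𝕜 E X y := hX
  replace hY : VectorSmoothNear 𝕜 E Y y := hY
  refine SmoothFunAt.congr ?_ (eventually_courantCovector_apply hX hξ hY hη hW)
  exact (((((hη.apply hW).deriv hX).self_of_nhds.sub
    (hη.apply (hX.vbracket hW)).self_of_nhds).sub
    ((hξ.apply hW).deriv hY).self_of_nhds).add
    ((hξ.apply hY).deriv hW).self_of_nhds).add (hξ.apply (hY.vbracket hW)).self_of_nhds

lemma dfun_courantCovector (hX : VectorSmoothNear 𝕜 E X x) (hξ : CovectorSmoothNear 𝕜 E ξ x)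
    (hY : VectorSmoothNear 𝕜 E Y x) (hη : CovectorSmoothNear 𝕜 E η x)
    (hW : VectorSmoothNear 𝕜 E W x) (v : CTangent 𝕜 E x) :
    dfun 𝕜 E (fun x => courantCovector X ξ Y η x (W x)) x v
      = dfun 𝕜 E (fun x => dfun 𝕜 E (fun y => η y (W y)) x (X x)) x v
        - dfun 𝕜 E (fun x => η x (vbracket 𝕜 E X W x)) x v
        - dfun 𝕜 E (fun x => dfun 𝕜 E (fun y => ξ y (W y)) x (Y x)) x v
        + dfun 𝕜 E (fun x => dfun 𝕜 E (fun y => ξ y (Y y)) x (W x)) x v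
        + dfun 𝕜 E (fun x => ξ x (vbracket 𝕜 E Y W x)) x v := by
  have h1 := ((hη.apply hW).deriv hX).self_of_nhds
  have h2 := (hη.apply (hX.vbracket hW)).self_of_nhds
  have h3 := ((hξ.apply hW).deriv hY).self_of_nhds
  have h4 := ((hξ.apply hY).deriv hW).self_of_nhds
  have h5 := (hξ.apply (hY.vbracket hW)).self_of_nhds
  rw [dfun_congr (eventually_courantCovector_apply hX hξ hY hη hW),
    dfun_add (((h1.sub h2).sub h3).add h4) h5, dfun_add ((h1.sub h2).sub h3) h4,
    dfun_sub (h1.sub h2) h3, dfun_sub h1 h2]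
  rfl

/-- On a test field `W`, everything becomes second derivatives of functions such as `ζ(W)` and
values of forms on double brackets. Brackets acting on functions expand into commutators, the Jacobi
identity for vector fields is applied to the three triples containing `W`, and the rest cancels. No
condition on the pairing enters. -/
lemma courantCovector_jacobi (hX : VectorSmoothNear 𝕜 E X x) (hξ : CovectorSmoothNear 𝕜 E ξ x)
    (hY : VectorSmoothNear 𝕜 E Y x) (hη : CovectorSmoothNear 𝕜 E η x)
    (hZ : VectorSmoothNear 𝕜 E Z x) (hζ : CovectorSmoothNear 𝕜 E ζ x) :
    courantCovector X ξ (vbracket 𝕜 E Y Z) (courantCovector Y η Z ζ) x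
      = courantCovector (vbracket 𝕜 E X Y) (courantCovector X ξ Y η) Z ζ x
        + courantCovector Y η (vbracket 𝕜 E X Z) (courantCovector X ξ Z ζ) x := by
  refine ccotangent_ext fun W hW => ?_
  have cYZ := courantCovector_smoothNear hY hη hZ hζ
  have cXY := courantCovector_smoothNear hX hξ hY hη
  have cXZ := courantCovector_smoothNear hX hξ hZ hζ
  rw [LinearMap.add_apply,
    courantCovector_apply hX hξ (hY.vbracket hZ) cYZ hW,
    courantCovector_apply (hX.vbracket hY) cXY hZ hζ hW,
    courantCovector_apply hY hη (hX.vbracket hZ) cXZ hW,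
    dfun_courantCovector hY hη hZ hζ hW, dfun_courantCovector hX hξ hY hη hW,
    dfun_courantCovector hX hξ hY hη hZ, dfun_courantCovector hX hξ hZ hζ hW,
    courantCovector_apply hY hη hZ hζ (hX.vbracket hW),
    courantCovector_apply hX hξ hY hη (hZ.vbracket hW),
    courantCovector_apply hX hξ hZ hζ (hY.vbracket hW),
    vbracket_spec hY.self_of_nhds hZ.self_of_nhds (hξ.apply hW),
    vbracket_spec hX.self_of_nhds hY.self_of_nhds (hζ.apply hW),
    vbracket_spec hX.self_of_nhds hZ.self_of_nhds (hη.apply hW),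
    vbracket_spec hX.self_of_nhds hW.self_of_nhds (hη.apply hZ),
    vbracket_spec hY.self_of_nhds hW.self_of_nhds (hξ.apply hZ),
    vbracket_spec hZ.self_of_nhds hW.self_of_nhds (hξ.apply hY),
    vbracket_jacobi hX hY hW, vbracket_jacobi hY hZ hW, vbracket_jacobi hX hZ hW]
  simp only [map_add]
  ring

lemma courantCovector_add (hX : VectorSmoothNear 𝕜 E X x) (hξ : CovectorSmoothNear 𝕜 E ξ x)
    (hY : VectorSmoothNear 𝕜 E Y x) (hη : CovectorSmoothNear 𝕜 E η x)
    (hZ : VectorSmoothNear 𝕜 E Z x) (hζ : CovectorSmoothNear 𝕜 E ζ x) :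
    courantCovector X ξ (fun y => Y y + Z y) (fun y => η y + ζ y) x
      = courantCovector X ξ Y η x + courantCovector X ξ Z ζ x := by
  refine ccotangent_ext fun W hW => ?_
  have hYZ : VectorSmoothNear 𝕜 E (fun y => Y y + Z y) x := by
    filter_upwards [hY, hZ] with y h1 h2 using h1.add h2
  have hηζ : CovectorSmoothNear 𝕜 E (fun y => η y + ζ y) x := by
    filter_upwards [hη, hζ] with y h1 h2 using h1.add h2
  have hb : vbracket 𝕜 E (fun y => Y y + Z y) W x
      = vbracket 𝕜 E Y W x + vbracket 𝕜 E Z W x := by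
    rw [vbracket_skew hYZ hW, vbracket_add hW hY hZ, vbracket_skew hW hY, vbracket_skew hW hZ]
    abel
  rw [LinearMap.add_apply, courantCovector_apply hX hξ hYZ hηζ hW,
    courantCovector_apply hX hξ hY hη hW, courantCovector_apply hX hξ hZ hζ hW, hb]
  simp only [map_add, LinearMap.add_apply]
  rw [dfun_add (hη.apply hW).self_of_nhds (hζ.apply hW).self_of_nhds,
    dfun_add (hξ.apply hY).self_of_nhds (hξ.apply hZ).self_of_nhds]
  simp only [LinearMap.add_apply]
  ring

/-- The terms `W(g) ξ(Y)` coming from `ξ(gY)` and from `[gY, W]` cancel, so the Leibniz rule in the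
second argument has no correction by the pairing. -/
lemma courantCovector_smul (hg : SmoothFunNear 𝕜 E g x) (hX : VectorSmoothNear 𝕜 E X x)
    (hξ : CovectorSmoothNear 𝕜 E ξ x) (hY : VectorSmoothNear 𝕜 E Y x)
    (hη : CovectorSmoothNear 𝕜 E η x) :
    courantCovector X ξ (fun y => g y • Y y) (fun y => g y • η y) x
      = g x • courantCovector X ξ Y η x + dfun 𝕜 E g x (X x) • η x := by
  refine ccotangent_ext fun W hW => ?_
  have hgY : VectorSmoothNear 𝕜 E (fun y => g y • Y y) x := by
    filter_upwards [hg, hY] with y h1 h2 using VectorSmoothAt.smul h1 h2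
  have hgη : CovectorSmoothNear 𝕜 E (fun y => g y • η y) x := by
    filter_upwards [hg, hη] with y h1 h2 using CovectorSmoothAt.smul h1 h2
  have hb : vbracket 𝕜 E (fun y => g y • Y y) W x
      = g x • vbracket 𝕜 E Y W x - dfun 𝕜 E g x (W x) • Y x := by
    rw [vbracket_skew hgY hW, vbracket_smul hg hW hY, vbracket_skew hW hY]
    module
  rw [LinearMap.add_apply, LinearMap.smul_apply, LinearMap.smul_apply,
    courantCovector_apply hX hξ hgY hgη hW, courantCovector_apply hX hξ hY hη hW, hb]
  simp only [map_sub, map_smul, LinearMap.smul_apply, smul_eq_mul]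
  rw [dfun_mul hg.self_of_nhds (hη.apply hW).self_of_nhds,
    dfun_mul hg.self_of_nhds (hξ.apply hY).self_of_nhds]
  simp only [LinearMap.add_apply, LinearMap.smul_apply, smul_eq_mul]
  ring

/-- Adding the two orders leaves only `d(ξ(Y) + η(X))`, twice the differential of the pairing. It
vanishes at `x` because the pairing vanishes on a whole neighbourhood. -/
lemma courantCovector_skew (hX : VectorSmoothNear 𝕜 E X x) (hξ : CovectorSmoothNear 𝕜 E ξ x)
    (hY : VectorSmoothNear 𝕜 E Y x) (hη : CovectorSmoothNear 𝕜 E η x)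
    (h : ∀ᶠ y in 𝓝 x, ξ y (Y y) + η y (X y) = 0) :
    courantCovector X ξ Y η x = - courantCovector Y η X ξ x := by
  refine ccotangent_ext fun W hW => ?_
  have hd : dfun 𝕜 E (fun y => ξ y (Y y)) x + dfun 𝕜 E (fun y => η y (X y)) x = 0 := by
    rw [← dfun_add (hξ.apply hY).self_of_nhds (hη.apply hX).self_of_nhds,
      dfun_congr (g := fun _ => 0) h, dfun_const]
  have hd' := LinearMap.congr_fun hd (W x)
  rw [LinearMap.add_apply, LinearMap.zero_apply] at hd'
  rw [LinearMap.neg_apply, courantCovector_apply hX hξ hY hη hW,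
    courantCovector_apply hY hη hX hξ hW]
  linear_combination hd'

end Covectors

/-! ### The Courant bracket on 𝕋M and the action of closed 2-forms. -/

section GeneralizedTangent

variable {𝕜 : Type uk} [RCLike 𝕜] [NormedAlgebra 𝕜 ℂ]
  {E : Type uE} [NormedAddCommGroup E] [NormedSpace 𝕜 E]
  {M : Type uM} [TopologicalSpace M] [ChartedSpace E M]
  {a b c : ∀ y : M, GTangent 𝕜 E y} {f g : M → ℂ} {x : M}

/-- The section `a` of `𝕋M` is smooth near `x`. -/
abbrev GSmoothNear (a : ∀ y : M, GTangent 𝕜 E y) (x : M) : Prop := ∀ᶠ y in 𝓝 x, GSmoothAt a y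

lemma GSmoothNear.fst (h : GSmoothNear a x) : VectorSmoothNear 𝕜 E (fun y => (a y).1) x :=
  h.mono fun _ h => h.1

lemma GSmoothNear.snd (h : GSmoothNear a x) : CovectorSmoothNear 𝕜 E (fun y => (a y).2) x :=
  h.mono fun _ h => h.2

lemma GSmoothAt.congr (ha : GSmoothAt a x) (h : ∀ᶠ y in 𝓝 x, b y = a y) : GSmoothAt b x :=
  ⟨ha.1.congr (h.mono fun y hy => by rw [hy]), ha.2.congr (h.mono fun y hy => by rw [hy])⟩

lemma GSmoothAt.add (ha : GSmoothAt a x) (hb : GSmoothAt b x) :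
    GSmoothAt (fun y => a y + b y) x :=
  ⟨ha.1.add hb.1, ha.2.add hb.2⟩

lemma GSmoothAt.smul (hg : SmoothFunAt 𝕜 E g x) (ha : GSmoothAt a x) :
    GSmoothAt (fun y => g y • a y) x :=
  ⟨VectorSmoothAt.smul hg ha.1, CovectorSmoothAt.smul hg ha.2⟩

lemma gsmoothAt_zero : GSmoothAt (𝕜 := 𝕜) (E := E) (fun _ : M => 0) x :=
  ⟨vectorSmoothAt_zero, covectorSmoothAt_zero⟩

lemma GSmoothAt.sum {α : Type*} (s : Finset α) {F : α → ∀ y : M, GTangent 𝕜 E y}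
    (h : ∀ k ∈ s, GSmoothAt (F k) x) : GSmoothAt (fun y => ∑ k ∈ s, F k y) x := by
  classical
  induction s using Finset.induction_on with
  | empty => simpa using gsmoothAt_zero
  | insert a s ha ih =>
    simp only [Finset.sum_insert ha]
    exact (h a (by simp)).add (ih fun k hk => h k (by simp [hk]))

lemma courantBracket_eq (a b : ∀ y : M, GTangent 𝕜 E y) (x : M) :
    courantBracket a b x
      = (vbracket 𝕜 E (fun y => (a y).1) (fun y => (b y).1) x,
        courantCovector (fun y => (a y).1) (fun y => (a y).2) (fun y => (b y).1)
          (fun y => (b y).2) x) := rfl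

lemma courantBracket_congr {a' b' : ∀ y : M, GTangent 𝕜 E y} (ha : ∀ᶠ y in 𝓝 x, a y = a' y)
    (hb : ∀ᶠ y in 𝓝 x, b y = b' y) : courantBracket a b x = courantBracket a' b' x := by
  have ha1 : ∀ᶠ y in 𝓝 x, (a y).1 = (a' y).1 := ha.mono fun y hy => by rw [hy]
  have ha2 : ∀ᶠ y in 𝓝 x, (a y).2 = (a' y).2 := ha.mono fun y hy => by rw [hy]
  have hb1 : ∀ᶠ y in 𝓝 x, (b y).1 = (b' y).1 := hb.mono fun y hy => by rw [hy]
  have hb2 : ∀ᶠ y in 𝓝 x, (b y).2 = (b' y).2 := hb.mono fun y hy => by rw [hy]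
  exact Prod.ext (vbracket_congr ha1 hb1)
    (congrArg₂ (· - ·) (lieDer_congr ha1 hb2) (contrD_congr hb1 ha2))

lemma courantBracket_congr_right (a : ∀ y : M, GTangent 𝕜 E y) {b' : ∀ y : M, GTangent 𝕜 E y}
    (hb : ∀ᶠ y in 𝓝 x, b y = b' y) : courantBracket a b x = courantBracket a b' x :=
  courantBracket_congr (.of_forall fun _ => rfl) hb

lemma courantBracket_congr_left (b : ∀ y : M, GTangent 𝕜 E y) {a' : ∀ y : M, GTangent 𝕜 E y}
    (ha : ∀ᶠ y in 𝓝 x, a y = a' y) : courantBracket a b x = courantBracket a' b x :=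
  courantBracket_congr ha (.of_forall fun _ => rfl)

variable [FiniteDimensional 𝕜 E] [IsManifold 𝓘(𝕜, E) ∞ M]

lemma courantBracket_smoothNear (ha : GSmoothNear a x) (hb : GSmoothNear b x) :
    GSmoothNear (courantBracket a b) x :=
  (ha.fst.vbracket hb.fst).and (courantCovector_smoothNear ha.fst ha.snd hb.fst hb.snd)

lemma courantBracket_jacobi (ha : GSmoothNear a x) (hb : GSmoothNear b x)
    (hc : GSmoothNear c x) :
    courantBracket a (courantBracket b c) x
      = courantBracket (courantBracket a b) c x + courantBracket b (courantBracket a c) x :=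
  Prod.ext (vbracket_jacobi ha.fst hb.fst hc.fst)
    (courantCovector_jacobi ha.fst ha.snd hb.fst hb.snd hc.fst hc.snd)

lemma courantBracket_add (ha : GSmoothNear a x) (hb : GSmoothNear b x)
    (hc : GSmoothNear c x) :
    courantBracket a (fun y => b y + c y) x = courantBracket a b x + courantBracket a c x :=
  Prod.ext (vbracket_add ha.fst hb.fst hc.fst)
    (courantCovector_add ha.fst ha.snd hb.fst hb.snd hc.fst hc.snd)

lemma courantBracket_smul (hg : SmoothFunNear 𝕜 E g x) (ha : GSmoothNear a x)
    (hb : GSmoothNear b x) :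
    courantBracket a (fun y => g y • b y) x
      = g x • courantBracket a b x + dfun 𝕜 E g x (a x).1 • b x :=
  Prod.ext (vbracket_smul hg ha.fst hb.fst)
    (courantCovector_smul hg ha.fst ha.snd hb.fst hb.snd)

omit [FiniteDimensional 𝕜 E] [IsManifold 𝓘(𝕜, E) ∞ M] in
lemma symPair_eq_zero_iff (e e' : GTangent 𝕜 E x) :
    symPair e e' = 0 ↔ e.2 e'.1 + e'.2 e.1 = 0 := by
  simp [symPair]

lemma courantBracket_skew (ha : GSmoothNear a x) (hb : GSmoothNear b x)
    (h : ∀ᶠ y in 𝓝 x, symPair (a y) (b y) = 0) :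
    courantBracket a b x = - courantBracket b a x :=
  Prod.ext (vbracket_skew ha.fst hb.fst)
    (courantCovector_skew ha.fst ha.snd hb.fst hb.snd
      (h.mono fun _ hy => (symPair_eq_zero_iff _ _).1 hy))

variable (𝕜 E) in
/-- `F` is a closed smooth 2-form near `x`. -/
structure IsClosedFormNear
    (F : ∀ y : M, CTangent 𝕜 E y →ₗ[ℂ] CTangent 𝕜 E y →ₗ[ℂ] ℂ) (x : M) : Prop where
  alt : ∀ᶠ y in 𝓝 x, ∀ v, F y v v = 0
  smooth : ∀ᶠ y in 𝓝 x, ∀ X Y : (∀ y : M, CTangent 𝕜 E y), VectorSmoothNear 𝕜 E X y →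
    VectorSmoothNear 𝕜 E Y y → SmoothFunAt 𝕜 E (fun y => F y (X y) (Y y)) y
  closed : ∀ X Y Z : (∀ y : M, CTangent 𝕜 E y), VectorSmoothNear 𝕜 E X x →
    VectorSmoothNear 𝕜 E Y x → VectorSmoothNear 𝕜 E Z x →
    (tangentAlgebroid 𝕜 E M).d₂ F X Y Z x = 0

variable {F : ∀ y : M, CTangent 𝕜 E y →ₗ[ℂ] CTangent 𝕜 E y →ₗ[ℂ] ℂ}
  {X Y Z : ∀ y : M, CTangent 𝕜 E y}

omit [FiniteDimensional 𝕜 E] [IsManifold 𝓘(𝕜, E) ∞ M]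

lemma tangent_d₂ (F : ∀ y : M, CTangent 𝕜 E y →ₗ[ℂ] CTangent 𝕜 E y →ₗ[ℂ] ℂ)
    (X Y Z : ∀ y : M, CTangent 𝕜 E y) (x : M) :
    (tangentAlgebroid 𝕜 E M).d₂ F X Y Z x
      = dfun 𝕜 E (fun y => F y (Y y) (Z y)) x (X x)
        - dfun 𝕜 E (fun y => F y (X y) (Z y)) x (Y x)
        + dfun 𝕜 E (fun y => F y (X y) (Y y)) x (Z x)
        - F x (vbracket 𝕜 E X Y x) (Z x) + F x (vbracket 𝕜 E X Z x) (Y x)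
        - F x (vbracket 𝕜 E Y Z x) (X x) := rfl

lemma neg_flip_of_alt {W : Type*} [AddCommGroup W] [Module ℂ W] {B : W →ₗ[ℂ] W →ₗ[ℂ] ℂ}
    (h : ∀ v, B v v = 0) (v w : W) : B v w = - B w v := by
  have := h (v + w)
  simp only [map_add, LinearMap.add_apply, h] at this
  linear_combination this

lemma IsClosedFormNear.smoothNear (hF : IsClosedFormNear 𝕜 E F x)
    (hX : VectorSmoothNear 𝕜 E X x) (hY : VectorSmoothNear 𝕜 E Y x) :
    SmoothFunNear 𝕜 E (fun y => F y (X y) (Y y)) x := by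
  filter_upwards [hF.smooth, hX.eventually_nhds, hY.eventually_nhds] with y h1 h2 h3 using
    h1 X Y h2 h3

lemma IsClosedFormNear.covectorSmoothNear (hF : IsClosedFormNear 𝕜 E F x)
    (hX : VectorSmoothNear 𝕜 E X x) : CovectorSmoothNear 𝕜 E (fun y => F y (X y)) x := by
  filter_upwards [hF.smooth, hX.eventually_nhds] with y h1 h2 Y hY using h1 X Y h2 hY

lemma IsClosedFormNear.neg (hF : IsClosedFormNear 𝕜 E F x) :
    IsClosedFormNear 𝕜 E (fun y => - F y) x where
  alt := hF.alt.mono fun y h v => by simp [h v]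
  smooth := hF.smooth.mono fun y h X Y hX hY => (h X Y hX hY).neg
  closed X Y Z hX hY hZ := by
    have h := hF.closed X Y Z hX hY hZ
    rw [tangent_d₂] at h ⊢
    simp only [LinearMap.neg_apply]
    rw [dfun_neg (hF.smoothNear hY hZ).self_of_nhds, dfun_neg (hF.smoothNear hX hZ).self_of_nhds,
      dfun_neg (hF.smoothNear hX hY).self_of_nhds]
    simp only [LinearMap.neg_apply]
    linear_combination -h

lemma GSmoothNear.expB (hF : IsClosedFormNear 𝕜 E F x) (ha : GSmoothNear a x) :
    GSmoothNear (fun y => expB (F y) (a y)) x := by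
  filter_upwards [ha, hF.covectorSmoothNear ha.fst] with y h1 h2 using ⟨h1.1, h1.2.add h2⟩

/-- Closed 2-forms act by automorphisms of the Courant bracket. -/
lemma courantBracket_expB [FiniteDimensional 𝕜 E] [IsManifold 𝓘(𝕜, E) ∞ M]
    (hF : IsClosedFormNear 𝕜 E F x) (ha : GSmoothNear a x) (hb : GSmoothNear b x) :
    courantBracket (fun y => Gerbes.expB (F y) (a y)) (fun y => Gerbes.expB (F y) (b y)) x
      = Gerbes.expB (F x) (courantBracket a b x) := by
  -- The vector parts agree outright; on a test field `W` the covector parts differ by `dF(X, Y,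
  -- W)`, which is zero by `h`.
  refine Prod.ext rfl (ccotangent_ext fun W hW => ?_)
  have hFa := hF.covectorSmoothNear ha.fst
  have hFb := hF.covectorSmoothNear hb.fst
  have h := hF.closed _ _ W ha.fst hb.fst hW
  have hflip := fun v w => neg_flip_of_alt hF.alt.self_of_nhds v w
  have h1 := courantCovector_apply (ha.expB hF).fst (ha.expB hF).snd (hb.expB hF).fst
    (hb.expB hF).snd hW
  have h2 := courantCovector_apply ha.fst ha.snd hb.fst hb.snd hW
  rw [tangent_d₂] at h
  change courantCovector (fun y => (Gerbes.expB (F y) (a y)).1)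
    (fun y => (Gerbes.expB (F y) (a y)).2) (fun y => (Gerbes.expB (F y) (b y)).1)
    (fun y => (Gerbes.expB (F y) (b y)).2) x (W x)
    = courantCovector (fun y => (a y).1) (fun y => (a y).2) (fun y => (b y).1)
      (fun y => (b y).2) x (W x)
      + F x (vbracket 𝕜 E (fun y => (a y).1) (fun y => (b y).1) x) (W x)
  rw [h1, h2]
  change dfun 𝕜 E (fun y => (b y).2 (W y) + F y (b y).1 (W y)) x (a x).1
      - ((b x).2 (vbracket 𝕜 E (fun y => (a y).1) W x)
        + F x (b x).1 (vbracket 𝕜 E (fun y => (a y).1) W x))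
      - dfun 𝕜 E (fun y => (a y).2 (W y) + F y (a y).1 (W y)) x (b x).1
      + dfun 𝕜 E (fun y => (a y).2 (b y).1 + F y (a y).1 (b y).1) x (W x)
      + ((a x).2 (vbracket 𝕜 E (fun y => (b y).1) W x)
        + F x (a x).1 (vbracket 𝕜 E (fun y => (b y).1) W x)) = _
  rw [dfun_add (hb.snd.apply hW).self_of_nhds (hFb.apply hW).self_of_nhds,
    dfun_add (ha.snd.apply hW).self_of_nhds (hFa.apply hW).self_of_nhds,
    dfun_add (ha.snd.apply hb.fst).self_of_nhds (hFa.apply hb.fst).self_of_nhds]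
  simp only [LinearMap.add_apply]
  -- Brackets are moved to the first argument of `F`, where they stand in the formula for `dF`.
  rw [hflip (b x).1, hflip (a x).1 (vbracket 𝕜 E (fun y => (b y).1) W x)]
  linear_combination h

end GeneralizedTangent
-- Local frames of vector bundles and line bundles.
section LineFrames

variable {𝕜 : Type uk} [RCLike 𝕜] [NormedAlgebra 𝕜 ℂ]
  {E : Type uE} [NormedAddCommGroup E] [NormedSpace 𝕜 E]
  {M : Type uM} [TopologicalSpace M] [ChartedSpace E M]

/-- Axioms for connections and pairings concern sections smooth over an open `V ≤ U`, while the
calculus concerns germs; this is the passage from the latter to the former. -/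
lemma exists_opens_le_of_eventually {p : M → Prop} {x : M} {U : Opens M} (hx : x ∈ U)
    (h : ∀ᶠ y in 𝓝 x, p y) : ∃ V ≤ U, x ∈ V ∧ ∀ y ∈ V, p y := by
  obtain ⟨t, ht, ho, hxt⟩ := eventually_nhds_iff.1 h
  exact ⟨⟨t, ho⟩ ⊓ U, inf_le_right, ⟨hxt, hx⟩, fun y hy => ht y hy.1⟩

lemma Opens.eventually_mem {V : Opens M} {x : M} (hx : x ∈ V) : ∀ᶠ y in 𝓝 x, y ∈ V :=
  V.isOpen.mem_nhds hx

variable (𝕜 E) in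
/-- A local frame of the line bundle `L` over `V`. -/
structure LineFrame (L : BundleData.{uM, v} M) (V : Opens M) where
  s : L.Sec
  coord : ∀ y, L.fiber y →ₗ[ℂ] ℂ
  coord_s : ∀ y ∈ V, coord y (s y) = 1
  eq_smul : ∀ y ∈ V, ∀ t : L.fiber y, t = coord y t • s y
  smoothAt_iff : ∀ t : L.Sec, ∀ y ∈ V,
    L.SmoothAt t y ↔ SmoothFunAt 𝕜 E (fun z => coord z (t z)) y

/-- A local frame of a vector bundle, together with the coordinates in this frame. -/
lemma IsVectorBundleOn.exists_frame {U : Opens M} {L : BundleData.{uM, v} M}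
    (hL : IsVectorBundleOn 𝕜 E U L) {x : M} (hx : x ∈ U) :
    ∃ V ≤ U, ∃ (n : ℕ) (e : Fin n → L.Sec) (c : ∀ y, L.fiber y →ₗ[ℂ] (Fin n → ℂ)), x ∈ V ∧
      (∀ y ∈ V, ∀ k, c y (e k y) = Pi.single k 1) ∧
      (∀ y ∈ V, ∀ t, t = ∑ k, c y t k • e k y) ∧
      ∀ (t : L.Sec), ∀ y ∈ V,
        L.SmoothAt t y ↔ ∀ k, SmoothFunAt 𝕜 E (fun z => c z (t z) k) y := by
  obtain ⟨V₀, n, e, hxV, hb, hs⟩ := hL x hx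
  -- Coordinates have to be linear maps at every point of `M`; off `V₀` the zero map serves.
  have hc : ∀ y, ∃ c : L.fiber y →ₗ[ℂ] (Fin n → ℂ), y ∈ V₀ →
      (∀ k, c (e k y) = Pi.single k 1) ∧ ∀ t, t = ∑ k, c t k • e k y := by
    intro y
    by_cases hy : y ∈ V₀
    · let b := Module.Basis.mk (hb y hy).1 (hb y hy).2.ge
      have hbe : ∀ k, b k = e k y := fun k => Module.Basis.mk_apply _ _ k
      refine ⟨b.equivFun.toLinearMap, fun _ => ⟨fun k => ?_, fun t => ?_⟩⟩
      · rw [← hbe k]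
        ext j
        simp [Pi.single_apply, eq_comm]
      · simp only [← hbe]
        exact (b.sum_equivFun t).symm
    · exact ⟨0, fun h => absurd h hy⟩
  choose c hc using hc
  refine ⟨V₀ ⊓ U, inf_le_right, n, e, c, ⟨hxV, hx⟩, fun y hy => (hc y hy.1).1,
    fun y hy => (hc y hy.1).2, fun t y hy => (hs t y hy.1).trans ⟨?_, fun h => ⟨_, h, ?_⟩⟩⟩
  · rintro ⟨d, hd, h⟩ k
    refine (hd k).congr ?_
    filter_upwards [h, Opens.eventually_mem hy.1] with z hz hzV
    rw [hz]
    simp [(hc z hzV).1, Finset.sum_apply, Pi.single_apply]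
  · filter_upwards [Opens.eventually_mem hy.1] with z hz using (hc z hz).2 (t z)

lemma IsLineBundleOn.exists_lineFrame {U : Opens M} {L : BundleData.{uM, v} M}
    (hL : IsLineBundleOn 𝕜 E U L) {x : M} (hx : x ∈ U) :
    ∃ V ≤ U, x ∈ V ∧ Nonempty (LineFrame 𝕜 E L V) := by
  obtain ⟨V, hV, n, e, c, hxV, h1, h2, h3⟩ := hL.1.exists_frame hx
  have hinj : Function.Bijective (c x) := by
    refine ⟨fun s t hst => ?_, fun d => ⟨∑ k, d k • e k x, ?_⟩⟩
    · rw [h2 x hxV s, h2 x hxV t, hst]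
    · rw [map_sum]
      ext j
      simp [h1 x hxV, Finset.sum_apply, Pi.single_apply]
  -- The length of the frame is read off at the single point `x`, where the fibre is identified with
  -- `ℂ^n`.
  have hn : n = 1 := by
    rw [← hL.2 x hx, (LinearEquiv.ofBijective _ hinj).finrank_eq]
    simp
  subst hn
  refine ⟨V, hV, hxV, ⟨⟨e 0, fun y => LinearMap.proj 0 ∘ₗ c y, fun y hy => ?_, fun y hy t => ?_,
    fun t y hy => ?_⟩⟩⟩
  · simp [h1 y hy]
  · conv_lhs => rw [h2 y hy t]
    simp
  · rw [h3 t y hy]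
    simp

namespace LineFrame

variable {L : BundleData.{uM, v} M} {V : Opens M} {x : M} (φ : LineFrame 𝕜 E L V)
include φ

lemma s_smoothAt (hx : x ∈ V) : L.SmoothAt φ.s x := by
  rw [φ.smoothAt_iff _ x hx]
  refine (smoothFunAt_const 1).congr ?_
  filter_upwards [Opens.eventually_mem hx] with y hy using φ.coord_s y hy

lemma s_smoothNear (hx : x ∈ V) : ∀ᶠ y in 𝓝 x, L.SmoothAt φ.s y := by
  filter_upwards [Opens.eventually_mem hx] with y hy using φ.s_smoothAt hy

lemma smul_s_injective (hx : x ∈ V) {z w : ℂ} (h : z • φ.s x = w • φ.s x) : z = w := by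
  simpa [φ.coord_s x hx] using congrArg (φ.coord x) h

lemma s_ne_zero (hx : x ∈ V) : φ.s x ≠ 0 := fun h => by
  simpa [h] using φ.coord_s x hx

end LineFrame

end LineFrames

/-! ### Curvature of line bundle connections: existence and closedness. -/

section Curvature

variable {𝕜 : Type uk} [RCLike 𝕜] [NormedAlgebra 𝕜 ℂ]
  {E : Type uE} [NormedAddCommGroup E] [NormedSpace 𝕜 E]
  {M : Type uM} [TopologicalSpace M] [ChartedSpace E M]

/-- The commutator `D_a D_b s - D_b D_a s - D_[a,b] s`. -/
def curvatureOp {A : LieAlgebroidData.{uk, uE, uM, w} 𝕜 E M} {L : BundleData.{uM, v} M}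
    (D : ConnOp A L) (a b : A.Sec) (s : L.Sec) (x : M) : L.fiber x :=
  D (fun y => D s y (b y)) x (a x) - D (fun y => D s y (a y)) x (b x) - D s x (A.bracket a b x)

/-- The condition characterizing the curvature at `x`. -/
def IsCurvatureAt {A : LieAlgebroidData.{uk, uE, uM, w} 𝕜 E M} {L : BundleData.{uM, v} M}
    (D : ConnOp A L) (x : M) (F : A.fiber x →ₗ[ℂ] A.fiber x →ₗ[ℂ] ℂ) : Prop :=
  ∀ (a b : A.Sec) (s : L.Sec), (∀ᶠ y in 𝓝 x, A.SmoothAt a y) →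
    (∀ᶠ y in 𝓝 x, A.SmoothAt b y) → (∀ᶠ y in 𝓝 x, L.SmoothAt s y) →
    F (a x) (b x) • s x = curvatureOp D a b s x

lemma IsCurvatureAt.curvature {A : LieAlgebroidData.{uk, uE, uM, w} 𝕜 E M}
    {L : BundleData.{uM, v} M} {D : ConnOp A L} {x : M}
    {F : A.fiber x →ₗ[ℂ] A.fiber x →ₗ[ℂ] ℂ} (hF : IsCurvatureAt D x F) :
    IsCurvatureAt D x (curvature D x) :=
  Classical.epsilon_spec (p := fun F => IsCurvatureAt D x F) ⟨F, hF⟩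

/-- Tested on a frame, the characterizing identity determines the scalar `F(a, b)`; `hA` provides
smooth sections through any two vectors. -/
lemma IsCurvatureAt.unique {A : LieAlgebroidData.{uk, uE, uM, w} 𝕜 E M}
    {L : BundleData.{uM, v} M} {D : ConnOp A L} {x : M}
    {F F' : A.fiber x →ₗ[ℂ] A.fiber x →ₗ[ℂ] ℂ} (hF : IsCurvatureAt D x F)
    (hF' : IsCurvatureAt D x F') {V : Opens M} (φ : LineFrame 𝕜 E L V) (hx : x ∈ V)
    (hA : ∀ v : A.fiber x, ∃ a : A.Sec, (∀ᶠ y in 𝓝 x, A.SmoothAt a y) ∧ a x = v) : F = F' := by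
  refine LinearMap.ext₂ fun v w => ?_
  obtain ⟨a, ha, rfl⟩ := hA v
  obtain ⟨b, hb, rfl⟩ := hA w
  apply φ.smul_s_injective hx
  rw [hF a b φ.s ha hb (φ.s_smoothNear hx), hF' a b φ.s ha hb (φ.s_smoothNear hx)]

variable {L : BundleData.{uM, v} M} {U V : Opens M} {x : M}
  {D : ConnOp (tangentAlgebroid 𝕜 E M) L} {X Y Z : ∀ y : M, CTangent 𝕜 E y} {t : L.Sec}

/-- The covariant derivative along a vector field. -/
def covDeriv (D : ConnOp (tangentAlgebroid 𝕜 E M) L) (X : ∀ y : M, CTangent 𝕜 E y)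
    (t : L.Sec) : L.Sec :=
  fun y => D t y (X y)

lemma curvatureOp_tangent (D : ConnOp (tangentAlgebroid 𝕜 E M) L)
    (X Y : ∀ y : M, CTangent 𝕜 E y) (t : L.Sec) (x : M) :
    curvatureOp D X Y t x = covDeriv D X (covDeriv D Y t) x - covDeriv D Y (covDeriv D X t) x
      - covDeriv D (vbracket 𝕜 E X Y) t x := rfl

/-- The connection form of `D` in a local frame. -/
def LineFrame.form (φ : LineFrame 𝕜 E L V) (D : ConnOp (tangentAlgebroid 𝕜 E M) L) (y : M) :
    CCotangent 𝕜 E y :=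
  (φ.coord y).comp (D φ.s y)

lemma IsConnectionOn.smoothNear {A : LieAlgebroidData.{uk, uE, uM, w} 𝕜 E M} {D : ConnOp A L}
    (hD : IsConnectionOn A U L D) (hx : x ∈ U) (ht : ∀ᶠ y in 𝓝 x, L.SmoothAt t y) {a : A.Sec}
    (ha : ∀ᶠ y in 𝓝 x, A.SmoothAt a y) : ∀ᶠ y in 𝓝 x, L.SmoothAt (fun z => D t z (a z)) y := by
  obtain ⟨V, hVU, hxV, h⟩ := exists_opens_le_of_eventually hx (ht.and ha)
  filter_upwards [Opens.eventually_mem hxV] with y hy using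
    hD.smooth V hVU t a (fun z hz => (h z hz).1) (fun z hz => (h z hz).2) y hy

lemma IsConnectionOn.covDeriv_smoothNear
    (hD : IsConnectionOn (tangentAlgebroid 𝕜 E M) U L D) (hx : x ∈ U)
    (ht : ∀ᶠ y in 𝓝 x, L.SmoothAt t y) (hX : VectorSmoothNear 𝕜 E X x) :
    ∀ᶠ y in 𝓝 x, L.SmoothAt (covDeriv D X t) y :=
  hD.smoothNear hx ht hX

namespace LineFrame

variable (φ : LineFrame 𝕜 E L V)

lemma form_smoothNear (hD : IsConnectionOn (tangentAlgebroid 𝕜 E M) U L D) (hVU : V ≤ U)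
    (hx : x ∈ V) : CovectorSmoothNear 𝕜 E (φ.form D) x := by
  filter_upwards [Opens.eventually_mem hx] with y hy X hX
  exact (φ.smoothAt_iff _ y hy).1
    (hD.smoothNear (hVU hy) (φ.s_smoothNear hy) hX).self_of_nhds

lemma coord_smoothNear (hx : x ∈ V) (ht : ∀ᶠ y in 𝓝 x, L.SmoothAt t y) :
    SmoothFunNear 𝕜 E (fun y => φ.coord y (t y)) x := by
  filter_upwards [Opens.eventually_mem hx, ht] with y hy h using (φ.smoothAt_iff t y hy).1 h

/-- In the frame the connection is `d + ω`: locality allows replacing `t` by its coefficient times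
the frame, and then the Leibniz rule applies. -/
lemma conn_apply (hD : IsConnectionOn (tangentAlgebroid 𝕜 E M) U L D) (hVU : V ≤ U)
    (hx : x ∈ V) (ht : ∀ᶠ y in 𝓝 x, L.SmoothAt t y) (X : ∀ y : M, CTangent 𝕜 E y) :
    covDeriv D X t x = (dfun 𝕜 E (fun y => φ.coord y (t y)) x (X x)
      + φ.coord x (t x) * φ.form D x (X x)) • φ.s x := by
  obtain ⟨V', hV', hxV', h⟩ := exists_opens_le_of_eventually hx ht
  have h1 := LinearMap.congr_fun (hD.congr V' (hV'.trans hVU) t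
    (L.fmul (fun y => φ.coord y (t y)) φ.s) h
    (fun y hy => φ.eq_smul y (hV' hy) (t y)) x hxV') (X x)
  have h2 := hD.leibniz V' (hV'.trans hVU) (fun y => φ.coord y (t y)) φ.s
    (fun y hy => (φ.smoothAt_iff t y (hV' hy)).1 (h y hy))
    (fun y hy => φ.s_smoothAt (hV' hy)) x hxV' (X x)
  have h3 : D φ.s x (X x) = φ.form D x (X x) • φ.s x := φ.eq_smul x hx (D φ.s x (X x))
  refine (h1.trans h2).trans ?_
  rw [h3, add_smul, mul_smul]
  rfl

variable [FiniteDimensional 𝕜 E] [IsManifold 𝓘(𝕜, E) ∞ M]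

/-- With the connection written as `d + ω`, the commutator leaves `dω`: the products `ω(X) ω(Y)`
cancel because they are scalars, and the second derivatives of the coefficient combine into `[X,
Y]`. -/
lemma curvatureOp_eq (hD : IsConnectionOn (tangentAlgebroid 𝕜 E M) U L D) (hVU : V ≤ U)
    (hx : x ∈ V) (hX : VectorSmoothNear 𝕜 E X x) (hY : VectorSmoothNear 𝕜 E Y x)
    (ht : ∀ᶠ y in 𝓝 x, L.SmoothAt t y) :
    curvatureOp D X Y t x
      = ((tangentAlgebroid 𝕜 E M).d₁ (φ.form D) X Y x * φ.coord x (t x)) • φ.s x := by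
  have hω := φ.form_smoothNear hD hVU hx
  have hc := φ.coord_smoothNear hx ht
  have key : ∀ X Y : (∀ y : M, CTangent 𝕜 E y), VectorSmoothNear 𝕜 E X x →
      VectorSmoothNear 𝕜 E Y x → covDeriv D X (covDeriv D Y t) x
        = (dfun 𝕜 E (fun y => dfun 𝕜 E (fun y => φ.coord y (t y)) y (Y y)) x (X x)
          + φ.coord x (t x) * dfun 𝕜 E (fun y => φ.form D y (Y y)) x (X x)
          + φ.form D x (Y x) * dfun 𝕜 E (fun y => φ.coord y (t y)) x (X x)
          + (dfun 𝕜 E (fun y => φ.coord y (t y)) x (Y x)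
            + φ.coord x (t x) * φ.form D x (Y x)) * φ.form D x (X x)) • φ.s x := by
    intro X Y hX hY
    have h : (fun y => φ.coord y (covDeriv D Y t y)) =ᶠ[𝓝 x] fun y =>
        dfun 𝕜 E (fun y => φ.coord y (t y)) y (Y y) + φ.coord y (t y) * φ.form D y (Y y) := by
      filter_upwards [Opens.eventually_mem hx, ht.eventually_nhds] with y hy hty
      rw [φ.conn_apply hD hVU hy hty, map_smul, φ.coord_s y hy, smul_eq_mul, mul_one]
    have h' : φ.coord x (covDeriv D Y t x) = _ := h.self_of_nhds
    rw [φ.conn_apply hD hVU hx (hD.covDeriv_smoothNear (hVU hx) ht hY), dfun_congr h, h',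
      dfun_add (hc.deriv hY).self_of_nhds (hc.self_of_nhds.mul (hω.apply hY).self_of_nhds),
      dfun_mul hc.self_of_nhds (hω.apply hY).self_of_nhds]
    simp only [LinearMap.add_apply, LinearMap.smul_apply, smul_eq_mul, add_assoc]
  rw [curvatureOp_tangent, key X Y hX hY, key Y X hY hX, φ.conn_apply hD hVU hx ht,
    vbracket_spec hX.self_of_nhds hY.self_of_nhds hc, tangent_d₁, ← sub_smul, ← sub_smul]
  congr 1
  ring

end LineFrame

variable [FiniteDimensional 𝕜 E] [IsManifold 𝓘(𝕜, E) ∞ M]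

/-- The differential of a 1-form, as a 2-form. -/
lemma exists_twoForm_d₁ {α : ∀ y : M, CCotangent 𝕜 E y} (hα : CovectorSmoothNear 𝕜 E α x) :
    ∃ F : CTangent 𝕜 E x →ₗ[ℂ] CTangent 𝕜 E x →ₗ[ℂ] ℂ,
      ∀ X Y : (∀ y : M, CTangent 𝕜 E y), VectorSmoothNear 𝕜 E X x → VectorSmoothNear 𝕜 E Y x →
        F (X x) (Y x) = (tangentAlgebroid 𝕜 E M).d₁ α X Y x := by
  -- Tensoriality in the second argument is already contained in `contrD_apply`; it remains to show
  -- that `X ↦ i_X dα` is tensorial with values in covectors.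
  suffices h : ∃ F : CTangent 𝕜 E x →ₗ[ℂ] CCotangent 𝕜 E x, ∀ X : (∀ y : M, CTangent 𝕜 E y),
      VectorSmoothNear 𝕜 E X x → F (X x) = contrD X α x by
    obtain ⟨F, hF⟩ := h
    exact ⟨F, fun X Y hX hY => by rw [hF X hX, contrD_apply hX hα hY, tangent_d₁]⟩
  refine exists_linearMap_of_tensorial (fun X => contrD X α x) ?_ ?_ ?_
  · intro X Y h
    exact contrD_congr h (.of_forall fun y => rfl)
  · intro X Y hX hY
    refine ccotangent_ext fun W hW => ?_
    have hXY : VectorSmoothNear 𝕜 E (fun y => X y + Y y) x := by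
      filter_upwards [hX, hY] with y h1 h2 using h1.add h2
    rw [LinearMap.add_apply, contrD_apply hXY hα hW, contrD_apply hX hα hW,
      contrD_apply hY hα hW, vbracket_skew hXY hW, vbracket_add hW hX hY, vbracket_skew hW hX,
      vbracket_skew hW hY]
    simp only [map_add, map_neg]
    rw [dfun_add (hα.apply hX).self_of_nhds (hα.apply hY).self_of_nhds, LinearMap.add_apply]
    ring
  · intro g X hg hX
    refine ccotangent_ext fun W hW => ?_
    have hgX : VectorSmoothNear 𝕜 E (fun y => g y • X y) x := by
      filter_upwards [hg, hX] with y h1 h2 using VectorSmoothAt.smul h1 h2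
    rw [LinearMap.smul_apply, contrD_apply hgX hα hW, contrD_apply hX hα hW,
      vbracket_skew hgX hW, vbracket_smul hg hW hX, vbracket_skew hW hX]
    simp only [map_add, map_neg, map_smul, smul_eq_mul]
    rw [dfun_mul hg.self_of_nhds (hα.apply hX).self_of_nhds]
    simp only [LinearMap.add_apply, LinearMap.smul_apply, smul_eq_mul]
    ring

/-- A 2-form which is locally exact is closed. -/
lemma isClosedFormNear_of_eq_d₁ {α : ∀ y : M, CCotangent 𝕜 E y}
    {F : ∀ y : M, CTangent 𝕜 E y →ₗ[ℂ] CTangent 𝕜 E y →ₗ[ℂ] ℂ}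
    (hα : CovectorSmoothNear 𝕜 E α x)
    (hF : ∀ᶠ y in 𝓝 x, ∀ X Y : (∀ y : M, CTangent 𝕜 E y), VectorSmoothNear 𝕜 E X y →
      VectorSmoothNear 𝕜 E Y y → F y (X y) (Y y)
        = dfun 𝕜 E (fun y => α y (Y y)) y (X y) - dfun 𝕜 E (fun y => α y (X y)) y (Y y)
          - α y (vbracket 𝕜 E X Y y)) : IsClosedFormNear 𝕜 E F x := by
  have hsm : ∀ X Y : (∀ y : M, CTangent 𝕜 E y), ∀ y,
      (∀ᶠ z in 𝓝 y, ∀ X Y : (∀ y : M, CTangent 𝕜 E y), VectorSmoothNear 𝕜 E X z →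
        VectorSmoothNear 𝕜 E Y z → F z (X z) (Y z)
          = dfun 𝕜 E (fun y => α y (Y y)) z (X z) - dfun 𝕜 E (fun y => α y (X y)) z (Y z)
            - α z (vbracket 𝕜 E X Y z)) → VectorSmoothNear 𝕜 E X y →
      VectorSmoothNear 𝕜 E Y y →
      (fun z => F z (X z) (Y z)) =ᶠ[𝓝 y] fun z =>
        dfun 𝕜 E (fun y => α y (Y y)) z (X z)
          - dfun 𝕜 E (fun y => α y (X y)) z (Y z) - α z (vbracket 𝕜 E X Y z) := by
    intro X Y y h hX hY
    filter_upwards [h, hX.eventually_nhds, hY.eventually_nhds] with z hz h1 h2 using hz X Y h1 h2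
  refine ⟨?_, ?_, fun X Y Z hX hY hZ => ?_⟩
  · filter_upwards [hF] with y hy v
    obtain ⟨X, hX, rfl⟩ := exists_vectorField v
    rw [hy X X hX hX, vbracket_self hX, map_zero, sub_self, sub_zero]
  · filter_upwards [hF.eventually_nhds, hα.eventually_nhds] with y hy hαy X Y hX hY
    replace hαy : CovectorSmoothNear 𝕜 E α y := hαy
    refine SmoothFunAt.congr ?_ (hsm X Y y hy hX hY)
    exact (((hαy.apply hY).deriv hX).self_of_nhds.sub
      ((hαy.apply hX).deriv hY).self_of_nhds).sub (hαy.apply (hX.vbracket hY)).self_of_nhds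
  · have hd : ∀ X Y : (∀ y : M, CTangent 𝕜 E y), VectorSmoothNear 𝕜 E X x →
        VectorSmoothNear 𝕜 E Y x → ∀ v : CTangent 𝕜 E x,
        dfun 𝕜 E (fun z => F z (X z) (Y z)) x v
          = dfun 𝕜 E (fun z => dfun 𝕜 E (fun y => α y (Y y)) z (X z)) x v
            - dfun 𝕜 E (fun z => dfun 𝕜 E (fun y => α y (X y)) z (Y z)) x v
            - dfun 𝕜 E (fun z => α z (vbracket 𝕜 E X Y z)) x v := by
      intro X Y hX hY v
      have h1 := ((hα.apply hY).deriv hX).self_of_nhds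
      have h2 := ((hα.apply hX).deriv hY).self_of_nhds
      have h3 := (hα.apply (hX.vbracket hY)).self_of_nhds
      rw [dfun_congr (hsm X Y x hF hX hY), dfun_sub (h1.sub h2) h3, dfun_sub h1 h2]
      rfl
    have hFx := hF.self_of_nhds
    have j := congrArg (α x) (vbracket_jacobi hX hY hZ)
    rw [vbracket_skew hX (hY.vbracket hZ), vbracket_skew hY (hX.vbracket hZ)] at j
    simp only [map_add, map_neg] at j
    rw [tangent_d₂, hd Y Z hY hZ, hd X Z hX hZ, hd X Y hX hY, hFx _ Z (hX.vbracket hY) hZ,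
      hFx _ Y (hX.vbracket hZ) hY, hFx _ X (hY.vbracket hZ) hX,
      vbracket_spec hX.self_of_nhds hY.self_of_nhds (hα.apply hZ),
      vbracket_spec hX.self_of_nhds hZ.self_of_nhds (hα.apply hY),
      vbracket_spec hY.self_of_nhds hZ.self_of_nhds (hα.apply hX)]
    -- This is `d² = 0`: second derivatives of the functions `α(X)`, `α(Y)`, `α(Z)` cancel, and what
    -- remains is `α` of the Jacobi identity.
    linear_combination -j

/-- The differential of the connection form has the characterizing property, so the form chosen by
`epsilon` has it as well. -/
lemma LineFrame.isCurvatureAt (φ : LineFrame 𝕜 E L V)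
    (hD : IsConnectionOn (tangentAlgebroid 𝕜 E M) U L D) (hVU : V ≤ U) (hx : x ∈ V) :
    IsCurvatureAt D x (curvature D x) := by
  obtain ⟨F, hF⟩ := exists_twoForm_d₁ (φ.form_smoothNear hD hVU hx)
  refine IsCurvatureAt.curvature (F := F) fun X Y t hX hY ht => ?_
  have h := φ.curvatureOp_eq hD hVU hx hX hY ht
  rw [h, ← hF X Y hX hY, mul_smul, ← φ.eq_smul x hx]
  rfl

lemma IsConnectionOn.isCurvatureAt (hD : IsConnectionOn (tangentAlgebroid 𝕜 E M) U L D)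
    (hL : IsLineBundleOn 𝕜 E U L) (hx : x ∈ U) : IsCurvatureAt D x (curvature D x) := by
  obtain ⟨V, hVU, hxV, ⟨φ⟩⟩ := hL.exists_lineFrame hx
  exact φ.isCurvatureAt hD hVU hxV

lemma LineFrame.curvature_apply (φ : LineFrame 𝕜 E L V)
    (hD : IsConnectionOn (tangentAlgebroid 𝕜 E M) U L D) (hVU : V ≤ U) (hx : x ∈ V)
    (hX : VectorSmoothNear 𝕜 E X x) (hY : VectorSmoothNear 𝕜 E Y x) :
    curvature D x (X x) (Y x) = (tangentAlgebroid 𝕜 E M).d₁ (φ.form D) X Y x := by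
  refine φ.smul_s_injective hx ?_
  have h := φ.curvatureOp_eq hD hVU hx hX hY (φ.s_smoothNear hx)
  rw [φ.coord_s x hx, mul_one] at h
  rw [← h]
  exact φ.isCurvatureAt hD hVU hx X Y φ.s hX hY (φ.s_smoothNear hx)

/-- The curvature of a connection on a line bundle is a closed 2-form. -/
lemma IsConnectionOn.isClosedFormNear (hD : IsConnectionOn (tangentAlgebroid 𝕜 E M) U L D)
    (hL : IsLineBundleOn 𝕜 E U L) (hx : x ∈ U) :
    IsClosedFormNear 𝕜 E (fun y => curvature D y) x := by
  obtain ⟨V, hVU, hxV, ⟨φ⟩⟩ := hL.exists_lineFrame hx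
  refine isClosedFormNear_of_eq_d₁ (φ.form_smoothNear hD hVU hxV) ?_
  filter_upwards [Opens.eventually_mem hxV] with y hy X Y hX hY using
    φ.curvature_apply hD hVU hy hX hY

end Curvature
-- Curvatures of dual and tensor product connections.
section CurvatureRelations

variable {𝕜 : Type uk} [RCLike 𝕜] [NormedAlgebra 𝕜 ℂ]
  {E : Type uE} [NormedAddCommGroup E] [NormedSpace 𝕜 E]
  {M : Type uM} [TopologicalSpace M] [ChartedSpace E M]
  {U : Opens M} {x : M} {X Y : ∀ y : M, CTangent 𝕜 E y}

section

variable {L : BundleData.{uM, v} M} {D : ConnOp (tangentAlgebroid 𝕜 E M) L} {s t : L.Sec}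

lemma IsConnectionOn.covDeriv_congr (hD : IsConnectionOn (tangentAlgebroid 𝕜 E M) U L D)
    (hx : x ∈ U) (hs : ∀ᶠ y in 𝓝 x, L.SmoothAt s y) (h : ∀ᶠ y in 𝓝 x, s y = t y) :
    covDeriv D X s x = covDeriv D X t x := by
  obtain ⟨V, hVU, hxV, hV⟩ := exists_opens_le_of_eventually hx (hs.and h)
  exact LinearMap.congr_fun (hD.congr V hVU s t (fun y hy => (hV y hy).1)
    (fun y hy => (hV y hy).2) x hxV) (X x)

lemma IsConnectionOn.covDeriv_add (hD : IsConnectionOn (tangentAlgebroid 𝕜 E M) U L D)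
    (hx : x ∈ U) (hs : ∀ᶠ y in 𝓝 x, L.SmoothAt s y) (ht : ∀ᶠ y in 𝓝 x, L.SmoothAt t y) :
    covDeriv D X (s + t) x = covDeriv D X s x + covDeriv D X t x := by
  obtain ⟨V, hVU, hxV, hV⟩ := exists_opens_le_of_eventually hx (hs.and ht)
  exact LinearMap.congr_fun (hD.add V hVU s t (fun y hy => (hV y hy).1)
    (fun y hy => (hV y hy).2) x hxV) (X x)

/-- `SmoothAt` is an arbitrary predicate of the bundle data; only a local frame shows that it is
closed under addition. -/
lemma IsLineBundleOn.smoothAt_add (hL : IsLineBundleOn 𝕜 E U L) (hx : x ∈ U)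
    (hs : L.SmoothAt s x) (ht : L.SmoothAt t x) : L.SmoothAt (s + t) x := by
  obtain ⟨V, hVU, hxV, ⟨φ⟩⟩ := hL.exists_lineFrame hx
  rw [φ.smoothAt_iff _ x hxV] at hs ht ⊢
  simpa only [Pi.add_apply, map_add] using hs.add ht

end

variable [FiniteDimensional 𝕜 E] [IsManifold 𝓘(𝕜, E) ∞ M]

/-- Dual connections have opposite curvatures. -/
lemma curvature_dual {L : BundleData.{uM, v} M} {L' : BundleData.{uM, v'} M}
    (hL : IsLineBundleOn 𝕜 E U L) (hL' : IsLineBundleOn 𝕜 E U L')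
    {p : ∀ x, L.fiber x →ₗ[ℂ] L'.fiber x →ₗ[ℂ] ℂ} (hp : IsDualPairing 𝕜 E U L L' p)
    {D : ConnOp (tangentAlgebroid 𝕜 E M) L} {D' : ConnOp (tangentAlgebroid 𝕜 E M) L'}
    (hD : IsConnectionOn (tangentAlgebroid 𝕜 E M) U L D)
    (hD' : IsConnectionOn (tangentAlgebroid 𝕜 E M) U L' D')
    (h : AreDualConnections (tangentAlgebroid 𝕜 E M) U p D D') (hx : x ∈ U) :
    curvature D' x = - curvature D x := by
  have hd : ∀ (s : L.Sec) (t : L'.Sec) (X : ∀ y : M, CTangent 𝕜 E y),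
      ∀ y ∈ U, (∀ᶠ z in 𝓝 y, L.SmoothAt s z) → (∀ᶠ z in 𝓝 y, L'.SmoothAt t z) →
      dfun 𝕜 E (fun z => p z (s z) (t z)) y (X y)
        = p y (covDeriv D X s y) (t y) + p y (s y) (covDeriv D' X t y) := by
    intro s t X y hy hs ht
    obtain ⟨V, hVU, hyV, hV⟩ := exists_opens_le_of_eventually hy (hs.and ht)
    exact h V hVU s t (fun z hz => (hV z hz).1) (fun z hz => (hV z hz).2) y hyV (X y)
  have hsm : ∀ (s : L.Sec) (t : L'.Sec), ∀ y ∈ U, (∀ᶠ z in 𝓝 y, L.SmoothAt s z) →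
      (∀ᶠ z in 𝓝 y, L'.SmoothAt t z) → SmoothFunNear 𝕜 E (fun z => p z (s z) (t z)) y := by
    intro s t y hy hs ht
    obtain ⟨V, hVU, hyV, hV⟩ := exists_opens_le_of_eventually hy (hs.and ht)
    filter_upwards [Opens.eventually_mem hyV] with z hz using
      hp.smooth V hVU s t (fun z hz => (hV z hz).1) (fun z hz => (hV z hz).2) z hz
  obtain ⟨V, hVU, hxV, ⟨φ⟩⟩ := hL.exists_lineFrame hx
  obtain ⟨V', hVU', hxV', ⟨φ'⟩⟩ := hL'.exists_lineFrame hx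
  have hs := φ.s_smoothNear hxV
  have ht := φ'.s_smoothNear hxV'
  -- Duality differentiated twice. The two mixed terms are exchanged by swapping `X` and `Y`, so
  -- they drop out of the commutator.
  have hdd : ∀ X Y : (∀ y : M, CTangent 𝕜 E y), VectorSmoothNear 𝕜 E X x →
      VectorSmoothNear 𝕜 E Y x →
      dfun 𝕜 E (fun y => dfun 𝕜 E (fun z => p z (φ.s z) (φ'.s z)) y (Y y)) x (X x)
        = p x (covDeriv D X (covDeriv D Y φ.s) x) (φ'.s x)
          + p x (covDeriv D Y φ.s x) (covDeriv D' X φ'.s x)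
          + (p x (covDeriv D X φ.s x) (covDeriv D' Y φ'.s x)
            + p x (φ.s x) (covDeriv D' X (covDeriv D' Y φ'.s) x)) := by
    intro X Y hX hY
    have he : (fun y => dfun 𝕜 E (fun z => p z (φ.s z) (φ'.s z)) y (Y y)) =ᶠ[𝓝 x] fun y =>
        p y (covDeriv D Y φ.s y) (φ'.s y) + p y (φ.s y) (covDeriv D' Y φ'.s y) := by
      filter_upwards [Opens.eventually_mem hx, hs.eventually_nhds, ht.eventually_nhds]
        with y hy h1 h2 using hd φ.s φ'.s Y y hy h1 h2
    have hsY := hD.covDeriv_smoothNear hx hs hY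
    have htY := hD'.covDeriv_smoothNear hx ht hY
    rw [dfun_congr he, dfun_add (hsm _ _ x hx hsY ht).self_of_nhds
      (hsm _ _ x hx hs htY).self_of_nhds, LinearMap.add_apply, hd _ _ X x hx hsY ht,
      hd _ _ X x hx hs htY]
  -- Otherwise `φ.s x` would pair to zero with the whole fibre, which the frame vector `φ'.s x`
  -- spans.
  have hne : p x (φ.s x) (φ'.s x) ≠ 0 := by
    intro h0
    refine φ.s_ne_zero hxV ((hp.perfect x hx).bijective_left.1 ?_)
    refine LinearMap.ext fun t => ?_
    rw [φ'.eq_smul x hxV' t, map_smul, h0, smul_zero, map_zero, LinearMap.zero_apply]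
  refine LinearMap.ext₂ fun v w => ?_
  obtain ⟨X, hX, rfl⟩ := exists_vectorField (𝕜 := 𝕜) (E := E) (x := x) v
  obtain ⟨Y, hY, rfl⟩ := exists_vectorField (𝕜 := 𝕜) (E := E) (x := x) w
  have h1 : curvature D x (X x) (Y x) • φ.s x = curvatureOp D X Y φ.s x :=
    hD.isCurvatureAt hL hx X Y φ.s hX hY hs
  have h2 : curvature D' x (X x) (Y x) • φ'.s x = curvatureOp D' X Y φ'.s x :=
    hD'.isCurvatureAt hL' hx X Y φ'.s hX hY ht
  have h3 := vbracket_spec hX.self_of_nhds hY.self_of_nhds (hsm _ _ x hx hs ht)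
  rw [hdd X Y hX hY, hdd Y X hY hX, hd _ _ (vbracket 𝕜 E X Y) x hx hs ht] at h3
  have h4 := congrArg (fun u => p x u (φ'.s x)) h1
  have h5 := congrArg (fun u => p x (φ.s x) u) h2
  simp only [curvatureOp_tangent, map_sub, LinearMap.sub_apply, map_smul, LinearMap.smul_apply,
    smul_eq_mul] at h4 h5
  -- Obtained by applying `[X, Y] = XY - YX` to the function `p(s, t)`.
  have h6 : (curvature D' x (X x) (Y x) + curvature D x (X x) (Y x)) * p x (φ.s x) (φ'.s x) = 0 := by
    linear_combination h4 + h5 - h3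
  exact eq_neg_of_add_eq_zero_left ((mul_eq_zero.1 h6).resolve_right hne)

/-- The curvature of a threefold tensor product of connections. -/
lemma curvature_trilinear {L₁ : BundleData.{uM, v} M} {L₂ L₃ : BundleData.{uM, w} M}
    {L₄ : BundleData.{uM, v'} M} {U₁ U₂ U₃ : Opens M}
    (h₁ : IsLineBundleOn 𝕜 E U₁ L₁) (h₂ : IsLineBundleOn 𝕜 E U₂ L₂)
    (h₃ : IsLineBundleOn 𝕜 E U₃ L₃) (h₄ : IsLineBundleOn 𝕜 E U L₄)
    (hU₁ : U ≤ U₁) (hU₂ : U ≤ U₂) (hU₃ : U ≤ U₃)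
    {D₁ : ConnOp (tangentAlgebroid 𝕜 E M) L₁} {D₂ : ConnOp (tangentAlgebroid 𝕜 E M) L₂}
    {D₃ : ConnOp (tangentAlgebroid 𝕜 E M) L₃} {D₄ : ConnOp (tangentAlgebroid 𝕜 E M) L₄}
    (hD₁ : IsConnectionOn (tangentAlgebroid 𝕜 E M) U₁ L₁ D₁)
    (hD₂ : IsConnectionOn (tangentAlgebroid 𝕜 E M) U₂ L₂ D₂)
    (hD₃ : IsConnectionOn (tangentAlgebroid 𝕜 E M) U₃ L₃ D₃)
    (hD₄ : IsConnectionOn (tangentAlgebroid 𝕜 E M) U L₄ D₄)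
    (m : ∀ x, L₁.fiber x →ₗ[ℂ] L₂.fiber x →ₗ[ℂ] L₃.fiber x →ₗ[ℂ] L₄.fiber x)
    (hm : ∀ x ∈ U, Function.Injective (TensorProduct.lift (TensorProduct.lift (m x))))
    (hsm : ∀ V ≤ U, ∀ s n t, L₁.SmoothOn V s → L₂.SmoothOn V n → L₃.SmoothOn V t →
      L₄.SmoothOn V (fun x => m x (s x) (n x) (t x)))
    (hflat : ∀ V ≤ U, ∀ s n t, L₁.SmoothOn V s → L₂.SmoothOn V n → L₃.SmoothOn V t →
      ∀ x ∈ V, ∀ v, D₄ (fun y => m y (s y) (n y) (t y)) x v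
        = m x (D₁ s x v) (n x) (t x) + m x (s x) (D₂ n x v) (t x) + m x (s x) (n x) (D₃ t x v))
    (hx : x ∈ U) : curvature D₄ x = curvature D₁ x + curvature D₂ x + curvature D₃ x := by
  have hd : ∀ (s : L₁.Sec) (n : L₂.Sec) (t : L₃.Sec) (X : ∀ y : M, CTangent 𝕜 E y),
      ∀ y ∈ U, (∀ᶠ z in 𝓝 y, L₁.SmoothAt s z) → (∀ᶠ z in 𝓝 y, L₂.SmoothAt n z) →
      (∀ᶠ z in 𝓝 y, L₃.SmoothAt t z) →
      covDeriv D₄ X (fun z => m z (s z) (n z) (t z)) y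
        = m y (covDeriv D₁ X s y) (n y) (t y) + m y (s y) (covDeriv D₂ X n y) (t y)
          + m y (s y) (n y) (covDeriv D₃ X t y) := by
    intro s n t X y hy hs hn ht
    obtain ⟨V, hVU, hyV, hV⟩ := exists_opens_le_of_eventually hy (hs.and (hn.and ht))
    exact hflat V hVU s n t (fun z hz => (hV z hz).1) (fun z hz => (hV z hz).2.1)
      (fun z hz => (hV z hz).2.2) y hyV (X y)
  have hms : ∀ (s : L₁.Sec) (n : L₂.Sec) (t : L₃.Sec), ∀ y ∈ U,
      (∀ᶠ z in 𝓝 y, L₁.SmoothAt s z) → (∀ᶠ z in 𝓝 y, L₂.SmoothAt n z) →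
      (∀ᶠ z in 𝓝 y, L₃.SmoothAt t z) →
      ∀ᶠ z in 𝓝 y, L₄.SmoothAt (fun z => m z (s z) (n z) (t z)) z := by
    intro s n t y hy hs hn ht
    obtain ⟨V, hVU, hyV, hV⟩ := exists_opens_le_of_eventually hy (hs.and (hn.and ht))
    filter_upwards [Opens.eventually_mem hyV] with z hz using
      hsm V hVU s n t (fun z hz => (hV z hz).1) (fun z hz => (hV z hz).2.1)
        (fun z hz => (hV z hz).2.2) z hz
  obtain ⟨V₁, -, hx₁, ⟨φ₁⟩⟩ := h₁.exists_lineFrame (hU₁ hx)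
  obtain ⟨V₂, -, hx₂, ⟨φ₂⟩⟩ := h₂.exists_lineFrame (hU₂ hx)
  obtain ⟨V₃, -, hx₃, ⟨φ₃⟩⟩ := h₃.exists_lineFrame (hU₃ hx)
  have hs := φ₁.s_smoothNear hx₁
  have hn := φ₂.s_smoothNear hx₂
  have ht := φ₃.s_smoothNear hx₃
  have hmst := hms _ _ _ x hx hs hn ht
  -- Of the nine terms, the six with derivatives on two different factors are permuted by swapping
  -- `X` and `Y`, so they cancel in the commutator.
  have hdd : ∀ X Y : (∀ y : M, CTangent 𝕜 E y), VectorSmoothNear 𝕜 E X x →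
      VectorSmoothNear 𝕜 E Y x →
      covDeriv D₄ X (covDeriv D₄ Y (fun z => m z (φ₁.s z) (φ₂.s z) (φ₃.s z))) x
        = (m x (covDeriv D₁ X (covDeriv D₁ Y φ₁.s) x) (φ₂.s x) (φ₃.s x)
            + m x (covDeriv D₁ Y φ₁.s x) (covDeriv D₂ X φ₂.s x) (φ₃.s x)
            + m x (covDeriv D₁ Y φ₁.s x) (φ₂.s x) (covDeriv D₃ X φ₃.s x))
          + (m x (covDeriv D₁ X φ₁.s x) (covDeriv D₂ Y φ₂.s x) (φ₃.s x)
            + m x (φ₁.s x) (covDeriv D₂ X (covDeriv D₂ Y φ₂.s) x) (φ₃.s x)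
            + m x (φ₁.s x) (covDeriv D₂ Y φ₂.s x) (covDeriv D₃ X φ₃.s x))
          + (m x (covDeriv D₁ X φ₁.s x) (φ₂.s x) (covDeriv D₃ Y φ₃.s x)
            + m x (φ₁.s x) (covDeriv D₂ X φ₂.s x) (covDeriv D₃ Y φ₃.s x)
            + m x (φ₁.s x) (φ₂.s x) (covDeriv D₃ X (covDeriv D₃ Y φ₃.s) x)) := by
    intro X Y hX hY
    have hsY := hD₁.covDeriv_smoothNear (hU₁ hx) hs hY
    have hnY := hD₂.covDeriv_smoothNear (hU₂ hx) hn hY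
    have htY := hD₃.covDeriv_smoothNear (hU₃ hx) ht hY
    have hm1 := hms _ _ _ x hx hsY hn ht
    have hm2 := hms _ _ _ x hx hs hnY ht
    have hm3 := hms _ _ _ x hx hs hn htY
    have he : ∀ᶠ y in 𝓝 x, covDeriv D₄ Y (fun z => m z (φ₁.s z) (φ₂.s z) (φ₃.s z)) y
        = ((fun y => m y (covDeriv D₁ Y φ₁.s y) (φ₂.s y) (φ₃.s y))
          + (fun y => m y (φ₁.s y) (covDeriv D₂ Y φ₂.s y) (φ₃.s y))
          + fun y => m y (φ₁.s y) (φ₂.s y) (covDeriv D₃ Y φ₃.s y) : L₄.Sec) y := by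
      filter_upwards [Opens.eventually_mem hx, hs.eventually_nhds, hn.eventually_nhds,
        ht.eventually_nhds] with y hy h1 h2 h3 using hd _ _ _ Y y hy h1 h2 h3
    have hm12 := (Opens.eventually_mem hx).and (hm1.and hm2) |>.mono fun y hy =>
      h₄.smoothAt_add hy.1 hy.2.1 hy.2.2
    rw [hD₄.covDeriv_congr hx (hD₄.covDeriv_smoothNear hx hmst hY) he,
      hD₄.covDeriv_add hx hm12 hm3, hD₄.covDeriv_add hx hm1 hm2, hd _ _ _ X x hx hsY hn ht,
      hd _ _ _ X x hx hs hnY ht, hd _ _ _ X x hx hs hn htY]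
  have hne : m x (φ₁.s x) (φ₂.s x) (φ₃.s x) ≠ 0 := by
    intro h0
    -- Injectivity of `m` on the tensor product reduces the claim to a pure tensor, which the
    -- product of the coordinate functionals sends to 1.
    have h1 : ((φ₁.s x ⊗ₜ[ℂ] φ₂.s x) ⊗ₜ[ℂ] φ₃.s x) = 0 := hm x hx (by simpa using h0)
    have h2 := congrArg (LinearMap.mul' ℂ ℂ ∘ₗ TensorProduct.map
      (LinearMap.mul' ℂ ℂ ∘ₗ TensorProduct.map (φ₁.coord x) (φ₂.coord x)) (φ₃.coord x)) h1
    simp [φ₁.coord_s x hx₁, φ₂.coord_s x hx₂, φ₃.coord_s x hx₃] at h2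
  refine LinearMap.ext₂ fun v w => ?_
  obtain ⟨X, hX, rfl⟩ := exists_vectorField (𝕜 := 𝕜) (E := E) (x := x) v
  obtain ⟨Y, hY, rfl⟩ := exists_vectorField (𝕜 := 𝕜) (E := E) (x := x) w
  have e1 : curvature D₁ x (X x) (Y x) • φ₁.s x = curvatureOp D₁ X Y φ₁.s x :=
    hD₁.isCurvatureAt h₁ (hU₁ hx) X Y φ₁.s hX hY hs
  have e2 : curvature D₂ x (X x) (Y x) • φ₂.s x = curvatureOp D₂ X Y φ₂.s x :=
    hD₂.isCurvatureAt h₂ (hU₂ hx) X Y φ₂.s hX hY hn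
  have e3 : curvature D₃ x (X x) (Y x) • φ₃.s x = curvatureOp D₃ X Y φ₃.s x :=
    hD₃.isCurvatureAt h₃ (hU₃ hx) X Y φ₃.s hX hY ht
  have e4 : curvature D₄ x (X x) (Y x) • m x (φ₁.s x) (φ₂.s x) (φ₃.s x)
      = curvatureOp D₄ X Y (fun z => m z (φ₁.s z) (φ₂.s z) (φ₃.s z)) x :=
    hD₄.isCurvatureAt h₄ hx X Y _ hX hY hmst
  rw [curvatureOp_tangent, hdd X Y hX hY, hdd Y X hY hX,
    hd _ _ _ (vbracket 𝕜 E X Y) x hx hs hn ht] at e4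
  have f1 := congrArg (fun u => m x u (φ₂.s x) (φ₃.s x)) e1
  have f2 := congrArg (fun u => m x (φ₁.s x) u (φ₃.s x)) e2
  have f3 := congrArg (fun u => m x (φ₁.s x) (φ₂.s x) u) e3
  simp only [curvatureOp_tangent, map_sub, LinearMap.sub_apply, map_smul, LinearMap.smul_apply]
    at f1 f2 f3
  refine smul_left_injective ℂ hne ?_
  change curvature D₄ x (X x) (Y x) • m x (φ₁.s x) (φ₂.s x) (φ₃.s x)
    = (curvature D₁ x (X x) (Y x) + curvature D₂ x (X x) (Y x) + curvature D₃ x (X x) (Y x))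
      • m x (φ₁.s x) (φ₂.s x) (φ₃.s x)
  rw [e4, add_smul, add_smul, f1, f2, f3]
  abel

end CurvatureRelations

/-! ### Pulling connections back along the anchor. -/

section Pullback

variable {𝕜 : Type uk} [RCLike 𝕜] [NormedAlgebra 𝕜 ℂ]
  {E : Type uE} [NormedAddCommGroup E] [NormedSpace 𝕜 E]
  {M : Type uM} [TopologicalSpace M] [ChartedSpace E M]
  {U : Opens M} {x : M} {A : LieAlgebroidData.{uk, uE, uM, w} 𝕜 E M} {L : BundleData.{uM, v} M}

lemma IsVectorBundleOn.exists_section {L : BundleData.{uM, v} M}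
    (hL : IsVectorBundleOn 𝕜 E U L) (hx : x ∈ U) (t : L.fiber x) :
    ∃ s : L.Sec, (∀ᶠ y in 𝓝 x, L.SmoothAt s y) ∧ s x = t := by
  obtain ⟨V, -, n, e, c, hxV, h1, h2, h3⟩ := hL.exists_frame hx
  refine ⟨fun y => ∑ k, c x t k • e k y, ?_, (h2 x hxV t).symm⟩
  filter_upwards [Opens.eventually_mem hxV] with y hy
  refine (h3 _ y hy).2 fun j => (smoothFunAt_const (c x t j)).congr ?_
  filter_upwards [Opens.eventually_mem hy] with z hz
  simp [h1 z hz, Finset.sum_apply, Pi.single_apply]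

lemma IsConnectionOn.pullback (hA : IsLieAlgebroid A)
    {D : ConnOp (tangentAlgebroid 𝕜 E M) L}
    (hD : IsConnectionOn (tangentAlgebroid 𝕜 E M) U L D) :
    IsConnectionOn A U L (D.pullback A.anchor) where
  smooth V hV s a hs ha := hD.smooth V hV s _ hs (hA.anchor_smooth V a ha)
  congr V hV s s' hs h x hx := congrArg (fun F => F.comp (A.anchor x)) (hD.congr V hV s s' hs h x hx)
  add V hV s t hs ht x hx := congrArg (fun F => F.comp (A.anchor x)) (hD.add V hV s t hs ht x hx)
  leibniz V hV f s hf hs x hx v := hD.leibniz V hV f s hf hs x hx (A.anchor x v)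

lemma AreDualConnections.pullback {L' : BundleData.{uM, v'} M}
    {p : ∀ x, L.fiber x →ₗ[ℂ] L'.fiber x →ₗ[ℂ] ℂ}
    {D : ConnOp (tangentAlgebroid 𝕜 E M) L} {D' : ConnOp (tangentAlgebroid 𝕜 E M) L'}
    (h : AreDualConnections (tangentAlgebroid 𝕜 E M) U p D D') :
    AreDualConnections A U p (D.pullback A.anchor) (D'.pullback A.anchor) :=
  fun V hV s t hs ht x hx v => h V hV s t hs ht x hx (A.anchor x v)

/-- The curvature of the pullback of a connection along the anchor. -/
lemma IsConnectionOn.curvature_pullback [FiniteDimensional 𝕜 E] [IsManifold 𝓘(𝕜, E) ∞ M]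
    (hA : IsLieAlgebroid A) {D : ConnOp (tangentAlgebroid 𝕜 E M) L}
    (hD : IsConnectionOn (tangentAlgebroid 𝕜 E M) U L D) (hL : IsLineBundleOn 𝕜 E U L)
    (hx : x ∈ U) :
    curvature (D.pullback A.anchor) x = (curvature D x).compl₁₂ (A.anchor x) (A.anchor x) := by
  have h : IsCurvatureAt (D.pullback A.anchor) x
      ((curvature D x).compl₁₂ (A.anchor x) (A.anchor x)) := by
    intro a b s ha hb hs
    obtain ⟨V, hVU, hxV, hV⟩ := exists_opens_le_of_eventually hx (ha.and hb)
    have ha' : ∀ᶠ y in 𝓝 x, VectorSmoothAt 𝕜 E (fun y => A.anchor y (a y)) y := by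
      filter_upwards [Opens.eventually_mem hxV] with y hy using
        hA.anchor_smooth V a (fun y hy => (hV y hy).1) y hy
    have hb' : ∀ᶠ y in 𝓝 x, VectorSmoothAt 𝕜 E (fun y => A.anchor y (b y)) y := by
      filter_upwards [Opens.eventually_mem hxV] with y hy using
        hA.anchor_smooth V b (fun y hy => (hV y hy).2) y hy
    have h1 : curvature D x (A.anchor x (a x)) (A.anchor x (b x)) • s x
        = curvatureOp D (fun y => A.anchor y (a y)) (fun y => A.anchor y (b y)) s x :=
      hD.isCurvatureAt hL hx _ _ s ha' hb' hs
    -- Compatibility of the anchor with brackets enters through the term `D_[a,b]` of the curvature.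
    have h2 := congrArg (D s x) (hA.anchor_bracket V a b (fun y hy => (hV y hy).1)
      (fun y hy => (hV y hy).2) x hxV)
    refine h1.trans ?_
    refine congrArg (fun u => D (fun y => D s y (A.anchor y (b y))) x (A.anchor x (a x))
      - D (fun y => D s y (A.anchor y (a y))) x (A.anchor x (b x)) - u) h2.symm
  obtain ⟨V, hVU, hxV, ⟨φ⟩⟩ := hL.exists_lineFrame hx
  exact h.curvature.unique h φ hxV (hA.bundle.exists_section (by trivial))

end Pullback
-- Smoothness of coefficients by Cramer's rule.
section SmoothLinearAlgebra

variable {𝕜 : Type uk} [RCLike 𝕜] [NormedAlgebra 𝕜 ℂ]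
  {E : Type uE} [NormedAddCommGroup E] [NormedSpace 𝕜 E]
  {M : Type uM} [TopologicalSpace M] [ChartedSpace E M] {x : M} {n : ℕ}

lemma SmoothFunAt.det {A : M → Matrix (Fin n) (Fin n) ℂ}
    (hA : ∀ j k, SmoothFunAt 𝕜 E (fun y => A y j k) x) :
    SmoothFunAt 𝕜 E (fun y => (A y).det) x := by
  simp only [Matrix.det_apply']
  exact SmoothFunAt.sum _ fun σ _ =>
    (smoothFunAt_const _).mul (SmoothFunAt.prod _ fun k _ => hA _ _)

/-- The solution of a smooth regular linear system is smooth. -/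
lemma smoothFunAt_of_mulVec_eq {A : M → Matrix (Fin n) (Fin n) ℂ} {b c : M → Fin n → ℂ}
    (hA : ∀ j k, SmoothFunAt 𝕜 E (fun y => A y j k) x)
    (hb : ∀ j, SmoothFunAt 𝕜 E (fun y => b y j) x) (hdet : (A x).det ≠ 0)
    (h : ∀ᶠ y in 𝓝 x, (A y).mulVec (c y) = b y) (k : Fin n) :
    SmoothFunAt 𝕜 E (fun y => c y k) x := by
  have hd := SmoothFunAt.det hA
  -- The numerator in Cramer's rule: column `k` is replaced by the right-hand side.
  have hk : SmoothFunAt 𝕜 E (fun y => ((A y).updateCol k (b y)).det) x := by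
    refine SmoothFunAt.det fun i j => ?_
    by_cases hj : j = k
    · subst hj
      simpa using hb i
    · simpa [Matrix.updateCol_ne hj] using hA i j
  refine (hk.div hd hdet).congr ?_
  filter_upwards [h, hd.continuousAt.eventually_ne hdet] with y hy hy'
  rw [eq_div_iff hy', ← Matrix.cramer_apply, Matrix.cramer_eq_adjugate_mulVec, ← hy,
    Matrix.mulVec_mulVec, Matrix.adjugate_mul, Matrix.smul_mulVec, Matrix.one_mulVec,
    Pi.smul_apply, smul_eq_mul, mul_comm]

/-- The coordinates on `𝕋M` in a coordinate frame. -/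
def CoordinateFrame.gcoord {V : Opens M} (C : CoordinateFrame 𝕜 E V n) (y : M) :
    GTangent 𝕜 E y →ₗ[ℂ] (Fin n → ℂ) × (Fin n → ℂ) :=
  LinearMap.prod
    (LinearMap.pi fun k => dfun 𝕜 E (C.u k) y ∘ₗ LinearMap.fst ℂ _ _)
    (LinearMap.pi fun k => LinearMap.applyₗ (C.del k y) ∘ₗ LinearMap.snd ℂ _ _)

lemma CoordinateFrame.gcoord_injective {V : Opens M} (C : CoordinateFrame 𝕜 E V n) (hx : x ∈ V) :
    Function.Injective (C.gcoord x) := by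
  rw [← LinearMap.ker_eq_bot, LinearMap.ker_eq_bot']
  intro g hg
  have h1 : ∀ k, dfun 𝕜 E (C.u k) x g.1 = 0 := fun k => congrFun (congrArg Prod.fst hg) k
  have h2 : ∀ k, g.2 (C.del k x) = 0 := fun k => congrFun (congrArg Prod.snd hg) k
  refine Prod.ext ?_ (LinearMap.ext fun v => ?_)
  · rw [C.expand x hx g.1]
    simp [h1]
  · rw [C.expand x hx v]
    simp [h2]

lemma CoordinateFrame.gcoord_smooth {V : Opens M} (C : CoordinateFrame 𝕜 E V n) (hx : x ∈ V)
    (τ : (Fin n → ℂ) × (Fin n → ℂ) →ₗ[ℂ] ℂ) {a : ∀ y : M, GTangent 𝕜 E y}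
    (ha : GSmoothAt a x) : SmoothFunAt 𝕜 E (fun y => τ (C.gcoord y (a y))) x := by
  have h : ∀ w, τ w = ∑ k, w.1 k * τ (Pi.single k 1, 0) + ∑ k, w.2 k * τ (0, Pi.single k 1) := by
    intro w
    have h1 := LinearMap.pi_apply_eq_sum_univ (τ ∘ₗ LinearMap.inl ℂ _ _) w.1
    have h2 := LinearMap.pi_apply_eq_sum_univ (τ ∘ₗ LinearMap.inr ℂ _ _) w.2
    have hs : ∀ k : Fin n, (fun j => if k = j then (1 : ℂ) else 0) = Pi.single k 1 := fun k => by
      ext j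
      simp [Pi.single_apply, eq_comm]
    simp only [LinearMap.comp_apply, LinearMap.inl_apply, LinearMap.inr_apply, smul_eq_mul, hs]
      at h1 h2
    have h3 : w = (w.1, 0) + (0, w.2) := by simp
    conv_lhs => rw [h3, map_add, h1, h2]
  refine SmoothFunAt.congr ?_ (.of_forall fun y => h (C.gcoord y (a y)))
  refine (SmoothFunAt.sum _ fun k _ => ?_).add (SmoothFunAt.sum _ fun k _ => ?_)
  · exact (C.coeff_smoothAt k hx ha.1).mul (smoothFunAt_const _)
  · refine SmoothFunAt.mul (ha.2 (C.del k) ?_) (smoothFunAt_const _)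
    filter_upwards [Opens.eventually_mem hx] with y hy using C.del_smoothAt k hy

/-- The coefficients of a smooth section of `𝕋M` with respect to smooth sections which are
linearly independent at `x` are smooth at `x`. -/
lemma smoothFunAt_coeff [FiniteDimensional 𝕜 E] [IsManifold 𝓘(𝕜, E) ∞ M]
    {e : Fin n → ∀ y : M, GTangent 𝕜 E y} {a : ∀ y : M, GTangent 𝕜 E y} {c : M → Fin n → ℂ}
    (he : ∀ k, GSmoothAt (e k) x) (ha : GSmoothAt a x)
    (hli : LinearIndependent ℂ fun k => e k x) (h : ∀ᶠ y in 𝓝 x, a y = ∑ k, c y k • e k y)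
    (k : Fin n) : SmoothFunAt 𝕜 E (fun y => c y k) x := by
  obtain ⟨V, m, C, hx⟩ := exists_coordinateFrame (𝕜 := 𝕜) (E := E) x
  have hli' : LinearIndependent ℂ fun k => C.gcoord x (e k x) :=
    hli.map' _ (LinearMap.ker_eq_bot.2 (C.gcoord_injective hx))
  -- `T` inverts the frame at `x` and is kept fixed as `y` varies. It turns the expansion of `a`
  -- into a square system whose matrix is smooth at `x` and equal to the identity there.
  obtain ⟨T, hT⟩ := LinearMap.exists_leftInverse_of_injective
    (Fintype.linearCombination ℂ fun k => C.gcoord x (e k x))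
    (LinearMap.ker_eq_bot.2 hli'.fintypeLinearCombination_injective)
  have hTe : ∀ k, T (C.gcoord x (e k x)) = Pi.single k 1 := by
    intro k
    simpa [Fintype.linearCombination_apply_single] using LinearMap.congr_fun hT (Pi.single k 1)
  refine smoothFunAt_of_mulVec_eq
    (A := fun y => Matrix.of fun j k => T (C.gcoord y (e k y)) j)
    (b := fun y => T (C.gcoord y (a y)))
    (fun j k => C.gcoord_smooth hx (LinearMap.proj j ∘ₗ T) (he k))
    (fun j => C.gcoord_smooth hx (LinearMap.proj j ∘ₗ T) ha) ?_ ?_ k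
  · have h1 : (Matrix.of fun j k => T (C.gcoord x (e k x)) j) = 1 := by
      ext j k
      simp [hTe, Pi.single_apply, Matrix.one_apply]
    simp only [h1, Matrix.det_one, ne_eq, one_ne_zero, not_false_eq_true]
  · filter_upwards [h] with y hy
    ext j
    rw [hy]
    simp [Matrix.mulVec, dotProduct, mul_comm]

end SmoothLinearAlgebra
-- E_∂ computed in a single component.
section CourantAlgebroid

variable {𝕜 : Type uk} [RCLike 𝕜] [NormedAlgebra 𝕜 ℂ]
  {E : Type uE} [NormedAddCommGroup E] [NormedSpace 𝕜 E]
  {M : Type uM} [TopologicalSpace M] [ChartedSpace E M] {ι : Type uι} {U : ι → Opens M}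
  {G : Gerbe.{uk, uE, uM, uι, v} 𝕜 E U}
  {del : ∀ i j, ConnOp (tangentAlgebroid 𝕜 E M) (G.L i j)} {x : M} {i j : ι}

lemma courantComp_of_mem (a : ∀ x, courantFiber G del x) (hi : x ∈ U i) :
    courantComp G del i a x = (a x).1 ⟨i, hi⟩ := dif_pos hi

lemma courantFiber_glue (e : courantFiber G del x) (i j : {i : ι // x ∈ U i}) :
    e.1 j = expB (curvature (del i.1 j.1) x) (e.1 i) := e.2 i j

/-- The gluing maps recover all components from one, so equalities in `E_∂` need only be checked in
one `𝕋U_i`. -/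
lemma courantFiber_ext {e e' : courantFiber G del x} (i : {i : ι // x ∈ U i})
    (h : e.1 i = e'.1 i) : e = e' :=
  Subtype.ext (funext fun j => by rw [courantFiber_glue e i j, courantFiber_glue e' i j, h])

lemma courantComp_glue (a : ∀ x, courantFiber G del x) (hi : x ∈ U i) (hj : x ∈ U j) :
    courantComp G del j a x = expB (curvature (del i j) x) (courantComp G del i a x) := by
  rw [courantComp_of_mem a hi, courantComp_of_mem a hj]
  exact courantFiber_glue (a x) ⟨i, hi⟩ ⟨j, hj⟩

lemma courant_anchor (e : courantFiber G del x) (i : {i : ι // x ∈ U i}) :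
    (courantAlgebroid G del).anchor x e = (e.1 i).1 := by
  rw [courantFiber_glue e (G.index x) i]
  rfl

lemma courant_smoothNear {a : (courantAlgebroid G del).Sec} (hi : x ∈ U i)
    (ha : ∀ᶠ y in 𝓝 x, (courantAlgebroid G del).SmoothAt a y) :
    GSmoothNear (courantComp G del i a) x := by
  filter_upwards [ha, Opens.eventually_mem hi] with y hy hyi using hy i hyi

/-- The contributions `F(X, Y)` and `F(Y, X)` cancel. -/
lemma symPair_expB {F : CTangent 𝕜 E x →ₗ[ℂ] CTangent 𝕜 E x →ₗ[ℂ] ℂ} (hF : ∀ v, F v v = 0)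
    (e e' : GTangent 𝕜 E x) : symPair (expB F e) (expB F e') = symPair e e' := by
  change 1 / 2 * ((e.2 e'.1 + F e.1 e'.1) + (e'.2 e.1 + F e'.1 e.1)) = _
  rw [neg_flip_of_alt hF e'.1 e.1, symPair]
  ring

/-- Here `F(X, Y)` and `F(Y, X)` are subtracted, so they add up to `2 F(X, Y)`, and the factor `1/2`
leaves `F(X, Y)`. Both the gluing law of the `B_i` and their change under retrivialization come from
this. -/
lemma antiPair_expB {F : CTangent 𝕜 E x →ₗ[ℂ] CTangent 𝕜 E x →ₗ[ℂ] ℂ} (hF : ∀ v, F v v = 0)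
    (e e' : GTangent 𝕜 E x) :
    antiPair x (expB F e) (expB F e') = antiPair x e e' + F e.1 e'.1 := by
  change 1 / 2 * ((e.2 e'.1 + F e.1 e'.1) - (e'.2 e.1 + F e'.1 e.1))
    = 1 / 2 * (e.2 e'.1 - e'.2 e.1) + F e.1 e'.1
  rw [neg_flip_of_alt hF e'.1 e.1]
  ring

variable [FiniteDimensional 𝕜 E] [IsManifold 𝓘(𝕜, E) ∞ M]

lemma IsZeroConnection.isClosedFormNear
    (hdel : IsZeroConnection (tangentAlgebroid 𝕜 E M) G del) (hi : x ∈ U i) (hj : x ∈ U j) :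
    IsClosedFormNear 𝕜 E (fun y => curvature (del i j) y) x :=
  (hdel.conn i j).isClosedFormNear (G.line i j) ⟨hi, hj⟩

lemma courant_pair (hdel : IsZeroConnection (tangentAlgebroid 𝕜 E M) G del)
    (e e' : courantFiber G del x) (i : {i : ι // x ∈ U i}) :
    (courantAlgebroid G del).pair x e e' = symPair (e.1 i) (e'.1 i) := by
  rw [courantFiber_glue e (G.index x) i, courantFiber_glue e' (G.index x) i, symPair_expB
    (hdel.isClosedFormNear (G.index x).2 i.2).alt.self_of_nhds]
  rfl

/-- The curvatures are closed, so the componentwise brackets satisfy the gluing condition and the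
default value in the definition is not taken. -/
lemma courant_bracket (hdel : IsZeroConnection (tangentAlgebroid 𝕜 E M) G del)
    {a b : (courantAlgebroid G del).Sec}
    (ha : ∀ᶠ y in 𝓝 x, (courantAlgebroid G del).SmoothAt a y)
    (hb : ∀ᶠ y in 𝓝 x, (courantAlgebroid G del).SmoothAt b y) (i : {i : ι // x ∈ U i}) :
    ((courantAlgebroid G del).bracket a b x).1 i
      = courantBracket (courantComp G del i.1 a) (courantComp G del i.1 b) x := by
  have h : (fun i : {i : ι // x ∈ U i} =>
      courantBracket (courantComp G del i.1 a) (courantComp G del i.1 b) x)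
        ∈ courantFiber G del x := by
    intro i j
    have hF := hdel.isClosedFormNear i.2 j.2
    rw [← courantBracket_expB hF (courant_smoothNear i.2 ha) (courant_smoothNear i.2 hb)]
    refine courantBracket_congr ?_ ?_
    · filter_upwards [Opens.eventually_mem i.2, Opens.eventually_mem j.2] with y h1 h2 using
        courantComp_glue a h1 h2
    · filter_upwards [Opens.eventually_mem i.2, Opens.eventually_mem j.2] with y h1 h2 using
        courantComp_glue b h1 h2
  have h' : (courantAlgebroid G del).bracket a b x = (⟨_, h⟩ : courantFiber G del x) := dif_pos h
  rw [h']

end CourantAlgebroid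

/-! ### The Lie algebroid structure on D. -/

section DiracAlgebroid

lemma linearIndependent_and_span_of_coe {W α : Type*} [AddCommGroup W] [Module ℂ W]
    {D : Submodule ℂ W} {e : α → W} {e' : α → D} (h : ∀ k, (e' k : W) = e k)
    (hli : LinearIndependent ℂ e) (hs : Submodule.span ℂ (Set.range e) = D) :
    LinearIndependent ℂ e' ∧ Submodule.span ℂ (Set.range e') = ⊤ := by
  obtain rfl : e = fun k => (e' k : W) := funext fun k => (h k).symm
  refine ⟨LinearIndependent.of_comp D.subtype hli, ?_⟩
  apply Submodule.map_injective_of_injective D.injective_subtype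
  rw [Submodule.map_span, Submodule.map_top, Submodule.range_subtype, ← Set.range_comp]
  exact hs

variable {𝕜 : Type uk} [RCLike 𝕜] [NormedAlgebra 𝕜 ℂ]
  {E : Type uE} [NormedAddCommGroup E] [NormedSpace 𝕜 E]
  {M : Type uM} [TopologicalSpace M] [ChartedSpace E M] {ι : Type uι} {U : ι → Opens M}
  {G : Gerbe.{uk, uE, uM, uι, v} 𝕜 E U}
  {del : ∀ i j, ConnOp (tangentAlgebroid 𝕜 E M) (G.L i j)} {x : M} {i j : ι}
  {D : ∀ x, Submodule ℂ ((courantAlgebroid G del).fiber x)}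

/-- A section of `D`, as a section of `E_∂`. -/
def diracVal (a : (diracAlgebroid G del D).Sec) : (courantAlgebroid G del).Sec :=
  fun y => (a y).1

/-- The component in `𝕋U_i` of a section of `D`. -/
def diracSec (i : ι) (a : (diracAlgebroid G del D).Sec) (y : M) : GTangent 𝕜 E y :=
  courantComp G del i (diracVal a) y

lemma diracSec_of_mem (a : (diracAlgebroid G del D).Sec) (hi : x ∈ U i) :
    diracSec i a x = diracComp G del D x ⟨i, hi⟩ (a x) := courantComp_of_mem _ hi

lemma diracComp_injective (i : {i : ι // x ∈ U i}) :
    Function.Injective (diracComp G del D x i) := fun _ _ h =>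
  Subtype.ext (courantFiber_ext i h)

lemma diracComp_anchor (i : {i : ι // x ∈ U i}) (d : (diracAlgebroid G del D).fiber x) :
    (diracAlgebroid G del D).anchor x d = (diracComp G del D x i d).1 :=
  courant_anchor d.1 i

lemma diracComp_glue (i j : {i : ι // x ∈ U i}) (d : (diracAlgebroid G del D).fiber x) :
    diracComp G del D x j d = expB (curvature (del i.1 j.1) x) (diracComp G del D x i d) :=
  courantFiber_glue d.1 i j

lemma diracSec_congr {a a' : (diracAlgebroid G del D).Sec} (h : ∀ᶠ y in 𝓝 x, a y = a' y) (i : ι) :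
    ∀ᶠ y in 𝓝 x, diracSec i a y = diracSec i a' y := by
  filter_upwards [h] with y hy
  unfold diracSec courantComp diracVal
  rw [hy]

lemma dirac_smoothNear {a : (diracAlgebroid G del D).Sec} (hi : x ∈ U i)
    (ha : ∀ᶠ y in 𝓝 x, (diracAlgebroid G del D).SmoothAt a y) : GSmoothNear (diracSec i a) x :=
  courant_smoothNear hi ha

lemma SmoothOn.eventually {L : BundleData.{uM, v} M} {V : Opens M} {s : L.Sec}
    (hs : L.SmoothOn V s) (hx : x ∈ V) : ∀ᶠ y in 𝓝 x, L.SmoothAt s y := by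
  filter_upwards [Opens.eventually_mem hx] with y hy using hs y hy

variable [FiniteDimensional 𝕜 E] [IsManifold 𝓘(𝕜, E) ∞ M]

lemma dirac_isotropic (hdel : IsZeroConnection (tangentAlgebroid 𝕜 E M) G del)
    (hiso : (courantAlgebroid G del).IsIsotropic D) (i : {i : ι // x ∈ U i})
    (d d' : (diracAlgebroid G del D).fiber x) :
    symPair (diracComp G del D x i d) (diracComp G del D x i d') = 0 :=
  (courant_pair hdel d.1 d'.1 i).symm.trans (hiso x _ d.2 _ d'.2)

/-- Involutivity rules out the default value in `restrict`, after which brackets in `D` are Courant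
brackets of components. -/
lemma diracComp_bracket (hdel : IsZeroConnection (tangentAlgebroid 𝕜 E M) G del)
    (hinv : (courantAlgebroid G del).IsInvolutive D) {a b : (diracAlgebroid G del D).Sec}
    (ha : ∀ᶠ y in 𝓝 x, (diracAlgebroid G del D).SmoothAt a y)
    (hb : ∀ᶠ y in 𝓝 x, (diracAlgebroid G del D).SmoothAt b y) (i : {i : ι // x ∈ U i}) :
    diracComp G del D x i ((diracAlgebroid G del D).bracket a b x)
      = courantBracket (diracSec i.1 a) (diracSec i.1 b) x := by
  obtain ⟨V, -, hxV, hV⟩ := exists_opens_le_of_eventually (U := ⊤) (by trivial) (ha.and hb)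
  have hD : (courantAlgebroid G del).bracket (diracVal a) (diracVal b) x ∈ D x :=
    hinv V _ _ (fun y hy => (hV y hy).1) (fun y hy => (hV y hy).2) (fun y _ => (a y).2)
      (fun y _ => (b y).2) x hxV
  have h : (diracAlgebroid G del D).bracket a b x = (⟨_, hD⟩ : D x) := dif_pos hD
  rw [h]
  exact courant_bracket hdel ha hb i

lemma eventually_diracSec_bracket (hdel : IsZeroConnection (tangentAlgebroid 𝕜 E M) G del)
    (hinv : (courantAlgebroid G del).IsInvolutive D) {a b : (diracAlgebroid G del D).Sec}
    (ha : ∀ᶠ y in 𝓝 x, (diracAlgebroid G del D).SmoothAt a y)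
    (hb : ∀ᶠ y in 𝓝 x, (diracAlgebroid G del D).SmoothAt b y) (hi : x ∈ U i) :
    ∀ᶠ y in 𝓝 x, diracSec i ((diracAlgebroid G del D).bracket a b) y
      = courantBracket (diracSec i a) (diracSec i b) y := by
  filter_upwards [Opens.eventually_mem hi, ha.eventually_nhds, hb.eventually_nhds]
    with y hy h1 h2
  rw [diracSec_of_mem _ hy, diracComp_bracket hdel hinv h1 h2]

/-- The point is the smoothness criterion: `restrict` measures smoothness by components in `𝕋U_i`,
and `smoothFunAt_coeff` converts this into smoothness of the coefficients in the frame. -/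
lemma dirac_isVectorBundleOn (hsub : (courantAlgebroid G del).IsSubbundle D) :
    IsVectorBundleOn 𝕜 E ⊤ (diracAlgebroid G del D).toBundleData := by
  classical
  intro x _
  obtain ⟨V, n, e, hxV, hes, he⟩ := hsub x
  have hmem : ∀ y ∈ V, ∀ k, e k y ∈ D y := fun y hy k => by
    rw [← (he y hy).2]
    exact Submodule.subset_span ⟨k, rfl⟩
  -- The frame is known to lie in `D` only over `V`; where it does not, 0 is used.
  let e' : Fin n → (diracAlgebroid G del D).Sec := fun k y =>
    if h : e k y ∈ D y then (⟨e k y, h⟩ : D y) else (0 : D y)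
  have he' : ∀ y ∈ V, ∀ k, diracVal (e' k) y = e k y := fun y hy k => by
    have : e' k y = (⟨e k y, hmem y hy k⟩ : D y) := dif_pos (hmem y hy k)
    rw [diracVal, this]
  have hframe : ∀ y ∈ V, LinearIndependent ℂ (fun k => e' k y) ∧
      Submodule.span ℂ (Set.range fun k => e' k y) = ⊤ := fun y hy =>
    linearIndependent_and_span_of_coe (D := D y) (e := fun k => e k y) (e' := fun k => e' k y)
      (he' y hy) (he y hy).1 (he y hy).2
  refine ⟨V, n, e', hxV, hframe, fun a y hy => ⟨fun ha => ?_, ?_⟩⟩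
  · have hc : ∀ z, ∃ c : Fin n → ℂ, z ∈ V → a z = ∑ k, c k • e' k z := by
      intro z
      by_cases hz : z ∈ V
      · obtain ⟨c, hc⟩ := (Submodule.mem_span_range_iff_exists_fun ℂ).1
          (show a z ∈ Submodule.span ℂ (Set.range fun k => e' k z) by
            rw [(hframe z hz).2]; trivial)
        exact ⟨c, fun _ => hc.symm⟩
      · exact ⟨0, fun h => absurd h hz⟩
    choose c hc using hc
    obtain ⟨i, hi⟩ := G.cover y
    refine ⟨fun k z => c z k, fun k => ?_, ?_⟩
    · refine smoothFunAt_coeff (e := fun k => diracSec i (e' k)) (a := diracSec i a) (fun k => ?_)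
        (ha i hi) ?_ ?_ k
      · refine GSmoothAt.congr (hes k y hy i hi) ?_
        filter_upwards [Opens.eventually_mem hy] with z hz
        unfold diracSec courantComp
        rw [he' z hz k]
      -- Projection to one component is injective on the glued fibre, so linear independence passes
      -- to `𝕋U_i`.
      · have h1 := (he y hy).1.map' (LinearMap.proj ⟨i, hi⟩ ∘ₗ (courantFiber G del y).subtype)
          (LinearMap.ker_eq_bot.2 fun _ _ h => courantFiber_ext ⟨i, hi⟩ h)
        have h2 : (fun k => diracSec i (e' k) y)
            = (LinearMap.proj ⟨i, hi⟩ ∘ₗ (courantFiber G del y).subtype) ∘ fun k => e k y :=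
          funext fun k => (diracSec_of_mem _ hi).trans
            (congrArg (fun e : courantFiber G del y => e.1 ⟨i, hi⟩) (he' y hy k))
        rw [h2]
        exact h1
      · filter_upwards [Opens.eventually_mem hy, Opens.eventually_mem hi] with z hz hzi
        simp only [diracSec_of_mem _ hzi]
        rw [hc z hz, map_sum]
        simp only [map_smul]
    · filter_upwards [Opens.eventually_mem hy] with z hz using hc z hz
  · rintro ⟨c, hc, h⟩ i hi
    have : GSmoothAt (fun z => ∑ k, c k z • diracSec i (e' k) z) y := by
      refine GSmoothAt.sum _ fun k _ => GSmoothAt.smul (hc k) ?_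
      refine GSmoothAt.congr (hes k y hy i hi) ?_
      filter_upwards [Opens.eventually_mem hy] with z hz
      unfold diracSec courantComp
      rw [he' z hz k]
    refine GSmoothAt.congr this ?_
    filter_upwards [h, Opens.eventually_mem hi] with z hz hzi
    refine (diracSec_of_mem a hzi).trans ?_
    rw [hz, map_sum]
    simp only [map_smul, diracSec_of_mem _ hzi]

/-- An involutive isotropic subbundle of `E_∂` is a Lie algebroid. -/
theorem dirac_isLieAlgebroid (hdel : IsZeroConnection (tangentAlgebroid 𝕜 E M) G del)
    (hsub : (courantAlgebroid G del).IsSubbundle D)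
    (hiso : (courantAlgebroid G del).IsIsotropic D)
    (hinv : (courantAlgebroid G del).IsInvolutive D) :
    IsLieAlgebroid (diracAlgebroid G del D) := by
  have hbs : ∀ (V : Opens M) (a b : (diracAlgebroid G del D).Sec),
      (diracAlgebroid G del D).SmoothOn V a → (diracAlgebroid G del D).SmoothOn V b →
      (diracAlgebroid G del D).SmoothOn V ((diracAlgebroid G del D).bracket a b) := by
    intro V a b ha hb x hx i hi
    have ha' := SmoothOn.eventually ha hx
    have hb' := SmoothOn.eventually hb hx
    exact GSmoothAt.congr (courantBracket_smoothNear (dirac_smoothNear hi ha')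
      (dirac_smoothNear hi hb')).self_of_nhds (eventually_diracSec_bracket hdel hinv ha' hb' hi)
  refine ⟨dirac_isVectorBundleOn hsub, ?_, hbs, ?_, ?_, ?_, ?_, ?_, ?_⟩
  · intro V a ha x hx
    obtain ⟨i, hi⟩ := G.cover x
    refine VectorSmoothAt.congr (dirac_smoothNear hi (SmoothOn.eventually ha hx)).fst.self_of_nhds ?_
    filter_upwards [Opens.eventually_mem hi] with y hy
    rw [diracSec_of_mem a hy]
    exact diracComp_anchor ⟨i, hy⟩ (a y)
  · intro V a b a' b' ha hb haa hbb x hx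
    have haa' : ∀ᶠ y in 𝓝 x, a y = a' y := (Opens.eventually_mem hx).mono haa
    have hbb' : ∀ᶠ y in 𝓝 x, b y = b' y := (Opens.eventually_mem hx).mono hbb
    have hcongr : ∀ a a' : (diracAlgebroid G del D).Sec, (∀ y ∈ V, a y = a' y) →
        (diracAlgebroid G del D).SmoothOn V a → (diracAlgebroid G del D).SmoothOn V a' := by
      intro a a' h ha y hy j hj
      exact GSmoothAt.congr (ha y hy j hj) (diracSec_congr
        ((Opens.eventually_mem hy).mono fun z hz => (h z hz).symm) j)
    refine diracComp_injective (G.index x) ?_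
    rw [diracComp_bracket hdel hinv (SmoothOn.eventually ha hx) (SmoothOn.eventually hb hx),
      diracComp_bracket hdel hinv (SmoothOn.eventually (hcongr a a' haa ha) hx)
        (SmoothOn.eventually (hcongr b b' hbb hb) hx)]
    exact courantBracket_congr (diracSec_congr haa' _) (diracSec_congr hbb' _)
  · intro V a b c ha hb hc x hx
    have ha' := SmoothOn.eventually ha hx
    have hb' := SmoothOn.eventually hb hx
    have hc' := SmoothOn.eventually hc hx
    have hbc : ∀ i, ∀ y, y ∈ U i → diracSec i (b + c) y = diracSec i b y + diracSec i c y := by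
      intro i y hy
      simp only [diracSec_of_mem _ hy]
      exact map_add _ _ _
    have hbc' : ∀ᶠ y in 𝓝 x, (diracAlgebroid G del D).SmoothAt (b + c) y := by
      filter_upwards [hb', hc'] with y h1 h2 i hi
      exact GSmoothAt.congr (GSmoothAt.add (h1 i hi) (h2 i hi))
        ((Opens.eventually_mem hi).mono fun z hz => hbc i z hz)
    refine diracComp_injective (G.index x) ?_
    rw [map_add, diracComp_bracket hdel hinv ha' hbc', diracComp_bracket hdel hinv ha' hb',
      diracComp_bracket hdel hinv ha' hc', ← courantBracket_add
        (dirac_smoothNear (G.index x).2 ha') (dirac_smoothNear (G.index x).2 hb')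
        (dirac_smoothNear (G.index x).2 hc')]
    exact courantBracket_congr_right _
      ((Opens.eventually_mem (G.index x).2).mono fun z hz => hbc _ z hz)
  · intro V a b ha hb x hx
    have ha' := SmoothOn.eventually ha hx
    have hb' := SmoothOn.eventually hb hx
    refine diracComp_injective (G.index x) ?_
    rw [map_neg, diracComp_bracket hdel hinv ha' hb', diracComp_bracket hdel hinv hb' ha']
    -- The only axiom that needs isotropy: it removes the defect `2 d⟨a, b⟩`.
    refine courantBracket_skew (dirac_smoothNear (G.index x).2 ha')
      (dirac_smoothNear (G.index x).2 hb') ?_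
    filter_upwards [Opens.eventually_mem (G.index x).2] with y hy
    rw [diracSec_of_mem a hy, diracSec_of_mem b hy]
    exact dirac_isotropic hdel hiso _ _ _
  · intro V a b c ha hb hc x hx
    have ha' := SmoothOn.eventually ha hx
    have hb' := SmoothOn.eventually hb hx
    have hc' := SmoothOn.eventually hc hx
    have hab := SmoothOn.eventually (hbs V a b ha hb) hx
    have hac := SmoothOn.eventually (hbs V a c ha hc) hx
    have hbc := SmoothOn.eventually (hbs V b c hb hc) hx
    have hi := (G.index x).2
    refine diracComp_injective (G.index x) ?_
    -- The outer bracket differentiates the inner one, so inner brackets must be identified with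
    -- Courant brackets on a neighbourhood.
    rw [map_add, diracComp_bracket hdel hinv ha' hbc, diracComp_bracket hdel hinv hab hc',
      diracComp_bracket hdel hinv hb' hac,
      courantBracket_congr_right _
        (eventually_diracSec_bracket hdel hinv hb' hc' hi),
      courantBracket_congr_left _ (eventually_diracSec_bracket hdel hinv ha' hb' hi),
      courantBracket_congr_right _
        (eventually_diracSec_bracket hdel hinv ha' hc' hi)]
    exact courantBracket_jacobi (dirac_smoothNear hi ha') (dirac_smoothNear hi hb')
      (dirac_smoothNear hi hc')
  · intro V f a b hf ha hb x hx
    have ha' := SmoothOn.eventually ha hx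
    have hb' := SmoothOn.eventually hb hx
    have hf' : SmoothFunNear 𝕜 E f x := (Opens.eventually_mem hx).mono hf
    have hfb : ∀ i, ∀ y, y ∈ U i →
        diracSec i ((diracAlgebroid G del D).fmul f b) y = f y • diracSec i b y := by
      intro i y hy
      simp only [diracSec_of_mem _ hy]
      exact map_smul _ _ _
    have hfb' : ∀ᶠ y in 𝓝 x,
        (diracAlgebroid G del D).SmoothAt ((diracAlgebroid G del D).fmul f b) y := by
      filter_upwards [hf', hb'] with y h1 h2 i hi
      exact GSmoothAt.congr (GSmoothAt.smul h1 (h2 i hi))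
        ((Opens.eventually_mem hi).mono fun z hz => hfb i z hz)
    have hi := (G.index x).2
    refine diracComp_injective (G.index x) ?_
    rw [map_add, map_smul, map_smul, diracComp_bracket hdel hinv ha' hfb',
      diracComp_bracket hdel hinv ha' hb',
      courantBracket_congr_right _
        ((Opens.eventually_mem hi).mono fun z hz => hfb _ z hz),
      courantBracket_smul hf' (dirac_smoothNear hi ha') (dirac_smoothNear hi hb'),
      diracSec_of_mem a hi, diracSec_of_mem b hi, LieAlgebroidData.deriv,
      diracComp_anchor (G.index x)]
  · intro V a b ha hb x hx
    have ha' := SmoothOn.eventually ha hx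
    have hb' := SmoothOn.eventually hb hx
    have hi := (G.index x).2
    have h : ∀ a : (diracAlgebroid G del D).Sec, ∀ᶠ y in 𝓝 x,
        (diracSec (G.index x).1 a y).1 = (diracAlgebroid G del D).anchor y (a y) := by
      intro a
      filter_upwards [Opens.eventually_mem hi] with y hy
      rw [diracSec_of_mem a hy]
      exact (diracComp_anchor _ (a y)).symm
    rw [diracComp_anchor (G.index x), diracComp_bracket hdel hinv ha' hb']
    exact vbracket_congr (𝕜 := 𝕜) (E := E) (h a) (h b)

end DiracAlgebroid
-- The canonical D-connection and its flatness.
section DiracConnection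

variable {𝕜 : Type uk} [RCLike 𝕜] [NormedAlgebra 𝕜 ℂ]
  {E : Type uE} [NormedAddCommGroup E] [NormedSpace 𝕜 E]
  {M : Type uM} [TopologicalSpace M] [ChartedSpace E M] {ι : Type uι} {U : ι → Opens M}
  {G : Gerbe.{uk, uE, uM, uι, v} 𝕜 E U}
  {del : ∀ i j, ConnOp (tangentAlgebroid 𝕜 E M) (G.L i j)} {x : M} {i j : ι}
  {D : ∀ x, Submodule ℂ ((courantAlgebroid G del).fiber x)}

lemma diracConnection_one_apply (i : {i : ι // x ∈ U i}) (d d' : (diracAlgebroid G del D).fiber x) :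
    (diracConnection G del D).one i.1 x d d'
      = antiPair x (diracComp G del D x i d) (diracComp G del D x i d') := by
  have h : (diracConnection G del D).one i.1 x
      = (antiPair x).compl₁₂ (diracComp G del D x i) (diracComp G del D x i) := dif_pos i.2
  rw [h]
  rfl

lemma antiPair_apply (e e' : GTangent 𝕜 E x) :
    antiPair x e e' = (1 / 2) * (e.2 e'.1 - e'.2 e.1) := rfl

variable [FiniteDimensional 𝕜 E] [IsManifold 𝓘(𝕜, E) ∞ M]

/-- The canonical connection over `D` on the gerbe. -/
theorem dirac_isGerbeConnection (hdel : IsZeroConnection (tangentAlgebroid 𝕜 E M) G del)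
    (hA : IsLieAlgebroid (diracAlgebroid G del D)) :
    IsGerbeConnection (diracAlgebroid G del D) G (diracConnection G del D) where
  zero :=
    { conn := fun i j => (hdel.conn i j).pullback hA
      dual := fun i j => (hdel.dual i j).pullback
      flat := fun i j k V hV s t hs ht x hx v =>
        hdel.flat i j k V hV s t hs ht x hx ((diracAlgebroid G del D).anchor x v) }
  form i :=
    { alt := fun x hx v => by
        rw [diracConnection_one_apply ⟨i, hx⟩, antiPair_apply, sub_self, mul_zero]
      smooth := fun V hV a b ha hb x hx => by
        have ha' := dirac_smoothNear (hV hx) (SmoothOn.eventually ha hx)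
        have hb' := dirac_smoothNear (hV hx) (SmoothOn.eventually hb hx)
        refine SmoothFunAt.congr ((smoothFunAt_const (1 / 2)).mul
          ((ha'.snd.apply hb'.fst).self_of_nhds.sub (hb'.snd.apply ha'.fst).self_of_nhds)) ?_
        filter_upwards [Opens.eventually_mem (hV hx)] with y hy
        rw [diracConnection_one_apply ⟨i, hy⟩, antiPair_apply, diracSec_of_mem a hy,
          diracSec_of_mem b hy] }
  glue i j x hx := by
    have hF := (hdel.isClosedFormNear hx.1 hx.2).alt.self_of_nhds
    refine LinearMap.ext₂ fun d d' => ?_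
    -- The pulled-back curvature is `F_ij` on vector parts, which is the correction term in
    -- `antiPair_expB`.
    have hc : curvature ((del i j).pullback (diracAlgebroid G del D).anchor) x d d'
        = curvature (del i j) x (diracComp G del D x ⟨i, hx.1⟩ d).1
          (diracComp G del D x ⟨i, hx.1⟩ d').1 := by
      rw [← diracComp_anchor, ← diracComp_anchor,
        (hdel.conn i j).curvature_pullback hA (G.line i j) hx]
      rfl
    refine Eq.trans ?_ hc.symm
    rw [LinearMap.sub_apply, LinearMap.sub_apply, diracConnection_one_apply ⟨j, hx.2⟩,
      diracConnection_one_apply ⟨i, hx.1⟩, diracComp_glue ⟨i, hx.1⟩ ⟨j, hx.2⟩ d,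
      diracComp_glue ⟨i, hx.1⟩ ⟨j, hx.2⟩ d', antiPair_expB hF, add_sub_cancel_left]
    rfl

/-- The canonical connection over `D` is flat. -/
theorem dirac_isFlat (hdel : IsZeroConnection (tangentAlgebroid 𝕜 E M) G del)
    (hiso : (courantAlgebroid G del).IsIsotropic D)
    (hinv : (courantAlgebroid G del).IsInvolutive D) : (diracConnection G del D).IsFlat := by
  intro i V hV a b c ha hb hc x hx
  have hi := hV hx
  have ha' := SmoothOn.eventually ha hx
  have hb' := SmoothOn.eventually hb hx
  have hc' := SmoothOn.eventually hc hx
  have hiso' : ∀ (y : M) (j : {i : ι // y ∈ U i}) (d d' : (diracAlgebroid G del D).fiber y),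
      (diracComp G del D y j d).2 (diracComp G del D y j d').1
        + (diracComp G del D y j d').2 (diracComp G del D y j d).1 = 0 := fun y j d d' =>
    (symPair_eq_zero_iff _ _).1 (dirac_isotropic hdel hiso j d d')
  -- Isotropy gives `ξ(Y) = -η(X)`, so the two halves of `B_i(a, b)` coincide.
  have hB : ∀ a b : (diracAlgebroid G del D).Sec,
      (fun y => (diracConnection G del D).one i y (a y) (b y)) =ᶠ[𝓝 x]
        fun y => (diracSec i a y).2 (diracSec i b y).1 := by
    intro a b
    filter_upwards [Opens.eventually_mem hi] with y hy
    rw [diracConnection_one_apply ⟨i, hy⟩, antiPair_apply, diracSec_of_mem a hy,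
      diracSec_of_mem b hy]
    linear_combination (-1 / 2 : ℂ) * hiso' y ⟨i, hy⟩ (a y) (b y)
  -- For a bracket in the first argument the other half is used, so that only its vector part `[X,
  -- Y]` appears.
  have hbr : ∀ a b c : (diracAlgebroid G del D).Sec,
      (∀ᶠ y in 𝓝 x, (diracAlgebroid G del D).SmoothAt a y) →
      (∀ᶠ y in 𝓝 x, (diracAlgebroid G del D).SmoothAt b y) →
      (diracConnection G del D).one i x ((diracAlgebroid G del D).bracket a b x) (c x)
        = - (diracSec i c x).2
          (vbracket 𝕜 E (fun y => (diracSec i a y).1) (fun y => (diracSec i b y).1) x) := by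
    intro a b c ha hb
    have h := hiso' x ⟨i, hi⟩ ((diracAlgebroid G del D).bracket a b x) (c x)
    rw [diracConnection_one_apply ⟨i, hi⟩, antiPair_apply]
    rw [diracComp_bracket hdel hinv ha hb, ← diracSec_of_mem c hi, courantBracket_eq] at h ⊢
    linear_combination (1 / 2 : ℂ) * h
  have hA := dirac_smoothNear hi ha'
  have hB' := dirac_smoothNear hi hb'
  have hC := dirac_smoothNear hi hc'
  -- This is `2⟨[a, b], c⟩ = 0`; once expanded, its left side is term by term `d_D B_i(a, b, c)`.
  have key := hiso' x ⟨i, hi⟩ ((diracAlgebroid G del D).bracket a b x) (c x)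
  rw [diracComp_bracket hdel hinv ha' hb', ← diracSec_of_mem c hi, courantBracket_eq,
    courantCovector_apply hA.fst hA.snd hB'.fst hB'.snd hC.fst] at key
  have hanc : ∀ a : (diracAlgebroid G del D).Sec,
      (diracAlgebroid G del D).anchor x (a x) = (diracSec i a x).1 := fun a => by
    rw [diracSec_of_mem a hi, diracComp_anchor ⟨i, hi⟩]
  simp only [LieAlgebroidData.d₂, LieAlgebroidData.deriv]
  rw [dfun_congr (hB b c), dfun_congr (hB a c), dfun_congr (hB a b), hbr a b c ha' hb',
    hbr a c b ha' hc', hbr b c a hb' hc', hanc a, hanc b, hanc c]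
  linear_combination key

end DiracConnection
-- Change of local trivialization: the map ψ and the image of D.
section ChangeOfTrivialization

variable {𝕜 : Type uk} [RCLike 𝕜] [NormedAlgebra 𝕜 ℂ]
  {E : Type uE} [NormedAddCommGroup E] [NormedSpace 𝕜 E]
  {M : Type uM} [TopologicalSpace M] [ChartedSpace E M] {ι : Type uι} {U : ι → Opens M}
  {G : Gerbe.{uk, uE, uM, uι, v} 𝕜 E U} {G' : Gerbe.{uk, uE, uM, uι, v'} 𝕜 E U}
  {del : ∀ i j, ConnOp (tangentAlgebroid 𝕜 E M) (G.L i j)}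
  {del' : ∀ i j, ConnOp (tangentAlgebroid 𝕜 E M) (G'.L i j)}
  {R : Retrivialization.{uk, uE, uM, uι, v, v', w} G G'}
  {nab : ∀ i, ConnOp (tangentAlgebroid 𝕜 E M) (R.N i)}
  {nab' : ∀ i, ConnOp (tangentAlgebroid 𝕜 E M) (R.N' i)} {x : M} {i j : ι}

lemma expB_expB (B C : CTangent 𝕜 E x →ₗ[ℂ] CTangent 𝕜 E x →ₗ[ℂ] ℂ) (e : GTangent 𝕜 E x) :
    expB B (expB C e) = expB (B + C) e := by
  refine Prod.ext rfl ?_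
  change e.2 + C e.1 + B e.1 = e.2 + (B e.1 + C e.1)
  abel

lemma expB_zero (e : GTangent 𝕜 E x) : expB 0 e = e :=
  Prod.ext rfl (add_zero _)

variable (𝕜 E) in
/-- The curvature of a connection over the tangent bundle, as a complex 2-form. -/
def tangentCurvature {L : BundleData.{uM, v} M} (D : ConnOp (tangentAlgebroid 𝕜 E M) L) (x : M) :
    CTangent 𝕜 E x →ₗ[ℂ] CTangent 𝕜 E x →ₗ[ℂ] ℂ :=
  curvature D x

variable (del del' nab) in
/-- The curvatures of `del' i j` and `del i j` differ by those of `nab i` and `nab j`. -/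
def CurvatureTransforms : Prop :=
  ∀ (x : M) (i j : ι), x ∈ U i → x ∈ U j → tangentCurvature 𝕜 E (del' i j) x
    = tangentCurvature 𝕜 E (del i j) x + tangentCurvature 𝕜 E (nab i) x
      - tangentCurvature 𝕜 E (nab j) x

/-- The map `E_∂ → E_∂'` induced by a change of local trivialization. -/
def courantEquiv (hF : CurvatureTransforms del del' nab) (x : M) :
    courantFiber G del x ≃ₗ[ℂ] courantFiber G' del' x where
  toFun e := ⟨fun i => expB (- tangentCurvature 𝕜 E (nab i.1) x) (e.1 i), fun i j => by
    -- Writing `F_i` for the curvature of `nab i`, compatibility with gluing is `-F_j + F_ij = F'_ij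
    -- - F_i`.
    change expB (- tangentCurvature 𝕜 E (nab j.1) x) (e.1 j)
      = expB (tangentCurvature 𝕜 E (del' i.1 j.1) x)
        (expB (- tangentCurvature 𝕜 E (nab i.1) x) (e.1 i))
    rw [courantFiber_glue e i j, hF x i j i.2 j.2, expB_expB]
    change expB (- tangentCurvature 𝕜 E (nab j.1) x)
      (expB (tangentCurvature 𝕜 E (del i.1 j.1) x) (e.1 i)) = _
    rw [expB_expB]
    congr 2
    abel⟩
  map_add' e e' := Subtype.ext (funext fun i =>
    (expB (- tangentCurvature 𝕜 E (nab i.1) x)).map_add (e.1 i) (e'.1 i))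
  map_smul' c e := Subtype.ext (funext fun i =>
    (expB (- tangentCurvature 𝕜 E (nab i.1) x)).map_smul c (e.1 i))
  invFun e := ⟨fun i => expB (tangentCurvature 𝕜 E (nab i.1) x) (e.1 i), fun i j => by
    change expB (tangentCurvature 𝕜 E (nab j.1) x) (e.1 j)
      = expB (tangentCurvature 𝕜 E (del i.1 j.1) x)
        (expB (tangentCurvature 𝕜 E (nab i.1) x) (e.1 i))
    rw [courantFiber_glue e i j, expB_expB]
    change expB (tangentCurvature 𝕜 E (nab j.1) x)
      (expB (tangentCurvature 𝕜 E (del' i.1 j.1) x) (e.1 i)) = _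
    rw [hF x i j i.2 j.2, expB_expB]
    congr 2
    abel⟩
  left_inv e := Subtype.ext (funext fun i => by
    change expB (tangentCurvature 𝕜 E (nab i.1) x)
      (expB (- tangentCurvature 𝕜 E (nab i.1) x) (e.1 i)) = e.1 i
    rw [expB_expB, add_neg_cancel, expB_zero])
  right_inv e := Subtype.ext (funext fun i => by
    change expB (- tangentCurvature 𝕜 E (nab i.1) x)
      (expB (tangentCurvature 𝕜 E (nab i.1) x) (e.1 i)) = e.1 i
    rw [expB_expB, neg_add_cancel, expB_zero])

lemma courantComp_courantEquiv (hF : CurvatureTransforms del del' nab)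
    (a : ∀ x, courantFiber G del x) (hi : x ∈ U i) :
    courantComp G' del' i (fun y => courantEquiv hF y (a y)) x
      = expB (- tangentCurvature 𝕜 E (nab i) x) (courantComp G del i a x) := by
  rw [courantComp_of_mem _ hi, courantComp_of_mem _ hi]
  rfl

lemma courantComp_courantEquiv_symm (hF : CurvatureTransforms del del' nab)
    (a : ∀ x, courantFiber G' del' x) (hi : x ∈ U i) :
    courantComp G del i (fun y => (courantEquiv hF y).symm (a y)) x
      = expB (tangentCurvature 𝕜 E (nab i) x) (courantComp G' del' i a x) := by
  rw [courantComp_of_mem _ hi, courantComp_of_mem _ hi]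
  rfl

/-- The image is formed in the product of all components and then restricted to `E_∂'`; nothing is
lost, because the product map already carries `E_∂` into `E_∂'`. -/
lemma image_eq_map (hF : CurvatureTransforms del del' nab)
    (D : ∀ x, Submodule ℂ ((courantAlgebroid G del).fiber x)) (x : M) :
    R.image nab del del' D x
      = Submodule.map (courantEquiv hF x).toLinearMap
        (D x : Submodule ℂ (courantFiber G del x)) := by
  ext e'
  constructor
  · rintro ⟨_, ⟨e, he, rfl⟩, h⟩
    exact ⟨e, he, Subtype.ext h⟩
  · rintro ⟨e, he, rfl⟩
    exact ⟨_, ⟨e, he, rfl⟩, rfl⟩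

section

variable (hN : ∀ i, ∀ x ∈ U i, IsClosedFormNear 𝕜 E (tangentCurvature 𝕜 E (nab i)) x)
  (hF : CurvatureTransforms del del' nab)
include hN

lemma smoothOn_courantEquiv (V : Opens M) (a : ∀ x, courantFiber G del x)
    (ha : (courantAlgebroid G del).SmoothOn V a) :
    (courantAlgebroid G' del').SmoothOn V (fun y => courantEquiv hF y (a y)) := by
  intro x hx i hi
  refine GSmoothAt.congr ((courant_smoothNear hi (SmoothOn.eventually ha hx)).expB
    (hN i x hi).neg).self_of_nhds ?_
  filter_upwards [Opens.eventually_mem hi] with y hy using courantComp_courantEquiv hF a hy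

lemma smoothOn_courantEquiv_symm (V : Opens M) (a : ∀ x, courantFiber G' del' x)
    (ha : (courantAlgebroid G' del').SmoothOn V a) :
    (courantAlgebroid G del).SmoothOn V (fun y => (courantEquiv hF y).symm (a y)) := by
  intro x hx i hi
  refine GSmoothAt.congr ((courant_smoothNear hi (SmoothOn.eventually ha hx)).expB
    (hN i x hi)).self_of_nhds ?_
  filter_upwards [Opens.eventually_mem hi] with y hy using courantComp_courantEquiv_symm hF a hy

omit hN in
lemma isSubbundle_image_aux {W W' α : Type*} [AddCommGroup W] [Module ℂ W] [AddCommGroup W']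
    [Module ℂ W'] (φ : W ≃ₗ[ℂ] W') {e : α → W} {D : Submodule ℂ W} (hli : LinearIndependent ℂ e)
    (hs : Submodule.span ℂ (Set.range e) = D) :
    LinearIndependent ℂ (fun k => φ (e k)) ∧
      Submodule.span ℂ (Set.range fun k => φ (e k)) = D.map φ.toLinearMap := by
  refine ⟨hli.map' φ.toLinearMap φ.ker, ?_⟩
  rw [← hs, Submodule.map_span, ← Set.range_comp]
  rfl

variable {D : ∀ x, Submodule ℂ ((courantAlgebroid G del).fiber x)}

include hF in
lemma isSubbundle_image (hsub : (courantAlgebroid G del).IsSubbundle D) :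
    (courantAlgebroid G' del').IsSubbundle (R.image nab del del' D) := by
  intro x
  obtain ⟨V, n, e, hxV, hes, he⟩ := hsub x
  refine ⟨V, n, fun k y => courantEquiv hF y (e k y), hxV,
    fun k => smoothOn_courantEquiv hN hF V (e k) (hes k), fun y hy => ?_⟩
  rw [image_eq_map hF]
  exact isSubbundle_image_aux (courantEquiv hF y) (he y hy).1 (he y hy).2

variable [FiniteDimensional 𝕜 E] [IsManifold 𝓘(𝕜, E) ∞ M]

include hF in
lemma isIsotropic_image (hdel : IsZeroConnection (tangentAlgebroid 𝕜 E M) G del)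
    (hdel' : IsZeroConnection (tangentAlgebroid 𝕜 E M) G' del')
    (hiso : (courantAlgebroid G del).IsIsotropic D) :
    (courantAlgebroid G' del').IsIsotropic (R.image nab del del' D) := by
  intro x a ha b hb
  rw [image_eq_map hF] at ha hb
  obtain ⟨a, ha, rfl⟩ := ha
  obtain ⟨b, hb, rfl⟩ := hb
  have h := hiso x a ha b hb
  refine (courant_pair hdel' _ _ (G.index x)).trans ?_
  refine (symPair_expB (hN (G.index x).1 x (G.index x).2).neg.alt.self_of_nhds _ _).trans ?_
  exact (courant_pair hdel a b (G.index x)).symm.trans h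

/-- In one component this is `courantBracket_expB` for minus the curvature of `nab i`. -/
lemma courantEquiv_bracket (hdel : IsZeroConnection (tangentAlgebroid 𝕜 E M) G del)
    (hdel' : IsZeroConnection (tangentAlgebroid 𝕜 E M) G' del') {V : Opens M} (hx : x ∈ V)
    {a b : ∀ x, courantFiber G del x} (ha : (courantAlgebroid G del).SmoothOn V a)
    (hb : (courantAlgebroid G del).SmoothOn V b) :
    courantEquiv hF x ((courantAlgebroid G del).bracket a b x)
      = (courantAlgebroid G' del').bracket (fun y => courantEquiv hF y (a y))
        (fun y => courantEquiv hF y (b y)) x := by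
  have ha' := SmoothOn.eventually ha hx
  have hb' := SmoothOn.eventually hb hx
  obtain ⟨i, hi⟩ := G.cover x
  refine courantFiber_ext ⟨i, hi⟩ ?_
  refine Eq.trans ?_ (courant_bracket hdel'
    (SmoothOn.eventually (smoothOn_courantEquiv hN hF V a ha) hx)
    (SmoothOn.eventually (smoothOn_courantEquiv hN hF V b hb) hx) ⟨i, hi⟩).symm
  have h : ∀ a : (∀ x, courantFiber G del x), ∀ᶠ y in 𝓝 x,
      courantComp G' del' i (fun y => courantEquiv hF y (a y)) y
        = expB (- tangentCurvature 𝕜 E (nab i) y) (courantComp G del i a y) := fun a => by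
    filter_upwards [Opens.eventually_mem hi] with y hy using courantComp_courantEquiv hF a hy
  rw [courantBracket_congr (h a) (h b), courantBracket_expB (hN i x hi).neg
    (courant_smoothNear hi ha') (courant_smoothNear hi hb')]
  exact congrArg (expB (- tangentCurvature 𝕜 E (nab i) x))
    (courant_bracket hdel ha' hb' ⟨i, hi⟩)

-- Sections of the image are carried back to `D` by the inverse map, which preserves smoothness;
-- they are bracketed there and sent forward again.
include hF in
lemma isInvolutive_image (hdel : IsZeroConnection (tangentAlgebroid 𝕜 E M) G del)
    (hdel' : IsZeroConnection (tangentAlgebroid 𝕜 E M) G' del')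
    (hinv : (courantAlgebroid G del).IsInvolutive D) :
    (courantAlgebroid G' del').IsInvolutive (R.image nab del del' D) := by
  intro V a b ha hb haD hbD x hx
  have hmem : ∀ a : (∀ x, courantFiber G' del' x), (∀ x ∈ V, a x ∈ R.image nab del del' D x) →
      ∀ x ∈ V, (courantEquiv hF x).symm (a x) ∈ D x := by
    intro a haD y hy
    have h := haD y hy
    rw [image_eq_map hF] at h
    obtain ⟨e, he, h⟩ := h
    have h' : (courantEquiv hF y).symm (a y) = e :=
      (courantEquiv hF y).symm_apply_eq.2 h.symm
    exact h' ▸ he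
  have h1 := smoothOn_courantEquiv_symm hN hF V a ha
  have h2 := smoothOn_courantEquiv_symm hN hF V b hb
  have h3 := hinv V _ _ h1 h2 (hmem a haD) (hmem b hbD) x hx
  have h4 := courantEquiv_bracket hN hF hdel hdel' hx h1 h2
  have h5 : ∀ a : (∀ x, courantFiber G' del' x),
      (fun y => courantEquiv hF y ((courantEquiv hF y).symm (a y))) = a :=
    fun a => funext fun y => (courantEquiv hF y).apply_symm_apply (a y)
  have h6 := congrArg₂ (fun s t => (courantAlgebroid G' del').bracket s t x) (h5 a) (h5 b)
  rw [image_eq_map hF]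
  exact ⟨_, h3, h4.trans h6⟩

end

variable (D : ∀ x, Submodule ℂ ((courantAlgebroid G del).fiber x))

/-- The isomorphism of `D` with its image under a change of local trivialization. -/
def diracEquiv (hF : CurvatureTransforms del del' nab) (x : M) :
    (diracAlgebroid G del D).fiber x ≃ₗ[ℂ]
      (diracAlgebroid G' del' (R.image nab del del' D)).fiber x :=
  LinearEquiv.ofSubmodules (courantEquiv hF x) (D x) (R.image nab del del' D x)
    (image_eq_map hF D x).symm

lemma diracComp_diracEquiv (hF : CurvatureTransforms del del' nab) (x : M)
    (d : (diracAlgebroid G del D).fiber x) (i : {i : ι // x ∈ U i}) :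
    diracComp G' del' (R.image nab del del' D) x i (diracEquiv D hF x d)
      = expB (- tangentCurvature 𝕜 E (nab i.1) x) (diracComp G del D x i d) := rfl

end ChangeOfTrivialization
-- Change of local trivialization: curvatures and the D-connection.
section ChangeOfTrivializationConnection

variable {𝕜 : Type uk} [RCLike 𝕜] [NormedAlgebra 𝕜 ℂ]
  {E : Type uE} [NormedAddCommGroup E] [NormedSpace 𝕜 E]
  [FiniteDimensional 𝕜 E]
  {M : Type uM} [TopologicalSpace M] [ChartedSpace E M] [IsManifold 𝓘(𝕜, E) ∞ M]
  {ι : Type uι} {U : ι → Opens M}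
  {G : Gerbe.{uk, uE, uM, uι, v} 𝕜 E U} {G' : Gerbe.{uk, uE, uM, uι, v'} 𝕜 E U}
  {del : ∀ i j, ConnOp (tangentAlgebroid 𝕜 E M) (G.L i j)}
  {del' : ∀ i j, ConnOp (tangentAlgebroid 𝕜 E M) (G'.L i j)}
  {R : Retrivialization.{uk, uE, uM, uι, v, v', w} G G'}
  {nab : ∀ i, ConnOp (tangentAlgebroid 𝕜 E M) (R.N i)}
  {nab' : ∀ i, ConnOp (tangentAlgebroid 𝕜 E M) (R.N' i)}

/-- Through `κ` the curvature of `del' i j` is the sum of those of `del i j`, `nab i` and `nab' j`;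
by duality the last is minus that of `nab j`. -/
lemma Retrivialization.TransformsZero.curvatureTransforms
    (hT : R.TransformsZero nab nab' del del') (hc : R.IsConn nab nab')
    (hdel : IsZeroConnection (tangentAlgebroid 𝕜 E M) G del)
    (hdel' : IsZeroConnection (tangentAlgebroid 𝕜 E M) G' del') :
    CurvatureTransforms del del' nab := by
  intro x i j hi hj
  have h := curvature_trilinear (G.line i j) (R.line i) (R.line' j) (G'.line i j) le_rfl
    inf_le_left inf_le_right (hdel.conn i j) (hc.conn i) (hc.conn' j) (hdel'.conn i j) (R.κ i j)
    (fun y hy => (R.κ_iso i j y hy).1) (R.κ_smooth i j) (hT i j) (x := x) ⟨hi, hj⟩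
  rw [curvature_dual (R.line j) (R.line' j) (R.ev_dual j) (hc.conn j) (hc.conn' j) (hc.dual j) hj]
    at h
  exact h.trans (sub_eq_add_neg _ _).symm

lemma Retrivialization.IsConn.isClosedFormNear (hc : R.IsConn nab nab') (i : ι) (x : M)
    (hx : x ∈ U i) : IsClosedFormNear 𝕜 E (tangentCurvature 𝕜 E (nab i)) x :=
  (hc.conn i).isClosedFormNear (R.line i) hx

omit [FiniteDimensional 𝕜 E] [IsManifold 𝓘(𝕜, E) ∞ M] in
lemma Retrivialization.IsConn.pullback {A : LieAlgebroidData.{uk, uE, uM, w'} 𝕜 E M}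
    (hA : IsLieAlgebroid A) (hc : R.IsConn nab nab') :
    R.IsConn (fun i => (nab i).pullback A.anchor) (fun i => (nab' i).pullback A.anchor) where
  conn i := (hc.conn i).pullback hA
  conn' i := (hc.conn' i).pullback hA
  dual i := (hc.dual i).pullback

variable {D : ∀ x, Submodule ℂ ((courantAlgebroid G del).fiber x)}

omit [FiniteDimensional 𝕜 E] [IsManifold 𝓘(𝕜, E) ∞ M] in
lemma anchor_diracEquiv (hF : CurvatureTransforms del del' nab) (x : M)
    (d : (diracAlgebroid G del D).fiber x) :
    (diracAlgebroid G' del' (R.image nab del del' D)).anchor x (diracEquiv D hF x d)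
      = (diracAlgebroid G del D).anchor x d := by
  rw [diracComp_anchor (G.index x), diracComp_anchor (G.index x), diracComp_diracEquiv]
  rfl

lemma diracEquiv_isLieAlgebroidIso
    (hN : ∀ i, ∀ x ∈ U i, IsClosedFormNear 𝕜 E (tangentCurvature 𝕜 E (nab i)) x)
    (hF : CurvatureTransforms del del' nab)
    (hdel : IsZeroConnection (tangentAlgebroid 𝕜 E M) G del)
    (hdel' : IsZeroConnection (tangentAlgebroid 𝕜 E M) G' del')
    (hinv : (courantAlgebroid G del).IsInvolutive D) :
    IsLieAlgebroidIso (diracAlgebroid G del D)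
      (diracAlgebroid G' del' (R.image nab del del' D)) (diracEquiv D hF) where
  smooth_iff V a := by
    constructor
    · intro h
      have h' := smoothOn_courantEquiv_symm hN hF V
        (fun y => courantEquiv hF y (diracVal a y)) h
      have h'' : (fun y => (courantEquiv hF y).symm (courantEquiv hF y (diracVal a y)))
          = diracVal a := funext fun y => (courantEquiv hF y).symm_apply_apply _
      rw [h''] at h'
      exact h'
    · exact fun h => smoothOn_courantEquiv hN hF V (diracVal a) h
  anchor x d := anchor_diracEquiv hF x d
  bracket V a b ha hb x hx := by
    have hinv' := isInvolutive_image hN hF hdel hdel' hinv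
    have ha' : ((diracAlgebroid G' del' (R.image nab del del' D))).SmoothOn V
      (fun y => diracEquiv D hF y (a y)) := smoothOn_courantEquiv hN hF V (diracVal a) ha
    have hb' : ((diracAlgebroid G' del' (R.image nab del del' D))).SmoothOn V
      (fun y => diracEquiv D hF y (b y)) := smoothOn_courantEquiv hN hF V (diracVal b) hb
    obtain ⟨i, hi⟩ := G.cover x
    refine diracComp_injective ⟨i, hi⟩ ?_
    have h : ∀ a : (diracAlgebroid G del D).Sec, ∀ᶠ y in 𝓝 x,
        diracSec (D := R.image nab del del' D) i (fun y => diracEquiv D hF y (a y)) y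
          = expB (- tangentCurvature 𝕜 E (nab i) y) (diracSec i a y) := fun a => by
      filter_upwards [Opens.eventually_mem hi] with y hy using
        courantComp_courantEquiv hF (diracVal a) hy
    rw [diracComp_bracket hdel' hinv' (SmoothOn.eventually ha' hx) (SmoothOn.eventually hb' hx),
      diracComp_diracEquiv, diracComp_bracket hdel hinv (SmoothOn.eventually ha hx)
        (SmoothOn.eventually hb hx), courantBracket_congr (h a) (h b),
      courantBracket_expB (hN i x hi).neg (dirac_smoothNear hi (SmoothOn.eventually ha hx))
        (dirac_smoothNear hi (SmoothOn.eventually hb hx))]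

/-- The 0-connection part is the hypothesis evaluated on anchors, which the isomorphism preserves.
The part for `B_i` is `antiPair_expB` for minus the curvature of `nab i`, together with the pullback
formula for curvature. -/
lemma diracConnection_transforms (hF : CurvatureTransforms del del' nab)
    (hA : IsLieAlgebroid (diracAlgebroid G del D)) (hc : R.IsConn nab nab')
    (hT : R.TransformsZero nab nab' del del') :
    R.Transforms (fun i => (nab i).pullback (diracAlgebroid G del D).anchor)
      (fun i => (nab' i).pullback (diracAlgebroid G del D).anchor) (diracConnection G del D)
      ((diracConnection G' del' (R.image nab del del' D)).pullback
        fun x => (diracEquiv D hF x).toLinearMap) where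
  zero i j V hV s n t hs hn ht x hx d := by
    refine Eq.trans ?_ (hT i j V hV s n t hs hn ht x hx ((diracAlgebroid G del D).anchor x d))
    exact congrArg (del' i j (fun y => R.κ i j y (s y) (n y) (t y)) x) (anchor_diracEquiv hF x d)
  one i x hi := by
    have hF' := (hc.isClosedFormNear i x hi).neg.alt.self_of_nhds
    rw [(hc.conn i).curvature_pullback hA (R.line i) hi]
    ext d d'
    refine (diracConnection_one_apply (D := R.image nab del del' D) ⟨i, hi⟩
      (diracEquiv D hF x d) (diracEquiv D hF x d')).trans ?_
    rw [diracComp_diracEquiv, diracComp_diracEquiv, antiPair_expB hF',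
      ← diracConnection_one_apply, ← diracComp_anchor, ← diracComp_anchor]
    exact (sub_eq_add_neg _ _).symm

end ChangeOfTrivializationConnection

end Gerbes

end

/-! ### Assembly of the theorem. -/

theorem mainTheorem10
    {𝕜 : Type*} [RCLike 𝕜] [NormedAlgebra 𝕜 ℂ]
    {E : Type*} [NormedAddCommGroup E] [NormedSpace 𝕜 E] [FiniteDimensional 𝕜 E]
    {M : Type*} [TopologicalSpace M] [ChartedSpace E M] [IsManifold 𝓘(𝕜, E) ∞ M]
    {ι : Type*} {U : ι → Opens M}
    (G : Gerbes.Gerbe 𝕜 E U)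
    (del : ∀ i j, Gerbes.ConnOp (Gerbes.tangentAlgebroid 𝕜 E M) (G.L i j))
    (hdel : Gerbes.IsZeroConnection (Gerbes.tangentAlgebroid 𝕜 E M) G del)
    (D : ∀ x, Submodule ℂ ((Gerbes.courantAlgebroid G del).fiber x))
    (hsub : (Gerbes.courantAlgebroid G del).IsSubbundle D)
    (hiso : (Gerbes.courantAlgebroid G del).IsIsotropic D)
    (hinv : (Gerbes.courantAlgebroid G del).IsInvolutive D) :
    -- `D` is a Lie algebroid, and `G` has a canonical flat connection over it
    Gerbes.IsLieAlgebroid (Gerbes.diracAlgebroid G del D) ∧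
    Gerbes.IsGerbeConnection (Gerbes.diracAlgebroid G del D) G
      (Gerbes.diracConnection G del D) ∧
    (Gerbes.diracConnection G del D).IsFlat ∧
    -- which does not depend on the local trivialization of the gerbe with 0-connection
    ∀ (G' : Gerbes.Gerbe 𝕜 E U)
      (del' : ∀ i j, Gerbes.ConnOp (Gerbes.tangentAlgebroid 𝕜 E M) (G'.L i j))
      (R : Gerbes.Retrivialization G G')
      (nab : ∀ i, Gerbes.ConnOp (Gerbes.tangentAlgebroid 𝕜 E M) (R.N i))
      (nab' : ∀ i, Gerbes.ConnOp (Gerbes.tangentAlgebroid 𝕜 E M) (R.N' i)),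
      Gerbes.IsZeroConnection (Gerbes.tangentAlgebroid 𝕜 E M) G' del' →
      R.IsConn nab nab' →
      R.TransformsZero nab nab' del del' →
      (Gerbes.courantAlgebroid G' del').IsSubbundle (R.image nab del del' D) ∧
      (Gerbes.courantAlgebroid G' del').IsIsotropic (R.image nab del del' D) ∧
      (Gerbes.courantAlgebroid G' del').IsInvolutive (R.image nab del del' D) ∧
      ∃ ψ : ∀ x, (Gerbes.diracAlgebroid G del D).fiber x ≃ₗ[ℂ]
          (Gerbes.diracAlgebroid G' del' (R.image nab del del' D)).fiber x,
        (∀ x d (i : {i : ι // x ∈ U i}),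
          Gerbes.diracComp G' del' (R.image nab del del' D) x i (ψ x d)
            = Gerbes.expB (-Gerbes.curvature (nab i.1) x) (Gerbes.diracComp G del D x i d)) ∧
        Gerbes.IsLieAlgebroidIso (Gerbes.diracAlgebroid G del D)
          (Gerbes.diracAlgebroid G' del' (R.image nab del del' D)) ψ ∧
        R.IsConn (fun i => (nab i).pullback (Gerbes.diracAlgebroid G del D).anchor)
          (fun i => (nab' i).pullback (Gerbes.diracAlgebroid G del D).anchor) ∧
        R.Transforms (fun i => (nab i).pullback (Gerbes.diracAlgebroid G del D).anchor)
          (fun i => (nab' i).pullback (Gerbes.diracAlgebroid G del D).anchor)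
          (Gerbes.diracConnection G del D)
          ((Gerbes.diracConnection G' del' (R.image nab del del' D)).pullback
            fun x => (ψ x).toLinearMap) := by
  have hA := Gerbes.dirac_isLieAlgebroid hdel hsub hiso hinv
  refine ⟨hA, Gerbes.dirac_isGerbeConnection hdel hA, Gerbes.dirac_isFlat hdel hiso hinv, ?_⟩
  intro G' del' R nab nab' hdel' hc hT
  have hF := hT.curvatureTransforms hc hdel hdel'
  exact ⟨Gerbes.isSubbundle_image hc.isClosedFormNear hF hsub,
    Gerbes.isIsotropic_image hc.isClosedFormNear hF hdel hdel' hiso,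
    Gerbes.isInvolutive_image hc.isClosedFormNear hF hdel hdel' hinv,
    Gerbes.diracEquiv D hF, Gerbes.diracComp_diracEquiv D hF,
    Gerbes.diracEquiv_isLieAlgebroidIso hc.isClosedFormNear hF hdel hdel' hinv,
    hc.pullback hA, Gerbes.diracConnection_transforms hF hA hc hT⟩
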